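/- A compactological set is a set $X$ with a non-empty collection $\mathscr C$ of subsets, each $K\in\mathscr C$ carrying a compact Hausdorff topology $\tau_K$, such that $\mathscr C$ covers $X$, is upwards filtering, $\tau_{K_2}=\tau_{K_1}|_{K_2}$ whenever $K_2\subseteq K_1$ are in $\mathscr C$, and every compact subset of a member $(K,\tau_K)$ belongs to $\mathscr C$. A morphism $(X,\mathscr C)\to(X',\mathscr C')$ is a map $f$ such that $f(K)\in\mathscr C'$ and $K\to f(K)$ is continuous for all $K\in\mathscr C$. This gives the category $\mathsf{Cmp}$. For an uncountable strong limit cardinal $\kappa$ let $\mathsf{CHaus}_\kappa$ be the category of compact Hausdorff spaces of cardinality $<\kappa$, and $\mathsf{Cmp}_\kappa\subseteq\mathsf{Cmp}$ the full subcategory of those $(X,\mathscr C)$ with $|K|<\kappa$ for all $K\in\mathscr C$. Let $\mathsf{Cond}_\kappa$ be the category of functors $Y\colon\mathsf{CHaus}_\kappa^{\mathrm{op}}\to\mathsf{Set}$ that send finite coproducts to products and for which every epimorphism $f\colon K\to L$ induces a bijection of $Y(L)$ onto the set of those $\varphi\in Y(K)$ whose two pullbacks to $Y(K\times_LK)$ agree.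 An object of $\mathsf{Cond}_\kappa$ is quasicompact if every jointly epimorphic family of morphisms to it from representables $\underline K$ has a finite jointly epimorphic subfamily. It is quasiseparated if $\underline K\times_Y\underline K$ is quasicompact for all $K\in\mathsf{CHaus}_\kappa$ and all pairs of morphisms $\underline K\rightrightarrows Y$; these objects form the full subcategory $\mathsf{qsCond}_\kappa$. Let $\mathsf{Cond}$ be the category of all condensed sets, the directed colimit of the categories $\mathsf{Cond}_\kappa$ along the left adjoints of the restriction functors; equivalently, the category of sheaves of sets on all compact Hausdorff spaces (in the above sense) which, for some $\kappa$, are freely generated by their restriction to $\mathsf{CHaus}_\kappa$. Theorem. (1) For every uncountable strong limit cardinal $\kappa$, the functor $C\mapsto\mathsf{Cmp}_\kappa(-,C)|_{\mathsf{CHaus}_\kappa}$, where a compact space carries the compactology of all its compact subsets, is a fully faithful embedding $\mathsf{Cmp}_\kappa\hookrightarrow\mathsf{Cond}_\kappa$ with a left adjoint, so that $\mathsf{Cmp}_\kappa$ is a reflective subcategory of $\mathsf{Cond}_\kappa$. The left adjoint preserves all small colimits and finite products. The embedding induces an equivalence $\mathsf{Cmp}_\kappa\cong\mathsf{qsCond}_\kappa$,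 the inclusion $\mathsf{qsCond}_\kappa\subseteq\mathsf{Cond}_\kappa$ has a left adjoint, and the left adjoint above is the composite $\mathsf{Cond}_\kappa\to\mathsf{qsCond}_\kappa\cong\mathsf{Cmp}_\kappa$. (2) The adjunctions lift to the unrestricted categories: $C\mapsto\mathsf{Cmp}(-,C)|_{\mathsf{CHaus}}$ is a fully faithful embedding $\mathsf{Cmp}\hookrightarrow\mathsf{Cond}$ with a left adjoint, which preserves small colimits and finite products. For every $\kappa$ the restriction $\mathsf{Cond}\to\mathsf{Cond}_\kappa$ has a fully faithful left adjoint, whose essential image consists of the condensed sets freely generated by their restriction to $\mathsf{CHaus}_\kappa$. Along these embeddings $\mathsf{Cond}_\kappa\hookrightarrow\mathsf{Cond}$ and the inclusions $\mathsf{Cmp}_\kappa\subseteq\mathsf{Cmp}$, the adjunction between $\mathsf{Cond}$ and $\mathsf{Cmp}$ is compatible with those between $\mathsf{Cond}_\kappa$ and $\mathsf{Cmp}_\kappa$: both the right adjoints and the left adjoints commute with the embeddings up to natural isomorphism, and these isomorphisms respect the units. -/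

import Mathlib

open CategoryTheory CategoryTheory.Limits Opposite

universe u

noncomputable section

/-- A compactological set: a set `carrier` with a non-empty collection `sets` of subsets (the
compactology), each endowed with a compact Hausdorff topology, which covers, is upwards filtering,
has coherent topologies, and is stable under compact subsets. -/
structure Cmp : Type (u + 1) where
  carrier : Type u
  sets : Set (Set carrier)
  top (K : sets) : TopologicalSpace K.1
  nonempty : sets.Nonempty
  compact (K : sets) : @CompactSpace K.1 (top K)
  t2 (K : sets) : @T2Space K.1 (top K)
  cover : ⋃₀ sets = Set.univ
  directed : ∀ K₁ ∈ sets, ∀ K₂ ∈ sets, ∃ K₃ ∈ sets, K₁ ⊆ K₃ ∧ K₂ ⊆ K₃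
  coherent (K₁ K₂ : sets) (h : K₂.1 ⊆ K₁.1) :
    top K₂ = (top K₁).induced (Set.inclusion h)
  stable (K₁ : sets) (K₂ : Set K₁.1) (h : @IsCompact K₁.1 (top K₁) K₂) :
    Subtype.val '' K₂ ∈ sets

namespace Cmp

/-- A map `f` is a morphism if `f(K)` belongs to the compactology of the target and
`K → f(K)` is continuous, for every `K` in the compactology of the source. -/
def IsMorphism (C D : Cmp.{u}) (f : C.carrier → D.carrier) : Prop :=
  ∀ K : C.sets, ∃ h : f '' K.1 ∈ D.sets,
    @Continuous K.1 (f '' K.1) (C.top K) (D.top ⟨f '' K.1, h⟩) (Set.imageFactorization f K.1)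

/-- Morphisms of compactological sets. -/
@[ext]
structure Hom (C D : Cmp.{u}) : Type u where
  toFun : C.carrier → D.carrier
  isMorphism : IsMorphism C D toFun

theorem continuous_congr (D : Cmp.{u}) {T : Type u} [TopologicalSpace T] {A B : Set D.carrier}
    (hAB : A = B) (hA : A ∈ D.sets) (hB : B ∈ D.sets) (g : T → A) (g' : T → B)
    (hg : ∀ t, (g t : D.carrier) = g' t)
    (h : @Continuous T A _ (D.top ⟨A, hA⟩) g) : @Continuous T B _ (D.top ⟨B, hB⟩) g' := by
  subst hAB
  have : g = g' := funext fun t => Subtype.ext (hg t)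
  exact this ▸ h

theorem isMorphism_id (C : Cmp.{u}) : IsMorphism C C id := by
  intro K
  have h : id '' K.1 = K.1 := Set.image_id _
  refine ⟨h.symm ▸ K.2, ?_⟩
  let _ := C.top K
  exact continuous_congr C h.symm K.2 _ id _ (fun _ => rfl) continuous_id

theorem IsMorphism.comp {C D E : Cmp.{u}} {g : D.carrier → E.carrier} {f : C.carrier → D.carrier}
    (hg : IsMorphism D E g) (hf : IsMorphism C D f) : IsMorphism C E (g ∘ f) := by
  intro K
  obtain ⟨h₁, c₁⟩ := hf K
  obtain ⟨h₂, c₂⟩ := hg ⟨_, h₁⟩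
  have h : (g ∘ f) '' K.1 = g '' (f '' K.1) := Set.image_comp _ _ _
  refine ⟨h.symm ▸ h₂, ?_⟩
  let _ := C.top K
  let _ := D.top ⟨_, h₁⟩
  let _ := E.top ⟨_, h₂⟩
  exact continuous_congr E h.symm h₂ _ _ _ (fun _ => rfl) (c₂.comp c₁)

instance : Category.{u} Cmp.{u} where
  Hom C D := Hom C D
  id C := ⟨id, isMorphism_id C⟩
  comp f g := ⟨g.toFun ∘ f.toFun, g.isMorphism.comp f.isMorphism⟩

/-- A compact Hausdorff space, as a compactological set: the compactology consists of all compact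
subsets, with the subspace topologies. -/
def ofCompHaus (K : CompHaus.{u}) : Cmp.{u} where
  carrier := K
  sets := {A | IsCompact A}
  top _ := instTopologicalSpaceSubtype
  nonempty := ⟨∅, isCompact_empty⟩
  compact A := isCompact_iff_compactSpace.mp A.2
  t2 A := inferInstanceAs (T2Space A.1)
  cover := Set.eq_univ_of_forall fun x => ⟨{x}, isCompact_singleton, rfl⟩
  directed A hA B hB := ⟨A ∪ B, IsCompact.union hA hB, Set.subset_union_left, Set.subset_union_right⟩
  coherent _ _ h := (induced_compose (f := Set.inclusion h) (g := Subtype.val)).symm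
  stable _ _ h := h.image continuous_subtype_val

theorem isMorphism_of_continuous {K L : CompHaus.{u}} {f : K → L} (hf : Continuous f) :
    IsMorphism (ofCompHaus K) (ofCompHaus L) f := fun A =>
  ⟨IsCompact.image (X := K) (s := A.1) A.2 hf, (hf.comp continuous_subtype_val).subtype_mk _⟩

/-- The embedding of compact Hausdorff spaces into compactological sets. -/
def fromCompHaus : CompHaus.{u} ⥤ Cmp.{u} where
  obj := ofCompHaus
  map f := ⟨f, isMorphism_of_continuous f.hom.hom.continuous⟩

/-- The restricted Yoneda embedding `C ↦ Cmp(ι(-), C)`, with values in presheaves of sets on compact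
Hausdorff spaces. -/
def yo : Cmp.{u} ⥤ CompHaus.{u}ᵒᵖ ⥤ Type u :=
  yoneda ⋙ (Functor.whiskeringLeft _ _ _).obj fromCompHaus.op

end Cmp

/-- An uncountable strong limit cardinal. -/
structure StrongLimitCard : Type (u + 1) where
  card : Cardinal.{u}
  aleph0_lt : Cardinal.aleph0 < card
  isStrongLimit : card.IsStrongLimit

variable (κ : StrongLimitCard.{u})

/-- The `κ`-small compact Hausdorff spaces. -/
def IsSmallCompHaus : ObjectProperty CompHaus.{u} := fun K => Cardinal.mk K < κ.card

/-- The category `CHaus_κ`. -/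
abbrev CHaus : Type (u + 1) := (IsSmallCompHaus κ).FullSubcategory

/-- The compactological sets all of whose distinguished subsets are `κ`-small. -/
def IsSmallCmp : ObjectProperty Cmp.{u} := fun C => ∀ K ∈ C.sets, Cardinal.mk K < κ.card

/-- The category `Cmp_κ`. -/
abbrev CmpK : Type (u + 1) := (IsSmallCmp κ).FullSubcategory

namespace CmpK

/-- The embedding `CHaus_κ ⥤ Cmp_κ`. -/
def fromCHaus : CHaus κ ⥤ CmpK κ :=
  ObjectProperty.lift _ ((IsSmallCompHaus κ).ι ⋙ Cmp.fromCompHaus)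
    fun K A _ => (Cardinal.mk_set_le A).trans_lt K.property

/-- The restricted Yoneda embedding `C ↦ Cmp_κ(ι(-), C)`, with values in presheaves on `CHaus_κ`. -/
def yo : CmpK κ ⥤ (CHaus κ)ᵒᵖ ⥤ Type u :=
  yoneda ⋙ (Functor.whiskeringLeft _ _ _).obj (fromCHaus κ).op

/-- The inclusion `Cmp_κ ⥤ Cmp`. -/
abbrev incl : CmpK κ ⥤ Cmp.{u} := (IsSmallCmp κ).ι

end CmpK

/-- A presheaf of sets `X` (on a category of compact spaces) is condensed if it maps finite
coproducts to products, and if for every epimorphism `f : K ⟶ L` with kernel pair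
`π₁, π₂ : M = K ×_L K ⟶ K`, the map `X(f)` is a bijection of `X(L)` onto the set of all
`φ ∈ X(K)` with `X(π₁)(φ) = X(π₂)(φ)`. -/
def IsCondensed {C : Type (u + 1)} [Category.{u} C] : ObjectProperty (Cᵒᵖ ⥤ Type u) := fun X =>
  PreservesFiniteProducts X ∧
  ∀ ⦃K L M : C⦄ (f : K ⟶ L) (π₁ π₂ : M ⟶ K), Epi f → IsPullback π₁ π₂ f f →
    Set.BijOn (X.map f.op) Set.univ {φ | X.map π₁.op φ = X.map π₂.op φ}

/-- The category `Cond_κ` of `κ`-condensed sets. -/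
abbrev CondK : Type (u + 1) := (IsCondensed (C := CHaus κ)).FullSubcategory


namespace CHaus

variable {κ}

theorem mk_prod_lt {A B : Type u} (hA : Cardinal.mk A < κ.card) (hB : Cardinal.mk B < κ.card) :
    Cardinal.mk (A × B) < κ.card := by
  rw [Cardinal.mk_prod, Cardinal.lift_id, Cardinal.lift_id]
  exact Cardinal.mul_lt_of_lt κ.aleph0_lt.le hA hB

theorem mk_sigma_lt {α : Type} [Finite α] (A : α → Type u) (hA : ∀ a, Cardinal.mk (A a) < κ.card) :
    Cardinal.mk (Σ a, A a) < κ.card := by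
  rcases isEmpty_or_nonempty α with h | h
  · rw [Cardinal.mk_eq_zero]
    exact Cardinal.aleph0_pos.trans κ.aleph0_lt
  · obtain ⟨a₀, h₀⟩ := Finite.exists_max fun a => Cardinal.mk (A a)
    rw [Cardinal.mk_sigma]
    refine (Cardinal.sum_le_sum _ (fun _ => Cardinal.mk (A a₀)) h₀).trans_lt ?_
    rw [Cardinal.sum_const, Cardinal.lift_uzero]
    refine Cardinal.mul_lt_of_lt κ.aleph0_lt.le (lt_trans ?_ κ.aleph0_lt) (hA a₀)
    rw [Cardinal.lift_lt_aleph0]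
    exact Cardinal.mk_lt_aleph0

theorem surjective_of_epi {K L : CHaus κ} (f : K ⟶ L) [Epi f] : Function.Surjective f.hom := by
  by_contra hf
  simp only [Function.Surjective, not_forall, not_exists] at hf
  obtain ⟨y, hy⟩ := hf
  have hC : IsClosed (Set.range f.hom) := (isCompact_range f.hom.hom.hom.continuous).isClosed
  have hCD : Disjoint (Set.range f.hom) {y} := by
    rw [Set.disjoint_singleton_right]
    rintro ⟨y', hy'⟩
    exact hy y' hy'
  obtain ⟨φ, hφ0, hφ1, hφ01⟩ := exists_continuous_zero_one_of_isClosed hC isClosed_singleton hCD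
  have : CompactSpace (ULift.{u} <| Set.Icc (0 : ℝ) 1) := Homeomorph.ulift.symm.compactSpace
  have : T2Space (ULift.{u} <| Set.Icc (0 : ℝ) 1) := Homeomorph.ulift.symm.t2Space
  have hI : Cardinal.mk (ULift.{u} <| Set.Icc (0 : ℝ) 1) < κ.card := by
    rw [Cardinal.mk_uLift, Cardinal.mk_Icc_real zero_lt_one, Cardinal.lift_continuum,
      ← Cardinal.two_power_aleph0]
    exact κ.isStrongLimit.isStrongPrelimit κ.aleph0_lt
  let Z : CHaus κ := ⟨CompHaus.of (ULift.{u} <| Set.Icc (0 : ℝ) 1), hI⟩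
  let g : L ⟶ Z := ObjectProperty.homMk (CompHausLike.ofHom _
    ⟨fun y' => ⟨⟨φ y', hφ01 y'⟩⟩,
      continuous_uliftUp.comp (φ.continuous.subtype_mk fun y' => hφ01 y')⟩)
  let h : L ⟶ Z := ObjectProperty.homMk (CompHausLike.ofHom _
    ⟨fun _ => ⟨⟨0, Set.left_mem_Icc.mpr zero_le_one⟩⟩, continuous_const⟩)
  have H : h = g := by
    rw [← cancel_epi f]
    ext x : 5
    simp [g, h, Z, hφ0 (Set.mem_range_self x)]
  have H' : (h.hom y).down.1 = (g.hom y).down.1 := by rw [H]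
  have : (0 : ℝ) = φ y := H'
  rw [hφ1 (Set.mem_singleton y)] at this
  exact zero_ne_one this

instance preservesFiniteCoproducts_ι : PreservesFiniteCoproducts (IsSmallCompHaus κ).ι where
  preserves n := by
    refine ⟨fun {F} => ?_⟩
    let X : Fin n → CompHaus.{u} := fun a => (F.obj ⟨a⟩).obj
    let e : F ⋙ (IsSmallCompHaus κ).ι ≅ Discrete.functor X := Discrete.natIso fun _ => Iso.refl _
    have hc := (IsColimit.precomposeHomEquiv e _).symm (CompHausLike.finiteCoproduct.isColimit X)
    have hP : IsSmallCompHaus κ ((Cocone.precompose e.hom).obj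
        (CompHausLike.finiteCoproduct.cofan X)).pt :=
      mk_sigma_lt (fun a : Fin n => (X a : Type u)) fun a => (F.obj ⟨a⟩).property
    have := createsColimitFullSubcategoryInclusion' F hc hP
    have : HasColimit (F ⋙ (IsSmallCompHaus κ).ι) := ⟨⟨⟨_, hc⟩⟩⟩
    infer_instance

instance preservesPullback_ι {K L M : CHaus κ} (f : K ⟶ M) (g : L ⟶ M) :
    PreservesLimit (cospan f g) (IsSmallCompHaus κ).ι := by
  let e : cospan f g ⋙ (IsSmallCompHaus κ).ι ≅ cospan f.hom g.hom := cospanCompIso _ _ _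
  have hc := (IsLimit.postcomposeInvEquiv e _).symm (CompHausLike.pullback.isLimit f.hom g.hom)
  have hP : IsSmallCompHaus κ ((Cone.postcompose e.inv).obj
      (CompHausLike.pullback.cone f.hom g.hom)).pt :=
    (Cardinal.mk_set_le _).trans_lt (mk_prod_lt K.property L.property)
  have := createsLimitFullSubcategoryInclusion' (cospan f g) hc hP
  have : HasLimit (cospan f g ⋙ (IsSmallCompHaus κ).ι) := ⟨⟨⟨_, hc⟩⟩⟩
  infer_instance

/-- Restricting a condensed presheaf on all compact spaces to the `κ`-small ones. -/
theorem isCondensed_restrict {X : CompHaus.{u}ᵒᵖ ⥤ Type u} (hX : IsCondensed X) :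
    IsCondensed ((IsSmallCompHaus κ).ι.op ⋙ X) := by
  have := hX.1
  have : PreservesFiniteProducts (IsSmallCompHaus κ).ι.op := preservesFiniteProducts_op _
  refine ⟨inferInstance, fun K L M f π₁ π₂ hf h => ?_⟩
  refine hX.2 _ _ _ ?_ (h.map (IsSmallCompHaus κ).ι)
  exact (CompHaus.epi_iff_surjective _).2 (surjective_of_epi f)

/-- Representable presheaves are condensed. -/
theorem isCondensed_yoneda (T : CHaus κ) : IsCondensed (yoneda.obj T) := by
  refine ⟨inferInstance, fun K L M f π₁ π₂ hf h => ⟨?_, ?_, ?_⟩⟩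
  · intro ψ _
    change π₁ ≫ f ≫ ψ = π₂ ≫ f ≫ ψ
    rw [h.w_assoc]
  · intro ψ _ ψ' _ e
    exact (cancel_epi f).1 e
  · intro φ hφ
    have hs := surjective_of_epi f
    replace hφ : π₁ ≫ φ = π₂ ≫ φ := hφ
    have hq : Topology.IsQuotientMap f.hom :=
      (f.hom.hom.hom.continuous.isClosedMap).isQuotientMap f.hom.hom.hom.continuous hs
    have hfib : ∀ a b : K.obj, f.hom a = f.hom b → φ.hom a = φ.hom b := by
      intro a b hab
      let P : CHaus κ := ⟨CompHaus.of PUnit.{u + 1}, by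
        refine lt_trans ?_ κ.aleph0_lt
        exact Cardinal.mk_lt_aleph0⟩
      let pt (x : K.obj) : P ⟶ K :=
        ObjectProperty.homMk (CompHausLike.ofHom _ ⟨fun _ => x, continuous_const⟩)
      have hw : pt a ≫ f = pt b ≫ f := by
        ext x : 5
        exact hab
      have : pt a ≫ φ = pt b ≫ φ := by
        rw [← h.lift_fst _ _ hw, Category.assoc, hφ, ← Category.assoc, h.lift_snd]
      exact congrArg (fun k : P ⟶ T => k.hom PUnit.unit) this
    let ψ : L ⟶ T := ObjectProperty.homMk (CompHausLike.ofHom _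
      (hq.lift φ.hom.hom.hom hfib))
    refine ⟨ψ, trivial, ?_⟩
    change f ≫ ψ = φ
    ext x : 5
    exact congrArg (fun k : C(K.obj, T.obj) => k x) (hq.lift_comp φ.hom.hom.hom hfib)

end CHaus

namespace CondK

/-- The representable `κ`-condensed set attached to a `κ`-small compact space. -/
def rep : CHaus κ ⥤ CondK κ := ObjectProperty.lift _ yoneda CHaus.isCondensed_yoneda

variable {κ}

/-- A family of morphisms from representables is a covering if it is jointly epimorphic, i.e. if
the induced map from the coproduct is an epimorphism in `Cond_κ`. -/
def IsCovering {X : CondK κ} {I : Type u} (K : I → CHaus κ) (φ : ∀ i, (rep κ).obj (K i) ⟶ X) :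
    Prop :=
  ∀ ⦃Y : CondK κ⦄ (g h : X ⟶ Y), (∀ i, φ i ≫ g = φ i ≫ h) → g = h

/-- Every covering by representables has a finite subcovering. -/
def IsQuasicompact (X : CondK κ) : Prop :=
  ∀ ⦃I : Type u⦄ (K : I → CHaus κ) (φ : ∀ i, (rep κ).obj (K i) ⟶ X), IsCovering K φ →
    ∃ s : Finset I, IsCovering (fun i : s => K i) (fun i : s => φ i)

/-- Every pullback of two morphisms `K ⟶ X` with `K` representable is quasicompact. -/
def IsQuasiseparated : ObjectProperty (CondK κ) := fun X =>
  ∀ ⦃K : CHaus κ⦄ (f g : (rep κ).obj K ⟶ X) ⦃Z : CondK κ⦄ (p q : Z ⟶ (rep κ).obj K),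
    IsPullback p q f g → IsQuasicompact Z

end CondK

/-- The category `qsCond_κ` of quasiseparated `κ`-condensed sets. -/
abbrev QsCondK : Type (u + 1) := (CondK.IsQuasiseparated (κ := κ)).FullSubcategory

/-- A sheaf `X` on all compact spaces is `κ`-generated if it is the free sheaf on its restriction to
`CHaus_κ`, i.e. if it is the value at `X|_κ` of the left adjoint of the restriction of sheaves from
all compact spaces to `CHaus_κ`: morphisms from `X` to any sheaf `Y` are the same as morphisms
from `X|_κ` to `Y|_κ`. -/
def IsKGenerated (X : CompHaus.{u}ᵒᵖ ⥤ Type u) : Prop :=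
  ∀ ⦃Y : CompHaus.{u}ᵒᵖ ⥤ Type u⦄, IsCondensed Y →
    Function.Bijective fun η : X ⟶ Y => Functor.whiskerLeft (IsSmallCompHaus κ).ι.op η

/-- Condensed sets without a fixed size restriction: sheaves of sets on all compact spaces that
are `κ`-generated for some uncountable strong limit cardinal `κ`. -/
def IsCondensedSet : ObjectProperty (CompHaus.{u}ᵒᵖ ⥤ Type u) := fun X =>
  IsCondensed X ∧ ∃ κ : StrongLimitCard.{u}, IsKGenerated κ X

/-- The category `Cond` of all condensed sets, which is the directed colimit of the categories
`Cond_κ` along the left adjoints of the restriction functors. -/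
abbrev Cond : Type (u + 1) := (IsCondensedSet.{u}).FullSubcategory

/-- The restriction functor `Cond ⥤ Cond_κ`. -/
def Cond.res : Cond.{u} ⥤ CondK κ :=
  ObjectProperty.lift _
    (IsCondensedSet.ι ⋙ (Functor.whiskeringLeft _ _ _).obj (IsSmallCompHaus κ).ι.op)
    fun X => CHaus.isCondensed_restrict X.property.1

/-- The inclusion `Cmp_κ ⥤ Cond_κ` given by the restricted Yoneda embedding, once the latter is known
to take values in `κ`-condensed sets. -/
def CmpK.toCond (h : ∀ C : CmpK κ, IsCondensed ((CmpK.yo κ).obj C)) : CmpK κ ⥤ CondK κ :=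
  ObjectProperty.lift _ (CmpK.yo κ) h

/-- The inclusion `Cmp ⥤ Cond` given by the restricted Yoneda embedding, once the latter is known
to take values in condensed sets. -/
def Cmp.toCond (h : ∀ C : Cmp.{u}, IsCondensedSet (Cmp.yo.obj C)) : Cmp.{u} ⥤ Cond.{u} :=
  ObjectProperty.lift _ Cmp.yo h

end

universe w

noncomputable section

variable (κ : StrongLimitCard.{u})

/-! ### Finite products in terms of elements -/

/-! Everything is read off from points. A section over `K` of a condensed set `X` gives a map from
`K` to the set `X(*)` of points. For the condensed set of a compactological set `C` the sections are
exactly the continuous maps to members of `C`. So a natural transformation between two such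
condensed sets is determined on points, and its values on the inclusions of members show that the
map on points is a morphism: the embedding is fully faithful.

For the left adjoint, divide `X(*)` by the smallest equivalence relation whose pullback along every
section is closed. The images of the sections, with quotient topologies, are compact Hausdorff
(`t2Space_coinduced_of_isClosed`), filtering because two sections amalgamate over a coproduct, and
stable under closed subsets by restriction; `Cmp.Atlas` turns such data into a compactological set.
A morphism to a compactological set has a closed kernel on points, hence factors uniquely
(`Reflection.existsUnique_desc`). Finite products are preserved because the minimal relation on a
product can be handled one variable at a time, the other being constant (`Reflection.rel_pair`), and
because sections over `K × L` provide enough charts. Preservation of colimits is formal.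

To pass from `κ` to all compact spaces, the free sheaf is written down directly: a section over `T`
is a section of `X` over a `κ`-small `K` with a closed correspondence from `T` to `K` whose
ambiguity the section does not see. A sheaf is `κ`-generated exactly if its sections are locally
pulled back from `κ`-small spaces (`isKGenerated_of_isLocallyKSmall`,
`CondK.isLocallyKSmall_of_isKGenerated`); what makes this work is that the image of any compact
space in a product of two `κ`-small ones is `κ`-small. The adjunction for `κ` is the unrestricted
one restricted along fully faithful functors, which gives the compatibility of units.

For quasiseparatedness, epimorphic families are tested against one condensed set, that of ideals of
closed subsets: given a covering family of `Z` and a morphism from `Z` to a representable, the image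
of any section is covered by the images of finitely many members
(`CondK.exists_finite_of_isCovering`). Hence representables are quasicompact, and the kernel pair of
a section of a quasiseparated `X` is controlled by finitely many closed relations
(`CondK.exists_finite_kernel`). So coincidence on points is a closed relation, sections are
determined by their points, and `X` comes from a compactology on `X(*)` (`CondK.bijective_toOfCmp`).
Conversely, for a compactological set the fibre products in question are represented by closed
subspaces of `K × K`. -/

theorem preservesFiniteProducts_of_existsUnique {C : Type*} [Category* C] (X : Cᵒᵖ ⥤ Type*)
    (H : ∀ (n : ℕ) (A : Fin n → C), ∃ c : Cofan A, Nonempty (IsColimit c) ∧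
      ∀ x : ∀ a, X.obj (op (A a)), ∃! y : X.obj (op c.pt), ∀ a, X.map (c.inj a).op y = x a) :
    PreservesFiniteProducts X := by
  refine ⟨fun n => ⟨fun {F} => ?_⟩⟩
  let A : Fin n → C := fun a => (F.obj ⟨a⟩).unop
  obtain ⟨c, ⟨hc⟩, h⟩ := H n A
  suffices PreservesLimit (Discrete.functor fun a => op (A a)) X from
    preservesLimit_of_iso_diagram X
      (Discrete.natIso fun _ => Iso.refl _ : Discrete.functor (fun a => op (A a)) ≅ F)
  refine preservesLimit_of_preserves_limit_cone (Cofan.IsColimit.op hc) ?_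
  refine ((Types.isLimit_iff _).2 fun s hs => ?_).some
  obtain ⟨y, hy, hy'⟩ := h fun a => s ⟨a⟩
  refine ⟨y, fun ⟨a⟩ => hy a, fun z hz => hy' z fun a => hz ⟨a⟩⟩

theorem existsUnique_of_preservesFiniteProducts {C : Type*} [Category* C] (X : Cᵒᵖ ⥤ Type*)
    [PreservesFiniteProducts X] {α : Type*} [Finite α] {A : α → C} {c : Cofan A}
    (hc : IsColimit c) (x : ∀ a, X.obj (op (A a))) :
    ∃! y : X.obj (op c.pt), ∀ a, X.map (c.inj a).op y = x a := by
  have h := (Types.isLimit_iff _).1 ⟨isLimitOfPreserves X (Cofan.IsColimit.op hc)⟩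
    (fun j => x j.as) (by
      rintro ⟨i⟩ ⟨j⟩ ⟨⟨f⟩⟩
      obtain rfl : i = j := f
      exact Functor.map_id_apply (Discrete.functor (fun a => op (A a)) ⋙ X) ⟨i⟩ _)
  obtain ⟨y, hy, hy'⟩ := h
  exact ⟨y, fun a => hy ⟨a⟩, fun z hz => hy' z fun ⟨a⟩ => hz a⟩

/-! ### Presheaves of sets in terms of elements -/

namespace Psh

section

variable {C : Type*} [Category* C]

/-- The restriction of a section of a presheaf along a morphism. -/
def pb (X : Cᵒᵖ ⥤ Type*) {K L : C} (f : K ⟶ L) (x : X.obj (op L)) : X.obj (op K) := X.map f.op x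

theorem pb_id (X : Cᵒᵖ ⥤ Type*) {K : C} (x : X.obj (op K)) : pb X (𝟙 K) x = x :=
  Functor.map_id_apply X _ x

theorem pb_comp (X : Cᵒᵖ ⥤ Type*) {K L M : C} (f : K ⟶ L) (g : L ⟶ M) (x : X.obj (op M)) :
    pb X (f ≫ g) x = pb X f (pb X g x) :=
  Functor.map_comp_apply X _ _ x

theorem app_pb {X Y : Cᵒᵖ ⥤ Type w} (η : X ⟶ Y) {K L : C} (f : K ⟶ L) (x : X.obj (op L)) :
    η.app (op K) (pb X f x) = pb Y f (η.app (op L) x) :=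
  NatTrans.naturality_apply η f.op x

theorem hom_ext {X Y : Cᵒᵖ ⥤ Type w} {η θ : X ⟶ Y}
    (h : ∀ (K : C) (x : X.obj (op K)), η.app (op K) x = θ.app (op K) x) : η = θ := by
  ext K x
  exact h K.unop x

/-- A presheaf of sets given by its sections and restriction maps. -/
def mk (F : C → Type w) (r : ∀ {K L : C}, (K ⟶ L) → F L → F K)
    (r_id : ∀ (K : C) (x : F K), r (𝟙 K) x = x)
    (r_comp : ∀ {K L M : C} (f : K ⟶ L) (g : L ⟶ M) (x : F M), r (f ≫ g) x = r f (r g x)) :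
    Cᵒᵖ ⥤ Type w where
  obj K := F K.unop
  map f := ↾(r f.unop)
  map_id K := by ext x; exact r_id _ x
  map_comp f g := by ext x; exact r_comp _ _ x

/-- A morphism of presheaves given by its effect on sections. -/
def homMk {X Y : Cᵒᵖ ⥤ Type w} (t : ∀ K : C, X.obj (op K) → Y.obj (op K))
    (ht : ∀ {K L : C} (f : K ⟶ L) (x : X.obj (op L)), t K (pb X f x) = pb Y f (t L x)) :
    X ⟶ Y where
  app K := ↾(t K.unop)
  naturality K L f := by ext x; exact ht f.unop x

theorem isIso_of_bijective {X Y : Cᵒᵖ ⥤ Type w} (η : X ⟶ Y)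
    (h : ∀ K : C, Function.Bijective (η.app (op K))) : IsIso η := by
  have (K : Cᵒᵖ) : IsIso (η.app K) := (isIso_iff_bijective _).2 (h K.unop)
  exact NatIso.isIso_of_isIso_app η

end

section

variable {C : Type (u + 1)} [Category.{u} C] {X : Cᵒᵖ ⥤ Type u}

/-- Every pair `a`, `b` equalized by `f` factors through the kernel pair, so the gluing condition
may be phrased with all such pairs and no pullback has to be chosen. -/
theorem isCondensed_of [PreservesFiniteProducts X]
    (inj : ∀ ⦃K L : C⦄ (f : K ⟶ L), Epi f → Function.Injective (pb X f))
    (glue : ∀ ⦃K L : C⦄ (f : K ⟶ L), Epi f → ∀ φ : X.obj (op K),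
      (∀ (E : C) (a b : E ⟶ K), a ≫ f = b ≫ f → pb X a φ = pb X b φ) → ∃ ψ, pb X f ψ = φ) :
    IsCondensed X := by
  refine ⟨inferInstance, fun K L M f π₁ π₂ hf h => ⟨fun ψ _ => ?_, (inj f hf).injOn, fun φ hφ => ?_⟩⟩
  · change pb X π₁ (pb X f ψ) = pb X π₂ (pb X f ψ)
    rw [← pb_comp, ← pb_comp, h.w]
  · obtain ⟨ψ, hψ⟩ := glue f hf φ fun E a b hab => by
      rw [← h.lift_fst a b hab, pb_comp]
      conv_rhs => rw [← h.lift_snd a b hab, pb_comp]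
      exact congrArg _ hφ
    exact ⟨ψ, trivial, hψ⟩

theorem injective_of_isCondensed [HasPullbacks C] (hX : IsCondensed X) {K L : C} (f : K ⟶ L)
    [Epi f] : Function.Injective (pb X f) :=
  fun _ _ h => (hX.2 f _ _ inferInstance (IsPullback.of_hasPullback f f)).injOn trivial trivial h

theorem exists_pb_eq_of_isCondensed [HasPullbacks C] (hX : IsCondensed X) {K L : C} (f : K ⟶ L)
    [Epi f] (φ : X.obj (op K))
    (hφ : ∀ (E : C) (a b : E ⟶ K), a ≫ f = b ≫ f → pb X a φ = pb X b φ) : ∃ ψ, pb X f ψ = φ := by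
  obtain ⟨ψ, -, hψ⟩ := (hX.2 f _ _ inferInstance (IsPullback.of_hasPullback f f)).surjOn
    (hφ _ _ _ pullback.condition)
  exact ⟨ψ, hψ⟩

theorem isCondensed_of_iso [HasPullbacks C] {Y : Cᵒᵖ ⥤ Type u} (e : X ≅ Y) (hX : IsCondensed X) :
    IsCondensed Y := by
  have := hX.1
  have : PreservesFiniteProducts Y := ⟨fun n => preservesLimitsOfShape_of_natIso e⟩
  have hi (K : C) : Function.Injective (e.inv.app (op K)) :=
    ((isIso_iff_bijective _).1 inferInstance).1
  have hs (K : C) (y : Y.obj (op K)) : ∃ x, e.hom.app (op K) x = y :=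
    ((isIso_iff_bijective _).1 (inferInstanceAs (IsIso (e.hom.app (op K))))).2 y
  refine isCondensed_of (fun K L f hf y y' h => hi _ ?_) fun K L f hf φ hφ => ?_
  · apply injective_of_isCondensed hX f
    rw [← app_pb, ← app_pb, h]
  · obtain ⟨ψ, hψ⟩ := exists_pb_eq_of_isCondensed hX f (e.inv.app _ φ) fun E a b hab => by
      rw [← app_pb, ← app_pb, hφ E a b hab]
    refine ⟨e.hom.app _ ψ, hi _ ?_⟩
    rw [← app_pb, hψ]
    simp

end

end Psh

/-! ### Constructions with compact Hausdorff spaces -/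

namespace CompHaus

/-- A continuous map, as a morphism of compact Hausdorff spaces. -/
def homOf {K L : CompHaus.{u}} (f : C(K, L)) : K ⟶ L := CompHausLike.ofHom _ f

theorem continuous_hom {K L : CompHaus.{u}} (f : K ⟶ L) : Continuous f := f.hom.hom.continuous

/-- A closed subspace of a compact Hausdorff space. -/
def sub (K : CompHaus.{u}) (A : Set K) (hA : IsClosed A) : CompHaus.{u} :=
  have := isCompact_iff_compactSpace.1 hA.isCompact
  CompHaus.of A

/-- The one-point space. -/
abbrev pt : CompHaus.{u} := CompHaus.of PUnit.{u + 1}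

/-- The morphism from the one-point space given by a point. -/
def point {K : CompHaus.{u}} (x : K) : pt ⟶ K := homOf ⟨fun _ => x, continuous_const⟩

theorem preservesFiniteProducts_of (X : CompHaus.{u}ᵒᵖ ⥤ Type w)
    (H : ∀ (n : ℕ) (A : Fin n → CompHaus.{u}) (x : ∀ a, X.obj (op (A a))),
      ∃! y : X.obj (op (CompHausLike.finiteCoproduct A)),
        ∀ a, Psh.pb X (CompHausLike.finiteCoproduct.ι A a) y = x a) :
    PreservesFiniteProducts X :=
  preservesFiniteProducts_of_existsUnique X fun n A =>
    ⟨CompHausLike.finiteCoproduct.cofan A, ⟨CompHausLike.finiteCoproduct.isColimit A⟩, H n A⟩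

theorem existsUnique_glue {X : CompHaus.{u}ᵒᵖ ⥤ Type u} (hX : IsCondensed X) {α : Type} [Finite α]
    (A : α → CompHaus.{u}) (x : ∀ a, X.obj (op (A a))) :
    ∃! y : X.obj (op (CompHausLike.finiteCoproduct A)),
      ∀ a, Psh.pb X (CompHausLike.finiteCoproduct.ι A a) y = x a := by
  have := hX.1
  exact existsUnique_of_preservesFiniteProducts X (CompHausLike.finiteCoproduct.isColimit A) x

end CompHaus

namespace CHaus

variable {κ}

/-- A continuous map, as a morphism of `κ`-small compact spaces. -/
def homOf {K L : CHaus κ} (f : C(K.obj, L.obj)) : K ⟶ L :=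
  ObjectProperty.homMk (CompHaus.homOf f)

theorem hom_ext {K L : CHaus κ} {f g : K ⟶ L} (h : ∀ x, f.hom x = g.hom x) : f = g := by
  ext x : 5
  exact h x

theorem epi_of_surjective {K L : CHaus κ} (f : K ⟶ L) (hf : Function.Surjective f.hom) :
    Epi f :=
  ⟨fun g h e => hom_ext fun y => by
    obtain ⟨x, rfl⟩ := hf y
    exact congrArg (fun k : K ⟶ _ => k.hom x) e⟩

/-- A closed subspace of a `κ`-small compact space. -/
def sub (K : CHaus κ) (A : Set K.obj) (hA : IsClosed A) : CHaus κ :=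
  ⟨CompHaus.sub K.obj A hA, (Cardinal.mk_set_le A).trans_lt K.property⟩

/-- The product of two `κ`-small compact spaces. -/
def prod (K L : CHaus κ) : CHaus κ :=
  ⟨CompHaus.of (K.obj × L.obj), mk_prod_lt K.property L.property⟩

/-- The finite coproduct of `κ`-small compact spaces. -/
def sigma {α : Type} [Finite α] (A : α → CHaus κ) : CHaus κ :=
  ⟨CompHausLike.finiteCoproduct fun a => (A a).obj, mk_sigma_lt _ fun a => (A a).property⟩

/-- The inclusions into a finite coproduct. -/
def sigmaι {α : Type} [Finite α] (A : α → CHaus κ) (a : α) : A a ⟶ sigma A :=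
  ObjectProperty.homMk (CompHausLike.finiteCoproduct.ι (fun a => (A a).obj) a)

/-- The map out of a finite coproduct. -/
def sigmaDesc {α : Type} [Finite α] (A : α → CHaus κ) {B : CHaus κ} (f : ∀ a, A a ⟶ B) :
    sigma A ⟶ B :=
  ObjectProperty.homMk (CompHausLike.finiteCoproduct.desc (fun a => (A a).obj) fun a => (f a).hom)

theorem sigmaι_desc {α : Type} [Finite α] (A : α → CHaus κ) {B : CHaus κ} (f : ∀ a, A a ⟶ B)
    (a : α) : sigmaι A a ≫ sigmaDesc A f = f a := rfl

/-- The coproduct cofan is a colimit. -/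
def isColimitSigma {α : Type} [Finite α] (A : α → CHaus κ) :
    IsColimit (Cofan.mk (sigma A) (sigmaι A)) :=
  Cofan.IsColimit.mk _ (fun s => sigmaDesc A s.inj) (fun _ a => sigmaι_desc A _ a) fun s _ hm =>
    hom_ext fun ⟨a, x⟩ => congrArg (fun k : A a ⟶ s.pt => k.hom x) (hm a)

theorem preservesFiniteProducts_of (X : (CHaus κ)ᵒᵖ ⥤ Type w)
    (H : ∀ (n : ℕ) (A : Fin n → CHaus κ) (x : ∀ a, X.obj (op (A a))),
      ∃! y : X.obj (op (sigma A)), ∀ a, Psh.pb X (sigmaι A a) y = x a) :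
    PreservesFiniteProducts X :=
  preservesFiniteProducts_of_existsUnique X fun n A => ⟨_, ⟨isColimitSigma A⟩, H n A⟩

theorem existsUnique_glue {X : (CHaus κ)ᵒᵖ ⥤ Type u} (hX : IsCondensed X) {α : Type} [Finite α]
    (A : α → CHaus κ) (x : ∀ a, X.obj (op (A a))) :
    ∃! y : X.obj (op (sigma A)), ∀ a, Psh.pb X (sigmaι A a) y = x a := by
  have := hX.1
  exact existsUnique_of_preservesFiniteProducts X (isColimitSigma A) x

instance : HasPullbacks (CHaus κ) := by
  have (K L M : CHaus κ) (f : K ⟶ M) (g : L ⟶ M) : HasLimit (cospan f g) := by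
    let e : cospan f g ⋙ (IsSmallCompHaus κ).ι ≅ cospan f.hom g.hom := cospanCompIso _ _ _
    have hc := (IsLimit.postcomposeInvEquiv e _).symm (CompHausLike.pullback.isLimit f.hom g.hom)
    have hP : IsSmallCompHaus κ ((Cone.postcompose e.inv).obj
        (CompHausLike.pullback.cone f.hom g.hom)).pt :=
      (Cardinal.mk_set_le _).trans_lt (mk_prod_lt K.property L.property)
    have := createsLimitFullSubcategoryInclusion' (cospan f g) hc hP
    have : HasLimit (cospan f g ⋙ (IsSmallCompHaus κ).ι) := ⟨⟨⟨_, hc⟩⟩⟩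
    exact hasLimit_of_created _ (IsSmallCompHaus κ).ι
  exact hasPullbacks_of_hasLimit_cospan _

/-- The one-point space. -/
def pt : CHaus κ := ⟨CompHaus.pt, lt_trans Cardinal.mk_lt_aleph0 κ.aleph0_lt⟩

/-- The morphism from the one-point space given by a point. -/
def point {K : CHaus κ} (x : K.obj) : (pt : CHaus κ) ⟶ K := ObjectProperty.homMk (CompHaus.point x)

variable {X : (CHaus κ)ᵒᵖ ⥤ Type u}

theorem pb_injective (hX : IsCondensed X) {K L : CHaus κ} (f : K ⟶ L)
    (hf : Function.Surjective f.hom) : Function.Injective (Psh.pb X f) :=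
  have := epi_of_surjective f hf
  Psh.injective_of_isCondensed hX f

theorem exists_pb_eq (hX : IsCondensed X) {K L : CHaus κ} (f : K ⟶ L)
    (hf : Function.Surjective f.hom) (φ : X.obj (op K))
    (hφ : ∀ (E : CHaus κ) (a b : E ⟶ K), (∀ e, f.hom (a.hom e) = f.hom (b.hom e)) →
      Psh.pb X a φ = Psh.pb X b φ) : ∃ ψ, Psh.pb X f ψ = φ :=
  have := epi_of_surjective f hf
  Psh.exists_pb_eq_of_isCondensed hX f φ fun E a b hab =>
    hφ E a b fun e => congrArg (fun k : E ⟶ L => k.hom e) hab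

theorem isCondensed_of
    (H : ∀ (n : ℕ) (A : Fin n → CHaus κ) (x : ∀ a, X.obj (op (A a))),
      ∃! y : X.obj (op (sigma A)), ∀ a, Psh.pb X (sigmaι A a) y = x a)
    (inj : ∀ ⦃K L : CHaus κ⦄ (f : K ⟶ L), Function.Surjective f.hom →
      Function.Injective (Psh.pb X f))
    (glue : ∀ ⦃K L : CHaus κ⦄ (f : K ⟶ L), Function.Surjective f.hom → ∀ φ : X.obj (op K),
      (∀ (E : CHaus κ) (a b : E ⟶ K), (∀ e, f.hom (a.hom e) = f.hom (b.hom e)) →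
        Psh.pb X a φ = Psh.pb X b φ) → ∃ ψ, Psh.pb X f ψ = φ) :
    IsCondensed X :=
  have := preservesFiniteProducts_of X H
  Psh.isCondensed_of (fun _ _ f _ => inj f (surjective_of_epi f)) fun _ _ f _ φ hφ =>
    glue f (surjective_of_epi f) φ fun E a b hab => hφ E a b (hom_ext hab)

/-- Sections agree if they agree on the members of a finite jointly surjective family. -/
theorem eq_of_finite_cover (hX : IsCondensed X) {α : Type w} [Finite α] {A : α → CHaus κ}
    {B : CHaus κ} (f : ∀ a, A a ⟶ B) (hf : ∀ b, ∃ a x, (f a).hom x = b) {x y : X.obj (op B)}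
    (h : ∀ a, Psh.pb X (f a) x = Psh.pb X (f a) y) : x = y := by
  obtain ⟨n, ⟨e⟩⟩ := Finite.exists_equiv_fin α
  apply pb_injective hX (sigmaDesc (fun i => A (e.symm i)) fun i => f (e.symm i))
  · intro b
    obtain ⟨a, x, rfl⟩ := hf b
    obtain ⟨i, rfl⟩ := e.symm.surjective a
    exact ⟨⟨i, x⟩, rfl⟩
  · refine (existsUnique_glue hX _ fun i => Psh.pb X (f (e.symm i)) x).unique (fun i => ?_)
      fun i => ?_
    · rw [← Psh.pb_comp, sigmaι_desc]
    · rw [← Psh.pb_comp, sigmaι_desc, h]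

end CHaus

namespace CompHaus

variable {X : CompHaus.{u}ᵒᵖ ⥤ Type u}

theorem pb_injective (hX : IsCondensed X) {K L : CompHaus.{u}} (f : K ⟶ L)
    (hf : Function.Surjective f) : Function.Injective (Psh.pb X f) :=
  have := (CompHaus.epi_iff_surjective f).2 hf
  Psh.injective_of_isCondensed hX f

theorem exists_pb_eq (hX : IsCondensed X) {K L : CompHaus.{u}} (f : K ⟶ L)
    (hf : Function.Surjective f) (φ : X.obj (op K))
    (hφ : ∀ (E : CompHaus.{u}) (a b : E ⟶ K), (∀ e, f (a e) = f (b e)) →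
      Psh.pb X a φ = Psh.pb X b φ) : ∃ ψ, Psh.pb X f ψ = φ :=
  have := (CompHaus.epi_iff_surjective f).2 hf
  Psh.exists_pb_eq_of_isCondensed hX f φ fun E a b hab =>
    hφ E a b fun e => congrArg (fun k : E ⟶ L => k e) hab

theorem hom_ext' {K L : CompHaus.{u}} {f g : K ⟶ L} (h : ∀ x, f x = g x) : f = g := by
  ext x
  exact h x

theorem isCondensed_of
    (H : ∀ (n : ℕ) (A : Fin n → CompHaus.{u}) (x : ∀ a, X.obj (op (A a))),
      ∃! y : X.obj (op (CompHausLike.finiteCoproduct A)),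
        ∀ a, Psh.pb X (CompHausLike.finiteCoproduct.ι A a) y = x a)
    (inj : ∀ ⦃K L : CompHaus.{u}⦄ (f : K ⟶ L), Function.Surjective f →
      Function.Injective (Psh.pb X f))
    (glue : ∀ ⦃K L : CompHaus.{u}⦄ (f : K ⟶ L), Function.Surjective f → ∀ φ : X.obj (op K),
      (∀ (E : CompHaus.{u}) (a b : E ⟶ K), (∀ e, f (a e) = f (b e)) →
        Psh.pb X a φ = Psh.pb X b φ) → ∃ ψ, Psh.pb X f ψ = φ) :
    IsCondensed X :=
  have := preservesFiniteProducts_of X H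
  Psh.isCondensed_of (fun _ _ f _ => inj f ((CompHaus.epi_iff_surjective f).1 ‹_›))
    fun _ _ f _ φ hφ => glue f ((CompHaus.epi_iff_surjective f).1 ‹_›) φ fun E a b hab =>
      hφ E a b (hom_ext' hab)

end CompHaus

/-! ### A local criterion for being `κ`-generated -/

/-- Every section of `Z` is locally pulled back from a `κ`-small compact space. -/
def IsLocallyKSmall (Z : CompHaus.{u}ᵒᵖ ⥤ Type u) : Prop :=
  ∀ (T : CompHaus.{u}) (z : Z.obj (op T)), ∃ (S : CompHaus.{u}) (p : S ⟶ T) (K : CHaus κ)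
    (g : S ⟶ K.obj) (w : Z.obj (op K.obj)), Function.Surjective p ∧ Psh.pb Z p z = Psh.pb Z g w

section

variable {κ}

variable {Z Y : CompHaus.{u}ᵒᵖ ⥤ Type u}

/-- The effect on sections of a morphism between restrictions to `κ`-small spaces. -/
def resApp (τ : (IsSmallCompHaus κ).ι.op ⋙ Z ⟶ (IsSmallCompHaus κ).ι.op ⋙ Y) (K : CHaus κ)
    (w : Z.obj (op K.obj)) : Y.obj (op K.obj) := τ.app (op K) w

theorem resApp_pb (τ : (IsSmallCompHaus κ).ι.op ⋙ Z ⟶ (IsSmallCompHaus κ).ι.op ⋙ Y)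
    {K L : CHaus κ} (f : K ⟶ L) (w : Z.obj (op L.obj)) :
    resApp τ K (Psh.pb Z f.hom w) = Psh.pb Y f.hom (resApp τ L w) :=
  Psh.app_pb τ f w

/-- The image of `S` in `K × K'` is `κ`-small even if `S` is not. The equality of the two sections
descends from `S` to this image, where `τ` is available. -/
theorem pb_resApp_eq (hZ : IsCondensed Z)
    (τ : (IsSmallCompHaus κ).ι.op ⋙ Z ⟶ (IsSmallCompHaus κ).ι.op ⋙ Y)
    {S : CompHaus.{u}} {K K' : CHaus κ} (g : S ⟶ K.obj) (g' : S ⟶ K'.obj) (w : Z.obj (op K.obj))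
    (w' : Z.obj (op K'.obj)) (h : Psh.pb Z g w = Psh.pb Z g' w') :
    Psh.pb Y g (resApp τ K w) = Psh.pb Y g' (resApp τ K' w') := by
  let q : C(S, K.obj × K'.obj) := ⟨fun s => (g s, g' s),
    (CompHaus.continuous_hom g).prodMk (CompHaus.continuous_hom g')⟩
  let A : CHaus κ := (CHaus.prod K K').sub (Set.range q) (isCompact_range q.continuous).isClosed
  let r : S ⟶ A.obj := CompHaus.homOf ⟨Set.rangeFactorization q, q.continuous.subtype_mk _⟩
  let a : A ⟶ K := CHaus.homOf ⟨fun x => x.1.1, continuous_fst.comp continuous_subtype_val⟩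
  let b : A ⟶ K' := CHaus.homOf ⟨fun x => x.1.2, continuous_snd.comp continuous_subtype_val⟩
  have hr : Function.Surjective r := Set.rangeFactorization_surjective
  have ha : r ≫ a.hom = g := rfl
  have hb : r ≫ b.hom = g' := rfl
  rw [← ha, ← hb, Psh.pb_comp, Psh.pb_comp] at h ⊢
  rw [← resApp_pb, ← resApp_pb, CompHaus.pb_injective hZ r hr h]

/-- The extension of `τ` is obtained by descent along one local presentation of `z`. Asserting the
formula for every presentation, not only the chosen one, makes naturality immediate later. -/
theorem exists_extend_section (hZ : IsCondensed Z) (hY : IsCondensed Y) (h : IsLocallyKSmall κ Z)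
    (τ : (IsSmallCompHaus κ).ι.op ⋙ Z ⟶ (IsSmallCompHaus κ).ι.op ⋙ Y) {T : CompHaus.{u}}
    (z : Z.obj (op T)) : ∃ y : Y.obj (op T), ∀ (S : CompHaus.{u}) (p : S ⟶ T) (K : CHaus κ)
      (g : S ⟶ K.obj) (w : Z.obj (op K.obj)), Psh.pb Z p z = Psh.pb Z g w →
        Psh.pb Y p y = Psh.pb Y g (resApp τ K w) := by
  obtain ⟨S₀, p₀, K₀, g₀, w₀, hp₀, h₀⟩ := h T z
  obtain ⟨y, hy⟩ := CompHaus.exists_pb_eq hY p₀ hp₀ (Psh.pb Y g₀ (resApp τ K₀ w₀))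
    fun E a b hab => by
      rw [← Psh.pb_comp, ← Psh.pb_comp]
      refine pb_resApp_eq hZ τ _ _ _ _ ?_
      rw [Psh.pb_comp, Psh.pb_comp, ← h₀, ← Psh.pb_comp, ← Psh.pb_comp,
        show a ≫ p₀ = b ≫ p₀ from CompHaus.hom_ext' hab]
  refine ⟨y, fun S p K g w hw => ?_⟩
  -- The given presentation is compared with the chosen one over their fibre product, which surjects
  -- onto `S`.
  let E : CompHaus.{u} := CompHaus.sub (CompHaus.of (S × S₀)) {x | p x.1 = p₀ x.2}
    (isClosed_eq ((CompHaus.continuous_hom p).comp continuous_fst)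
      ((CompHaus.continuous_hom p₀).comp continuous_snd))
  let a : E ⟶ S := CompHaus.homOf ⟨fun x => x.1.1, continuous_fst.comp continuous_subtype_val⟩
  let b : E ⟶ S₀ := CompHaus.homOf ⟨fun x => x.1.2, continuous_snd.comp continuous_subtype_val⟩
  have hab : a ≫ p = b ≫ p₀ := CompHaus.hom_ext' fun x => x.2
  have ha : Function.Surjective a := fun s => by
    obtain ⟨s₀, hs₀⟩ := hp₀ (p s)
    exact ⟨⟨(s, s₀), hs₀.symm⟩, rfl⟩
  apply CompHaus.pb_injective hY a ha
  rw [← Psh.pb_comp, hab, Psh.pb_comp, hy, ← Psh.pb_comp, ← Psh.pb_comp]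
  refine pb_resApp_eq hZ τ _ _ _ _ ?_
  rw [Psh.pb_comp, Psh.pb_comp, ← h₀, ← hw, ← Psh.pb_comp, ← Psh.pb_comp, hab]

theorem isKGenerated_of_isLocallyKSmall (hZ : IsCondensed Z) (h : IsLocallyKSmall κ Z) :
    IsKGenerated κ Z := by
  intro Y hY
  refine ⟨fun η θ e => Psh.hom_ext fun T z => ?_, fun τ => ?_⟩
  · obtain ⟨S, p, K, g, w, hp, hw⟩ := h T z
    apply CompHaus.pb_injective hY p hp
    rw [← Psh.app_pb, ← Psh.app_pb, hw, Psh.app_pb, Psh.app_pb]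
    exact congrArg _ (ConcreteCategory.congr_hom (NatTrans.congr_app e (op K)) w)
  · choose t ht using fun (T : CompHaus.{u}) (z : Z.obj (op T)) =>
      exists_extend_section hZ hY h τ z
    refine ⟨Psh.homMk t fun {T' T} f z => ?_, ?_⟩
    · obtain ⟨S, p, K, g, w, hp, hw⟩ := h T' (Psh.pb Z f z)
      apply CompHaus.pb_injective hY p hp
      rw [ht _ _ S p K g w hw, ← Psh.pb_comp, ht _ _ S (p ≫ f) K g w (by rw [Psh.pb_comp, hw])]
    · refine Psh.hom_ext fun K w => ?_
      -- Over a `κ`-small space a section presents itself, so the extension restricts to `τ`.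
      have := ht K.obj w K.obj (𝟙 _) K (𝟙 _) w rfl
      rwa [Psh.pb_id, Psh.pb_id] at this

theorem IsLocallyKSmall.of_iso (e : Z ≅ Y) (h : IsLocallyKSmall κ Z) : IsLocallyKSmall κ Y := by
  intro T y
  obtain ⟨S, p, K, g, w, hp, hw⟩ := h T (e.inv.app _ y)
  refine ⟨S, p, K, g, e.hom.app _ w, hp, ?_⟩
  rw [← Psh.app_pb, ← hw, Psh.app_pb]
  simp

theorem IsLocallyKSmall.mono {κ' : StrongLimitCard.{u}} (hκ : κ.card ≤ κ'.card)
    (h : IsLocallyKSmall κ Z) : IsLocallyKSmall κ' Z := by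
  intro T z
  obtain ⟨S, p, K, g, w, hp, hw⟩ := h T z
  exact ⟨S, p, ⟨K.obj, K.property.trans_le hκ⟩, g, w, hp, hw⟩

end

/-! ### The free sheaf on a `κ`-condensed set

A section over `T` of the free sheaf on `X` is represented by a section of `X` over a `κ`-small `K`
together with a closed correspondence from `T` to `K`. -/

namespace FreeSheaf

section Small

/-- A set of representatives for `κ`-small compact spaces. -/
def Model : Type u :=
  Σ A : Set κ.card.out, {τ : TopologicalSpace A //
    @CompactSpace A τ ∧ @T2Space A τ ∧ Cardinal.mk A < κ.card}

variable {κ}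

/-- The compact space attached to a representative. -/
def Model.toCHaus (j : Model κ) : CHaus κ :=
  let _ := j.2.1
  have := j.2.2.1
  have := j.2.2.2.1
  ⟨CompHaus.of j.1, j.2.2.2.2⟩

/-- Transporting the topology to a subset of a fixed set of cardinality `κ` bounds the `κ`-small
spaces up to isomorphism by a type in universe `u`; the free sheaf then takes values in `Type u`. -/
theorem exists_model (K : CHaus κ) : ∃ j : Model κ, Nonempty (K ≅ j.toCHaus) := by
  have h : Cardinal.mk K.obj ≤ Cardinal.mk κ.card.out := by
    rw [Cardinal.mk_out]
    exact K.property.le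
  obtain ⟨i⟩ := (Cardinal.le_def _ _).1 h
  let e : K.obj ≃ Set.range i := Equiv.ofInjective i i.injective
  let τ : TopologicalSpace (Set.range i) := TopologicalSpace.induced e.symm inferInstance
  let h : Set.range i ≃ₜ K.obj := e.symm.toHomeomorphOfIsInducing ⟨rfl⟩
  have h₁ : CompactSpace (Set.range i) := h.symm.compactSpace
  have h₂ : T2Space (Set.range i) := h.symm.t2Space
  refine ⟨⟨Set.range i, τ, h₁, h₂, ?_⟩, ⟨ObjectProperty.isoMk _ (CompHausLike.isoOfHomeo h.symm)⟩⟩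
  rw [← Cardinal.mk_congr e]
  exact K.property

end Small

variable {κ} (X : (CHaus κ)ᵒᵖ ⥤ Type u)

/-- A representative of a section of the free sheaf on `X`: a closed correspondence to a `κ`-small
space `K` and a section of `X` over `K` that does not see the ambiguity of the correspondence. -/
structure PreSec (T : CompHaus.{u}) : Type (u + 1) where
  K : CHaus κ
  Γ : Set (T × K.obj)
  isClosed : IsClosed Γ
  total : ∀ t, ∃ k, (t, k) ∈ Γ
  sec : X.obj (op K)
  compat : ∀ (E : CHaus κ) (a b : E ⟶ K), (∀ e, ∃ t, (t, a.hom e) ∈ Γ ∧ (t, b.hom e) ∈ Γ) →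
    Psh.pb X a sec = Psh.pb X b sec

namespace PreSec

variable {X} {T : CompHaus.{u}}

/-- Two representatives are equivalent if the sections agree along the correspondences. -/
def Rel (s s' : PreSec X T) : Prop :=
  ∀ (E : CHaus κ) (a : E ⟶ s.K) (b : E ⟶ s'.K),
    (∀ e, ∃ t, (t, a.hom e) ∈ s.Γ ∧ (t, b.hom e) ∈ s'.Γ) → Psh.pb X a s.sec = Psh.pb X b s'.sec

theorem Rel.refl (s : PreSec X T) : Rel s s := s.compat

theorem Rel.symm {s s' : PreSec X T} (h : Rel s s') : Rel s' s := fun E a b hab =>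
  (h E b a fun e => (hab e).imp fun _ => And.symm).symm

/-- The natural fibre product over `T` need not be `κ`-small, so only its image `F` in `E × s'.K` is
kept. `F` is closed because `T` is compact, and surjects onto `E` because `s'` is total. -/
theorem Rel.trans (hX : IsCondensed X) {s s' s'' : PreSec X T} (h : Rel s s') (h' : Rel s' s'') :
    Rel s s'' := by
  intro E a b hab
  let W : Set (T × (E.obj × s'.K.obj)) :=
    {x | (x.1, a.hom x.2.1) ∈ s.Γ ∧ (x.1, x.2.2) ∈ s'.Γ ∧ (x.1, b.hom x.2.1) ∈ s''.Γ}
  have ha := CompHaus.continuous_hom a.hom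
  have hb := CompHaus.continuous_hom b.hom
  have hW : IsClosed W := by
    refine IsClosed.inter (s.isClosed.preimage (by fun_prop))
      (IsClosed.inter (s'.isClosed.preimage (by fun_prop)) (s''.isClosed.preimage (by fun_prop)))
  let F : CHaus κ := (CHaus.prod E s'.K).sub (Prod.snd '' W)
    (isClosedMap_snd_of_compactSpace W hW)
  let p : F ⟶ E := CHaus.homOf ⟨fun x => x.1.1, continuous_fst.comp continuous_subtype_val⟩
  let q : F ⟶ s'.K := CHaus.homOf ⟨fun x => x.1.2, continuous_snd.comp continuous_subtype_val⟩
  apply CHaus.pb_injective hX p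
  · intro e
    obtain ⟨t, h₁, h₂⟩ := hab e
    obtain ⟨k, hk⟩ := s'.total t
    exact ⟨⟨(e, k), (t, (e, k)), ⟨h₁, hk, h₂⟩, rfl⟩, rfl⟩
  · rw [← Psh.pb_comp, ← Psh.pb_comp, h F (p ≫ a) q, h' F q (p ≫ b)]
    · rintro ⟨_, ⟨t, x⟩, ⟨h₁, h₂, h₃⟩, rfl⟩
      exact ⟨t, h₂, h₃⟩
    · rintro ⟨_, ⟨t, x⟩, ⟨h₁, h₂, h₃⟩, rfl⟩
      exact ⟨t, h₁, h₂⟩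

/-- Restriction of representatives. -/
def pull {T' : CompHaus.{u}} (f : T' ⟶ T) (s : PreSec X T) : PreSec X T' where
  K := s.K
  Γ := {x | (f x.1, x.2) ∈ s.Γ}
  isClosed := s.isClosed.preimage
    (((CompHaus.continuous_hom f).comp continuous_fst).prodMk continuous_snd)
  total t := s.total (f t)
  sec := s.sec
  compat E a b h := s.compat E a b fun e => (h e).elim fun t ht => ⟨f t, ht⟩

theorem Rel.pull {T' : CompHaus.{u}} (f : T' ⟶ T) {s s' : PreSec X T} (h : Rel s s') :
    Rel (s.pull f) (s'.pull f) :=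
  fun E a b hab => h E a b fun e => (hab e).elim fun t ht => ⟨f t, ht⟩

/-- Equivalence of representatives, as a setoid. -/
def setoid (hX : IsCondensed X) (T : CompHaus.{u}) : Setoid (PreSec X T) :=
  ⟨Rel, Rel.refl, Rel.symm, Rel.trans hX⟩

/-- The representative given by an actual map to a `κ`-small space. -/
def ofMap (K : CHaus κ) (g : T ⟶ K.obj) (x : X.obj (op K)) : PreSec X T where
  K := K
  Γ := {y | g y.1 = y.2}
  isClosed := isClosed_eq ((CompHaus.continuous_hom g).comp continuous_fst) continuous_snd
  total t := ⟨g t, rfl⟩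
  sec := x
  compat E a b h := by
    have : a = b := CHaus.hom_ext fun e => by
      obtain ⟨t, h₁, h₂⟩ := h e
      exact h₁.symm.trans h₂
    rw [this]

theorem exists_rel_model (s : PreSec X T) :
    ∃ (j : Model κ) (s' : PreSec X T), s'.K = j.toCHaus ∧ Rel s' s := by
  obtain ⟨j, ⟨e⟩⟩ := exists_model s.K
  have he (x) : e.inv.hom (e.hom.hom x) = x :=
    congrArg (fun k : s.K ⟶ s.K => k.hom x) e.hom_inv_id
  refine ⟨j, ⟨j.toCHaus, {x | (x.1, e.inv.hom x.2) ∈ s.Γ}, s.isClosed.preimage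
    (continuous_fst.prodMk ((CompHaus.continuous_hom e.inv.hom).comp continuous_snd)), fun t => ?_,
    Psh.pb X e.inv s.sec, fun E a b h => ?_⟩, rfl, fun E a b h => ?_⟩
  · obtain ⟨k, hk⟩ := s.total t
    refine ⟨e.hom.hom k, ?_⟩
    simpa only [Set.mem_ofPred_eq, he] using hk
  · rw [← Psh.pb_comp, ← Psh.pb_comp]
    exact s.compat E _ _ h
  · rw [← Psh.pb_comp]
    exact s.compat E _ _ h

/-- Each class has a representative over a model space, which is then recorded by the model, the
correspondence and the section, all in universe `u`. -/
instance small_quotient (hX : IsCondensed X) (T : CompHaus.{u}) :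
    Small.{u} (Quotient (setoid hX T)) := by
  let B : Type u := Σ j : Model κ, {x : Set (T × j.toCHaus.obj) × X.obj (op j.toCHaus) //
    ∃ s : PreSec X T, ∃ h : s.K = j.toCHaus, HEq s.Γ x.1 ∧ HEq s.sec x.2}
  refine small_of_surjective (α := B) (f := fun b => Quotient.mk _ b.2.2.choose) fun y => ?_
  obtain ⟨s, rfl⟩ := Quotient.exists_rep y
  obtain ⟨j, s', h, hs⟩ := exists_rel_model s
  obtain ⟨K, Γ, h₁, h₂, x, h₃⟩ := s'
  obtain rfl : K = j.toCHaus := h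
  let b : B := ⟨j, (Γ, x), ⟨_, Γ, h₁, h₂, x, h₃⟩, rfl, HEq.rfl, HEq.rfl⟩
  refine ⟨b, Quotient.sound (Rel.trans hX ?_ hs)⟩
  obtain ⟨h, h', h''⟩ := b.2.2.choose_spec
  generalize b.2.2.choose = c at h h' h''
  obtain ⟨K, Γ', _, _, x', _⟩ := c
  obtain rfl : K = j.toCHaus := h
  obtain rfl : Γ' = Γ := eq_of_heq h'
  obtain rfl : x' = x := eq_of_heq h''
  exact Rel.refl _

end PreSec

variable {X} (hX : IsCondensed X)

/-- The sections of the free sheaf. -/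
def Sec (T : CompHaus.{u}) : Type u := Shrink.{u} (Quotient (PreSec.setoid hX T))

/-- The section attached to a representative. -/
def Sec.mk {T : CompHaus.{u}} (s : PreSec X T) : Sec hX T := equivShrink _ (Quotient.mk _ s)

theorem Sec.mk_surjective {T : CompHaus.{u}} (z : Sec hX T) : ∃ s, Sec.mk hX s = z := by
  obtain ⟨y, rfl⟩ := (equivShrink _).surjective z
  obtain ⟨s, rfl⟩ := Quotient.exists_rep y
  exact ⟨s, rfl⟩

theorem Sec.mk_eq_iff {T : CompHaus.{u}} {s s' : PreSec X T} :
    Sec.mk hX s = Sec.mk hX s' ↔ PreSec.Rel s s' := by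
  exact (equivShrink _).apply_eq_iff_eq.trans (Quotient.eq (r := PreSec.setoid hX T))

/-- Restriction of sections. -/
def Sec.pull {T T' : CompHaus.{u}} (f : T' ⟶ T) (z : Sec hX T) : Sec hX T' :=
  equivShrink _ (Quotient.map (sa := PreSec.setoid hX T) (sb := PreSec.setoid hX T')
    (PreSec.pull f) (fun _ _ h => h.pull f) ((equivShrink _).symm z))

theorem Sec.pull_mk {T T' : CompHaus.{u}} (f : T' ⟶ T) (s : PreSec X T) :
    Sec.pull hX f (Sec.mk hX s) = Sec.mk hX (s.pull f) := by
  rw [Sec.pull, Sec.mk, Equiv.symm_apply_apply]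
  rfl

/-- The free sheaf on a `κ`-condensed set. -/
def sheaf : CompHaus.{u}ᵒᵖ ⥤ Type u :=
  Psh.mk (Sec hX) (fun f => Sec.pull hX f)
    (fun T z => by
      obtain ⟨s, rfl⟩ := Sec.mk_surjective hX z
      rw [Sec.pull_mk]
      rfl)
    (fun f g z => by
      obtain ⟨s, rfl⟩ := Sec.mk_surjective hX z
      rw [Sec.pull_mk, Sec.pull_mk, Sec.pull_mk]
      rfl)

/-- The section of the free sheaf attached to a representative. -/
def mk {T : CompHaus.{u}} (s : PreSec X T) : (sheaf hX).obj (op T) := Sec.mk hX s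

theorem mk_surjective {T : CompHaus.{u}} (z : (sheaf hX).obj (op T)) : ∃ s, mk hX s = z :=
  Sec.mk_surjective hX z

theorem mk_eq_iff {T : CompHaus.{u}} {s s' : PreSec X T} :
    mk hX s = mk hX s' ↔ PreSec.Rel s s' := Sec.mk_eq_iff hX

theorem pb_mk {T T' : CompHaus.{u}} (f : T' ⟶ T) (s : PreSec X T) :
    Psh.pb (sheaf hX) f (mk hX s) = mk hX (s.pull f) := Sec.pull_mk hX f s

/-- The correspondence `Γ` is itself the required cover: it is compact, surjects onto `T` by
totality and maps to the `κ`-small space `K`. -/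
theorem isLocallyKSmall : IsLocallyKSmall κ (sheaf hX) := by
  intro T z
  obtain ⟨s, rfl⟩ := mk_surjective hX z
  refine ⟨CompHaus.sub (CompHaus.of (T × s.K.obj)) s.Γ s.isClosed,
    CompHaus.homOf ⟨fun x => x.1.1, continuous_fst.comp continuous_subtype_val⟩, s.K,
    CompHaus.homOf ⟨fun x => x.1.2, continuous_snd.comp continuous_subtype_val⟩,
    mk hX (PreSec.ofMap s.K (𝟙 _) s.sec), fun t => ?_, ?_⟩
  · obtain ⟨k, hk⟩ := s.total t
    exact ⟨⟨(t, k), hk⟩, rfl⟩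
  · rw [pb_mk, pb_mk, mk_eq_iff]
    intro E a b hab
    refine s.compat E a b fun e => ?_
    obtain ⟨⟨⟨t, k⟩, h⟩, h₁, h₂⟩ := hab e
    obtain rfl : k = b.hom e := h₂
    exact ⟨t, h₁, h⟩

/-- The comparison between `X` and the restriction of the free sheaf on `X`. -/
def unit : X ⟶ (IsSmallCompHaus κ).ι.op ⋙ sheaf hX :=
  Psh.homMk (fun K x => mk hX (PreSec.ofMap K (𝟙 K.obj) x)) fun {K L} f x => by
    refine Eq.trans ?_ (pb_mk hX f.hom _).symm
    rw [mk_eq_iff]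
    intro E (a : E ⟶ K) (b : E ⟶ L) hab
    change Psh.pb X a (Psh.pb X f x) = Psh.pb X b x
    rw [← Psh.pb_comp]
    congr 1
    refine CHaus.hom_ext fun e => ?_
    obtain ⟨t, h₁, h₂⟩ := hab e
    obtain rfl : t = a.hom e := h₁
    exact h₂

/-- Over a `κ`-small base the correspondence is a `κ`-small space surjecting onto the base, so the
section carried by it descends within `X`. Injectivity is seen by testing the relation on identity
maps. -/
theorem isIso_unit : IsIso (unit hX) := by
  refine Psh.isIso_of_bijective _ fun K => ⟨fun x y h => ?_, fun z => ?_⟩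
  · have := (mk_eq_iff hX).1 h K (𝟙 _) (𝟙 _) fun e => ⟨e, rfl, rfl⟩
    exact (Psh.pb_id X x).symm.trans (this.trans (Psh.pb_id X y))
  · obtain ⟨s, rfl⟩ := mk_surjective hX z
    let F : CHaus κ := (CHaus.prod K s.K).sub s.Γ s.isClosed
    let p : F ⟶ K := CHaus.homOf ⟨fun x => x.1.1, continuous_fst.comp continuous_subtype_val⟩
    let q : F ⟶ s.K := CHaus.homOf ⟨fun x => x.1.2, continuous_snd.comp continuous_subtype_val⟩
    have hp : Function.Surjective p.hom := fun t => by
      obtain ⟨k, hk⟩ := s.total t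
      exact ⟨⟨(t, k), hk⟩, rfl⟩
    obtain ⟨y, hy⟩ := CHaus.exists_pb_eq hX p hp (Psh.pb X q s.sec) fun E a b hab => by
      rw [← Psh.pb_comp, ← Psh.pb_comp]
      refine s.compat E _ _ fun e => ⟨p.hom (a.hom e), (a.hom e).2, ?_⟩
      rw [hab]
      exact (b.hom e).2
    refine ⟨y, (mk_eq_iff hX).2 fun E (a : E ⟶ K) (b : E ⟶ s.K) hab => ?_⟩
    have hc (e : E.obj) : (a.hom e, b.hom e) ∈ s.Γ := by
      obtain ⟨t, h₁, h₂⟩ := hab e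
      obtain rfl : t = a.hom e := h₁
      exact h₂
    let c : E ⟶ F := CHaus.homOf ⟨fun e => ⟨(a.hom e, b.hom e), hc e⟩, ((CompHaus.continuous_hom a.hom).prodMk
        (CompHaus.continuous_hom b.hom)).subtype_mk hc⟩
    change Psh.pb X a y = Psh.pb X b s.sec
    rw [show a = c ≫ p from rfl, show b = c ≫ q from rfl, Psh.pb_comp, Psh.pb_comp, hy]

/-! ### Descent and gluing of representatives -/

namespace PreSec

theorem rel_of_surjective {T T' : CompHaus.{u}} {f : T' ⟶ T} (hf : Function.Surjective f)
    {s s' : PreSec X T} (h : Rel (s.pull f) (s'.pull f)) : Rel s s' := fun E a b hab =>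
  h E a b fun e => by
    obtain ⟨t, ht⟩ := hab e
    obtain ⟨t', rfl⟩ := hf t
    exact ⟨t', ht⟩

/-- The test space `E` is a finite union of closed subsets, the `i`-th consisting of the points with
a witness `t` coming from `A i`; sections of `X` are compared on these pieces. -/
theorem rel_of_finite_cover (hX : IsCondensed X) {α : Type} [Finite α] {T : CompHaus.{u}}
    {A : α → CompHaus.{u}} (f : ∀ i, A i ⟶ T) (hf : ∀ t, ∃ i x, f i x = t) {s s' : PreSec X T}
    (h : ∀ i, Rel (s.pull (f i)) (s'.pull (f i))) : Rel s s' := by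
  intro E a b hab
  have ha := CompHaus.continuous_hom a.hom
  have hb := CompHaus.continuous_hom b.hom
  have hf' (i) := CompHaus.continuous_hom (f i)
  let W (i : α) : Set (A i × E.obj) :=
    {x | (f i x.1, a.hom x.2) ∈ s.Γ ∧ (f i x.1, b.hom x.2) ∈ s'.Γ}
  have hW (i) : IsClosed (W i) := by
    have := hf' i
    exact IsClosed.inter (s.isClosed.preimage (by fun_prop)) (s'.isClosed.preimage (by fun_prop))
  let F (i : α) : CHaus κ := E.sub (Prod.snd '' W i) (isClosedMap_snd_of_compactSpace _ (hW i))
  let p (i : α) : F i ⟶ E := CHaus.homOf ⟨fun x => x.1, continuous_subtype_val⟩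
  refine CHaus.eq_of_finite_cover hX p (fun e => ?_) fun i => ?_
  · obtain ⟨t, h₁, h₂⟩ := hab e
    obtain ⟨i, x, rfl⟩ := hf t
    exact ⟨i, ⟨e, (x, e), ⟨h₁, h₂⟩, rfl⟩, rfl⟩
  · rw [← Psh.pb_comp, ← Psh.pb_comp]
    refine h i (F i) (p i ≫ a) (p i ≫ b) ?_
    rintro ⟨_, ⟨t, e⟩, ht, rfl⟩
    exact ⟨t, ht⟩

/-- The correspondence is pushed forward along `f` while the section stays the same. The ambiguity
that this creates is governed by the kernel pair of `f`, where the hypothesis applies. -/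
theorem exists_glue {T L : CompHaus.{u}} (f : T ⟶ L)
    (hf : Function.Surjective f) (s : PreSec X T)
    (hs : ∀ (E : CompHaus.{u}) (a b : E ⟶ T), (∀ e, f (a e) = f (b e)) →
      Rel (s.pull a) (s.pull b)) : ∃ r : PreSec X L, Rel (r.pull f) s := by
  have hfc := CompHaus.continuous_hom f
  let E₀ : CompHaus.{u} := CompHaus.sub (CompHaus.of (T × T)) {x | f x.1 = f x.2}
    (isClosed_eq (hfc.comp continuous_fst) (hfc.comp continuous_snd))
  have key : ∀ (E : CHaus κ) (a b : E ⟶ s.K),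
      (∀ e, ∃ t₁ t₂, f t₁ = f t₂ ∧ (t₁, a.hom e) ∈ s.Γ ∧ (t₂, b.hom e) ∈ s.Γ) →
      Psh.pb X a s.sec = Psh.pb X b s.sec := fun E a b hab =>
    hs E₀ (CompHaus.homOf ⟨fun x => x.1.1, continuous_fst.comp continuous_subtype_val⟩)
      (CompHaus.homOf ⟨fun x => x.1.2, continuous_snd.comp continuous_subtype_val⟩)
      (fun e => e.2) E a b fun e => by
        obtain ⟨t₁, t₂, h, h₁, h₂⟩ := hab e
        exact ⟨⟨(t₁, t₂), h⟩, h₁, h₂⟩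
  refine ⟨⟨s.K, Prod.map f id '' s.Γ, (s.isClosed.isCompact.image
    (hfc.prodMap continuous_id)).isClosed, fun l => ?_, s.sec, fun E a b hab => ?_⟩,
    fun E a b hab => ?_⟩
  · obtain ⟨t, rfl⟩ := hf l
    obtain ⟨k, hk⟩ := s.total t
    exact ⟨k, (t, k), hk, rfl⟩
  · refine key E a b fun e => ?_
    obtain ⟨l, ⟨⟨t₁, k₁⟩, h₁, h₁'⟩, ⟨t₂, k₂⟩, h₂, h₂'⟩ := hab e
    obtain ⟨h, rfl⟩ : f t₁ = l ∧ k₁ = a.hom e := Prod.ext_iff.1 h₁'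
    obtain ⟨h', rfl⟩ : f t₂ = l ∧ k₂ = b.hom e := Prod.ext_iff.1 h₂'
    exact ⟨t₁, t₂, h.trans h'.symm, h₁, h₂⟩
  · refine key E a b fun e => ?_
    obtain ⟨t₂, ⟨⟨t₁, k₁⟩, h₁, h₁'⟩, h₂⟩ := hab e
    obtain ⟨h, rfl⟩ := Prod.ext_iff.1 h₁'
    exact ⟨t₁, t₂, h, h₁, h₂⟩

/-- The disjoint union of the correspondences goes to the coproduct of the target spaces, which is
still `κ`-small; the sections glue there because `X` is condensed. -/
theorem exists_glue_coproduct (hX : IsCondensed X) {α : Type} [Finite α] (A : α → CompHaus.{u})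
    (s : ∀ i, PreSec X (A i)) : ∃ r : PreSec X (CompHausLike.finiteCoproduct A),
      ∀ i, Rel (r.pull (CompHausLike.finiteCoproduct.ι A i)) (s i) := by
  obtain ⟨x, hx, -⟩ := CHaus.existsUnique_glue hX (fun i => (s i).K) fun i => (s i).sec
  have hι (i : α) : Continuous fun k : (s i).K.obj => (⟨i, k⟩ : Σ i, (s i).K.obj) :=
    continuous_sigmaMk (σ := fun i => (s i).K.obj)
  let j (i : α) : A i × (s i).K.obj → (Σ i, A i) × (Σ i, (s i).K.obj) :=
    fun y => (⟨i, y.1⟩, ⟨i, y.2⟩)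
  have hj (i) : Continuous (j i) := 
    ((continuous_sigmaMk (σ := fun i => A i)).comp continuous_fst).prodMk
      ((hι i).comp continuous_snd)
  let Γ : Set ((Σ i, A i) × (Σ i, (s i).K.obj)) := ⋃ i, j i '' (s i).Γ
  have hΓ : IsClosed Γ := isClosed_iUnion_of_finite fun i =>
    ((s i).isClosed.isCompact.image (hj i)).isClosed
  have mem (i : α) (t : A i) (k : Σ i, (s i).K.obj) (h : ((⟨i, t⟩, k) : _ × _) ∈ Γ) :
      ∃ k', (t, k') ∈ (s i).Γ ∧ k = ⟨i, k'⟩ := by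
    obtain ⟨i', ⟨t', k'⟩, h', h''⟩ := Set.mem_iUnion.1 h
    obtain ⟨h₁, rfl⟩ := Prod.ext_iff.1 h''
    obtain ⟨rfl, h₁⟩ := Sigma.mk.inj_iff.1 h₁
    obtain rfl := eq_of_heq h₁
    exact ⟨k', h', rfl⟩
  refine ⟨⟨CHaus.sigma fun i => (s i).K, Γ, hΓ, fun ⟨i, t⟩ => ?_, x, fun E a b hab => ?_⟩,
    fun i E (a : E ⟶ CHaus.sigma fun i => (s i).K) (b : E ⟶ (s i).K) hab => ?_⟩
  · obtain ⟨k, hk⟩ := (s i).total t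
    exact ⟨⟨i, k⟩, Set.mem_iUnion.2 ⟨i, _, hk, rfl⟩⟩
  · let a' : E.obj → Σ i, (s i).K.obj := a.hom
    let b' : E.obj → Σ i, (s i).K.obj := b.hom
    have ha' : Continuous a' := CompHaus.continuous_hom a.hom
    have hb' : Continuous b' := CompHaus.continuous_hom b.hom
    have h₁ (i) : IsClosed {y : A i × (E.obj × ((s i).K.obj × (s i).K.obj)) |
        a' y.2.1 = ⟨i, y.2.2.1⟩} := isClosed_eq (by fun_prop) ((hι i).comp (by fun_prop))
    have h₂ (i) : IsClosed {y : A i × (E.obj × ((s i).K.obj × (s i).K.obj)) |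
        b' y.2.1 = ⟨i, y.2.2.2⟩} := isClosed_eq (by fun_prop) ((hι i).comp (by fun_prop))
    -- Both maps out of `E` land in the same summand, as they have a common witness. After
    -- projecting `A i` away, the `W i` give a finite closed cover of `E` by `κ`-small spaces on
    -- which the compatibility of `s i` applies.
    let W (i : α) : Set (A i × (E.obj × ((s i).K.obj × (s i).K.obj))) :=
      {y | (y.1, y.2.2.1) ∈ (s i).Γ ∧ (y.1, y.2.2.2) ∈ (s i).Γ ∧ a' y.2.1 = ⟨i, y.2.2.1⟩ ∧
        b' y.2.1 = ⟨i, y.2.2.2⟩}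
    have hW (i) : IsClosed (W i) :=
      IsClosed.inter ((s i).isClosed.preimage (by fun_prop))
        (IsClosed.inter ((s i).isClosed.preimage (by fun_prop))
          (IsClosed.inter (h₁ i) (h₂ i)))
    let F (i : α) : CHaus κ := (CHaus.prod E (CHaus.prod (s i).K (s i).K)).sub (Prod.snd '' W i)
      (isClosedMap_snd_of_compactSpace _ (hW i))
    let p (i : α) : F i ⟶ E :=
      CHaus.homOf ⟨fun x => x.1.1, continuous_fst.comp continuous_subtype_val⟩
    let q (i : α) : F i ⟶ (s i).K :=
      CHaus.homOf ⟨fun x => x.1.2.1, (continuous_fst.comp continuous_snd).comp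
        continuous_subtype_val⟩
    let q' (i : α) : F i ⟶ (s i).K :=
      CHaus.homOf ⟨fun x => x.1.2.2, (continuous_snd.comp continuous_snd).comp
        continuous_subtype_val⟩
    refine CHaus.eq_of_finite_cover hX p (fun e => ?_) fun i => ?_
    · obtain ⟨⟨i, t⟩, h₁, h₂⟩ := hab e
      obtain ⟨k, hk, hk'⟩ := mem _ _ _ h₁
      obtain ⟨l, hl, hl'⟩ := mem _ _ _ h₂
      exact ⟨i, ⟨(e, (k, l)), (t, (e, (k, l))), ⟨hk, hl, hk', hl'⟩, rfl⟩, rfl⟩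
    · have hpa : p i ≫ a = q i ≫ CHaus.sigmaι (fun i => (s i).K) i := CHaus.hom_ext fun y => by
        obtain ⟨_, y, hy, rfl⟩ := y
        exact hy.2.2.1
      have hpb : p i ≫ b = q' i ≫ CHaus.sigmaι (fun i => (s i).K) i := CHaus.hom_ext fun y => by
        obtain ⟨_, y, hy, rfl⟩ := y
        exact hy.2.2.2
      rw [← Psh.pb_comp, ← Psh.pb_comp, hpa, hpb, Psh.pb_comp, Psh.pb_comp, hx]
      refine (s i).compat _ _ _ ?_
      rintro ⟨_, y, hy, rfl⟩
      exact ⟨y.1, hy.1, hy.2.1⟩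
  · let a' : E.obj → Σ i, (s i).K.obj := a.hom
    have ha' : Continuous a' := CompHaus.continuous_hom a.hom
    have hcl : IsClosed {y : E.obj × (s i).K.obj | a' y.1 = ⟨i, y.2⟩} :=
      isClosed_eq (by fun_prop) ((hι i).comp (by fun_prop))
    let F : CHaus κ := (CHaus.prod E (s i).K).sub {y | a' y.1 = ⟨i, y.2⟩} hcl
    let p : F ⟶ E := CHaus.homOf ⟨fun x => x.1.1, continuous_fst.comp continuous_subtype_val⟩
    let q : F ⟶ (s i).K := CHaus.homOf ⟨fun x => x.1.2, continuous_snd.comp continuous_subtype_val⟩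
    have hpa : p ≫ a = q ≫ CHaus.sigmaι (fun i => (s i).K) i := CHaus.hom_ext fun y => y.2
    apply CHaus.pb_injective hX p
    · intro e
      obtain ⟨t, h₁, -⟩ := hab e
      obtain ⟨k, -, hk⟩ := mem _ _ _ h₁
      exact ⟨⟨(e, k), hk⟩, rfl⟩
    · change Psh.pb X p (Psh.pb X a x) = _
      rw [← Psh.pb_comp, ← Psh.pb_comp, hpa, Psh.pb_comp, hx]
      refine (s i).compat _ _ _ fun y => ?_
      obtain ⟨t, h₁, h₂⟩ := hab (p.hom y)
      obtain ⟨k, hk, hk'⟩ := mem _ _ _ h₁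
      obtain rfl : k = q.hom y := by
        have : (⟨i, k⟩ : Σ i, (s i).K.obj) = ⟨i, q.hom y⟩ := hk'.symm.trans y.2
        simpa using this
      exact ⟨t, hk, h₂⟩

end PreSec

theorem isCondensed_sheaf : IsCondensed (sheaf hX) := by
  refine CompHaus.isCondensed_of (fun n A x => ?_) (fun K L f hf z z' h => ?_)
    fun K L f hf φ hφ => ?_
  · choose s hs using fun i => mk_surjective hX (x i)
    obtain ⟨r, hr⟩ := PreSec.exists_glue_coproduct hX A s
    refine ⟨mk hX r, fun i => ?_, fun y hy => ?_⟩
    · rw [← hs, pb_mk, mk_eq_iff]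
      exact hr i
    · obtain ⟨y, rfl⟩ := mk_surjective hX y
      rw [mk_eq_iff]
      refine PreSec.rel_of_finite_cover hX (CompHausLike.finiteCoproduct.ι A)
        (fun ⟨i, t⟩ => ⟨i, t, rfl⟩) fun i => ?_
      have := hy i
      rw [← hs, pb_mk, mk_eq_iff] at this
      exact this.trans hX (hr i).symm
  · obtain ⟨s, rfl⟩ := mk_surjective hX z
    obtain ⟨s', rfl⟩ := mk_surjective hX z'
    rw [pb_mk, pb_mk, mk_eq_iff] at h
    exact (mk_eq_iff hX).2 (PreSec.rel_of_surjective hf h)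
  · obtain ⟨s, rfl⟩ := mk_surjective hX φ
    obtain ⟨r, hr⟩ := PreSec.exists_glue f hf s fun E a b hab => by
      have := hφ E a b hab
      rwa [pb_mk, pb_mk, mk_eq_iff] at this
    exact ⟨mk hX r, by rwa [pb_mk, mk_eq_iff]⟩

end FreeSheaf

/-! ### The embedding of `κ`-condensed sets into condensed sets -/

namespace CondK

variable {κ}

/-- The free condensed set on a `κ`-condensed set. -/
def free (X : CondK κ) : Cond.{u} :=
  ⟨FreeSheaf.sheaf X.property, FreeSheaf.isCondensed_sheaf _, κ,
    isKGenerated_of_isLocallyKSmall (FreeSheaf.isCondensed_sheaf _) (FreeSheaf.isLocallyKSmall _)⟩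

/-- The universal morphism to the free condensed set. -/
def freeUnit (X : CondK κ) : X ⟶ (Cond.res κ).obj (free X) :=
  ObjectProperty.homMk (FreeSheaf.unit X.property)

instance (X : CondK κ) : IsIso (freeUnit X) :=
  have : IsIso (freeUnit X).hom := FreeSheaf.isIso_unit X.property
  (ObjectProperty.isIso_hom_iff _).1 this

theorem res_map_bijective {X : Cond.{u}} (hX : IsKGenerated κ X.obj) (Y : Cond.{u}) :
    Function.Bijective fun f : X ⟶ Y => (Cond.res κ).map f := by
  have h := hX Y.property.1
  refine ⟨fun f g e => ?_, fun g => ?_⟩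
  · ext1
    exact h.1 (congrArg (fun k => k.hom) e)
  · obtain ⟨f, hf⟩ := h.2 g.hom
    exact ⟨ObjectProperty.homMk f, by ext1; exact hf⟩

theorem isLocallyKSmall_free (X : CondK κ) : IsLocallyKSmall κ (free X).obj :=
  FreeSheaf.isLocallyKSmall _

theorem isKGenerated_free (X : CondK κ) : IsKGenerated κ (free X).obj :=
  isKGenerated_of_isLocallyKSmall (FreeSheaf.isCondensed_sheaf _) (isLocallyKSmall_free X)

/-- The universal property of the free condensed set. -/
def freeEquiv (X : CondK κ) (Y : Cond.{u}) : (free X ⟶ Y) ≃ (X ⟶ (Cond.res κ).obj Y) :=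
  (Equiv.ofBijective _ (res_map_bijective (isKGenerated_free X) Y)).trans
    ((asIso (freeUnit X)).symm.homCongr (Iso.refl _))

theorem freeEquiv_apply (X : CondK κ) (Y : Cond.{u}) (f : free X ⟶ Y) :
    freeEquiv X Y f = freeUnit X ≫ (Cond.res κ).map f := by
  simp [freeEquiv, Iso.homCongr]

variable (κ)

theorem freeEquiv_comp (X : CondK κ) (Y Y' : Cond.{u}) (g : Y ⟶ Y') (h : free X ⟶ Y) :
    freeEquiv X Y' (h ≫ g) = freeEquiv X Y h ≫ (Cond.res κ).map g := by
  simp [freeEquiv_apply]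

/-- The embedding of `κ`-condensed sets into condensed sets. -/
def toCond : CondK κ ⥤ Cond.{u} := Adjunction.leftAdjointOfEquiv freeEquiv (freeEquiv_comp κ)

/-- The embedding of `κ`-condensed sets is left adjoint to restriction. -/
def toCondAdj : toCond κ ⊣ Cond.res κ := Adjunction.adjunctionOfEquivLeft freeEquiv (freeEquiv_comp κ)

theorem toCondAdj_unit_app (X : CondK κ) : (toCondAdj κ).unit.app X = freeUnit X := by
  change freeEquiv X (free X) (𝟙 _) = _
  rw [freeEquiv_apply, CategoryTheory.Functor.map_id]
  exact Category.comp_id _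

instance isIso_toCondAdj_unit : IsIso (toCondAdj κ).unit := by
  have (X : CondK κ) : IsIso ((toCondAdj κ).unit.app X) := by
    rw [toCondAdj_unit_app]
    exact inferInstanceAs (IsIso (freeUnit X))
  exact NatIso.isIso_of_isIso_app _

/-- The embedding of `κ`-condensed sets into condensed sets is fully faithful. -/
def fullyFaithfulToCond : (toCond κ).FullyFaithful := (toCondAdj κ).fullyFaithfulLOfIsIsoUnit

/-- Under the adjunction bijection, precomposition with the counit becomes restriction of morphisms,
which is bijective for a `κ`-generated source; the co-Yoneda criterion concludes. -/
theorem isIso_toCondAdj_counit_app {X : Cond.{u}} (hX : IsKGenerated κ X.obj) :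
    IsIso ((toCondAdj κ).counit.app X) := by
  rw [isIso_iff_coyoneda_map_bijective]
  intro Y
  have h : (fun f : X ⟶ Y => (toCondAdj κ).counit.app X ≫ f) =
      ((toCondAdj κ).homEquiv _ _).symm ∘ fun f => (Cond.res κ).map f := by
    funext f
    rw [Function.comp_apply, Equiv.eq_symm_apply, Adjunction.homEquiv_unit]
    simp
  exact h ▸ (((toCondAdj κ).homEquiv _ _).symm.bijective.comp (res_map_bijective hX Y))

theorem essImage_toCond_iff (X : Cond.{u}) : (toCond κ).essImage X ↔ IsKGenerated κ X.obj := by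
  refine ⟨fun ⟨Y, ⟨e⟩⟩ => ?_, fun hX => ?_⟩
  · exact isKGenerated_of_isLocallyKSmall X.property.1
      ((isLocallyKSmall_free Y).of_iso (IsCondensedSet.ι.mapIso e))
  · have := isIso_toCondAdj_counit_app κ hX
    exact ⟨_, ⟨asIso ((toCondAdj κ).counit.app X)⟩⟩

variable {κ} in
-- A `κ`-generated sheaf is isomorphic to a free one, and free sheaves satisfy the local condition
-- by construction. This is the converse of the local criterion.
theorem isLocallyKSmall_of_isKGenerated {X : CompHaus.{u}ᵒᵖ ⥤ Type u} (hX : IsCondensed X)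
    (h : IsKGenerated κ X) : IsLocallyKSmall κ X := by
  obtain ⟨Y, ⟨e⟩⟩ := (essImage_toCond_iff κ ⟨X, hX, κ, h⟩).2 h
  exact (isLocallyKSmall_free Y).of_iso (IsCondensedSet.ι.mapIso e)

end CondK

/-! ### Maps from topological spaces to compactological sets -/

namespace Cmp

variable {C D : Cmp.{u}}

/-- A map from a topological space to a compactological set is bounded continuous if it is a
continuous map to a member of the compactology. -/
def Cont (C : Cmp.{u}) {T : Type*} [TopologicalSpace T] (f : T → C.carrier) : Prop :=
  ∃ (A : C.sets) (h : ∀ t, f t ∈ A.1), @Continuous T A.1 _ (C.top A) fun t => ⟨f t, h t⟩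

section

variable {T S : Type*} [TopologicalSpace T] [TopologicalSpace S]

theorem continuous_enlarge {A B : C.sets} (hAB : A.1 ⊆ B.1) {f : T → C.carrier}
    (h : ∀ t, f t ∈ A.1) :
    (@Continuous T A.1 _ (C.top A) fun t => ⟨f t, h t⟩) ↔
      @Continuous T B.1 _ (C.top B) fun t => ⟨f t, hAB (h t)⟩ := by
  rw [C.coherent B A hAB]
  let _ := C.top B
  exact continuous_induced_rng

theorem Cont.comp_continuous {f : T → C.carrier} (hf : C.Cont f) {g : S → T} (hg : Continuous g) :
    C.Cont (f ∘ g) := by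
  obtain ⟨A, h, hc⟩ := hf
  let _ := C.top A
  exact ⟨A, fun s => h (g s), hc.comp hg⟩

theorem Cont.range [CompactSpace T] {f : T → C.carrier} (hf : C.Cont f) :
    ∃ h : Set.range f ∈ C.sets,
      @Continuous T (Set.range f) _ (C.top ⟨_, h⟩) (Set.rangeFactorization f) := by
  obtain ⟨A, h, hc⟩ := hf
  have h₀ : Set.range f ∈ C.sets := by
    let _ := C.top A
    have := C.stable A _ (isCompact_range hc)
    convert this
    ext x
    simp
  refine ⟨h₀, ?_⟩
  have hA : Set.range f ⊆ A.1 := Set.range_subset_iff.2 h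
  exact (continuous_enlarge (A := ⟨_, h₀⟩) (B := A) hA fun t => Set.mem_range_self t).2 hc

/-- By directedness both maps are continuous into a single member, which is Hausdorff. All
closedness assertions about compactological sets rest on this. -/
theorem Cont.isClosed_eq {f : T → C.carrier} {g : S → C.carrier} (hf : C.Cont f) (hg : C.Cont g) :
    IsClosed {x : T × S | f x.1 = g x.2} := by
  obtain ⟨A, h, hc⟩ := hf
  obtain ⟨B, h', hc'⟩ := hg
  obtain ⟨R, hR, hA, hB⟩ := C.directed A.1 A.2 B.1 B.2
  replace hc := (continuous_enlarge (B := ⟨R, hR⟩) hA h).1 hc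
  replace hc' := (continuous_enlarge (B := ⟨R, hR⟩) hB h').1 hc'
  let _ := C.top ⟨R, hR⟩
  have := C.t2 ⟨R, hR⟩
  convert _root_.isClosed_eq (hc.comp continuous_fst) (hc'.comp continuous_snd) using 3 with x
  simp

theorem Cont.of_isQuotientMap {f : T → C.carrier} {p : S → T} (hp : Topology.IsQuotientMap p)
    (hf : C.Cont (f ∘ p)) : C.Cont f := by
  obtain ⟨A, h, hc⟩ := hf
  have h' (t : T) : f t ∈ A.1 := by
    obtain ⟨s, rfl⟩ := hp.surjective t
    exact h s
  let _ := C.top A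
  exact ⟨A, h', hp.continuous_iff.2 hc⟩

theorem Cont.sigma {α : Type} [Finite α] {T : α → Type*} [∀ a, TopologicalSpace (T a)]
    {f : (Σ a, T a) → C.carrier} (hf : ∀ a, C.Cont fun t => f ⟨a, t⟩) : C.Cont f := by
  choose A h hc using hf
  have : IsDirectedOrder C.sets := ⟨fun A B => by
    obtain ⟨R, hR, hA, hB⟩ := C.directed A.1 A.2 B.1 B.2
    exact ⟨⟨R, hR⟩, hA, hB⟩⟩
  have : Nonempty C.sets := C.nonempty.to_subtype
  obtain ⟨B, hB⟩ := Finite.exists_le A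
  refine ⟨B, fun ⟨a, t⟩ => hB a (h a t), ?_⟩
  let _ := C.top B
  exact continuous_sigma fun a => (continuous_enlarge (hB a) (h a)).1 (hc a)

theorem Cont.const (x : C.carrier) : C.Cont fun _ : T => x := by
  obtain ⟨A, hA, hx⟩ : x ∈ ⋃₀ C.sets := C.cover ▸ Set.mem_univ x
  let _ := C.top ⟨A, hA⟩
  exact ⟨⟨A, hA⟩, fun _ => hx, continuous_const⟩

theorem Cont.subtype_val (A : C.sets) : @Cont C A.1 (C.top A) Subtype.val :=
  let _ := C.top A
  ⟨A, fun t => t.2, continuous_id⟩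

theorem IsMorphism.cont {F : C.carrier → D.carrier} (hF : IsMorphism C D F) {f : T → C.carrier}
    (hf : C.Cont f) : D.Cont (F ∘ f) := by
  obtain ⟨A, h, hc⟩ := hf
  obtain ⟨hA, hA'⟩ := hF A
  let _ := C.top A
  let _ := D.top ⟨_, hA⟩
  exact ⟨⟨_, hA⟩, fun t => Set.mem_image_of_mem F (h t), hA'.comp hc⟩

theorem isMorphism_of_cont {F : C.carrier → D.carrier}
    (h : ∀ A : C.sets, @Cont D A.1 (C.top A) fun x => F x) : IsMorphism C D F := by
  intro A
  let _ := C.top A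
  have := C.compact A
  obtain ⟨hA, hc⟩ := (h A).range
  have e : Set.range (fun x : A.1 => F x) = F '' A.1 := by
    rw [Set.image_eq_range]
  refine ⟨e ▸ hA, ?_⟩
  exact continuous_congr D e hA _ _ _ (fun _ => rfl) hc

end

/-- The whole space is a member of its own compactology, so the condition on all compact subsets
reduces to the one for `K` itself. -/
theorem isMorphism_ofCompHaus_iff {K : CompHaus.{u}} {f : K → C.carrier} :
    IsMorphism (ofCompHaus K) C f ↔ C.Cont f := by
  refine ⟨fun h => ?_, fun h => isMorphism_of_cont fun A => ?_⟩
  · exact h.cont (T := K) (f := id) ⟨⟨Set.univ, isCompact_univ (X := K)⟩, fun _ => trivial,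
      (continuous_id (X := K)).subtype_mk _⟩
  · let B : Set K := A.1
    exact h.comp_continuous (S := B) (continuous_subtype_val (p := fun x => x ∈ B))

/-- A section of `Cmp.yo.obj C` over `K`, as a map. -/
def ev {K : CompHaus.{u}} (s : (yo.obj C).obj (op K)) : K → C.carrier := Hom.toFun s

/-- The section given by a bounded continuous map. -/
def secMk {K : CompHaus.{u}} (f : K → C.carrier) (hf : C.Cont f) : (yo.obj C).obj (op K) :=
  (⟨f, isMorphism_ofCompHaus_iff.2 hf⟩ : Hom (ofCompHaus K) C)

theorem cont_ev {K : CompHaus.{u}} (s : (yo.obj C).obj (op K)) : C.Cont (ev s) :=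
  isMorphism_ofCompHaus_iff.1 (Hom.isMorphism s)

theorem sec_ext {K : CompHaus.{u}} {s t : (yo.obj C).obj (op K)} (h : ∀ k, ev s k = ev t k) :
    s = t :=
  Hom.ext (funext h)

theorem hom_ext' {F G : C ⟶ D} (h : ∀ x, F.toFun x = G.toFun x) : F = G := Hom.ext (funext h)

/-- The section over the one-point space attached to a point. -/
def ptSec (x : C.carrier) : (yo.obj C).obj (op CompHaus.pt.{u}) := secMk (fun _ => x) (Cont.const x)

theorem pb_point {K : CompHaus.{u}} (s : (yo.obj C).obj (op K)) (k : K) :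
    Psh.pb (yo.obj C) (CompHaus.point k) s = ptSec (ev s k) := rfl

theorem ev_app (η : yo.obj C ⟶ yo.obj D) {K : CompHaus.{u}} (s : (yo.obj C).obj (op K)) (k : K) :
    ev (η.app _ s) k = ev (η.app _ (ptSec (ev s k))) PUnit.unit := by
  rw [← pb_point, Psh.app_pb]
  rfl

/-- A surjection of compact Hausdorff spaces is a quotient map, so bounded continuous maps descend
once they are constant on fibres; the one-point test space gives this constancy. -/
theorem isCondensed_yo (C : Cmp.{u}) : IsCondensed (yo.obj C) := by
  refine CompHaus.isCondensed_of (fun n A x => ?_) (fun K L f hf z z' h => ?_)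
    fun K L f hf φ hφ => ?_
  · refine ⟨secMk (fun p : Σ a, A a => ev (x p.1) p.2) (Cont.sigma fun a => cont_ev (x a)),
      fun a => rfl, fun y hy => sec_ext fun ⟨a, t⟩ => ?_⟩
    exact congrArg (fun s => ev s t) (hy a)
  · refine sec_ext fun l => ?_
    obtain ⟨k, rfl⟩ := hf l
    exact congrArg (fun s => ev s k) h
  · have hfc := CompHaus.continuous_hom f
    have key (k k' : K) (h : f k = f k') : ev φ k = ev φ k' :=
      congrArg (fun s => ev s PUnit.unit) (hφ _ (CompHaus.point k) (CompHaus.point k') fun _ => h)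
    have e : (fun l => ev φ (Function.surjInv hf l)) ∘ f = ev φ := funext fun k =>
      key _ _ (Function.surjInv_eq hf _)
    refine ⟨secMk (fun l => ev φ (Function.surjInv hf l))
      (Cont.of_isQuotientMap (hfc.isClosedMap.isQuotientMap hfc hf) ?_), sec_ext (congrFun e)⟩
    rw [e]
    exact cont_ev φ

/-- A member of the compactology, as a compact Hausdorff space. -/
def member (A : C.sets) : CompHaus.{u} :=
  let _ := C.top A
  have := C.compact A
  have := C.t2 A
  CompHaus.of A.1

/-- The inclusion of a member of the compactology. -/
def memberSec (A : C.sets) : (yo.obj C).obj (op (member A)) :=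
  secMk (K := member A) Subtype.val (Cont.subtype_val A)

/-- A section factors through a member of the compactology, which is `κ`-small, so no covering is
needed. -/
theorem isLocallyKSmall_yo {κ : StrongLimitCard.{u}} (hC : IsSmallCmp κ C) :
    IsLocallyKSmall κ (yo.obj C) := by
  intro T z
  obtain ⟨A, h, hc⟩ := cont_ev z
  let A' : CHaus κ := ⟨member A, hC A.1 A.2⟩
  exact ⟨T, 𝟙 T, A', CompHaus.homOf (L := member A)
    (let _ := C.top A; ⟨fun t => ⟨ev z t, h t⟩, hc⟩), memberSec A, fun t => ⟨t, rfl⟩, rfl⟩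

theorem exists_strongLimitCard (c : Cardinal.{u}) : ∃ κ : StrongLimitCard.{u}, c < κ.card := by
  have h (o : Ordinal.{u}) (ho : o ≤ c.ord) :
      Cardinal.beth o < Cardinal.beth (c.ord + Ordinal.omega0) :=
    Cardinal.beth_lt_beth.2 (ho.trans_lt (lt_add_of_pos_right _ Ordinal.omega0_pos))
  -- Adding `ω` makes the index a limit ordinal, where the beth number is a strong limit.
  refine ⟨⟨Cardinal.beth (c.ord + Ordinal.omega0), ?_, ?_⟩, (Cardinal.le_beth_ord c).trans_lt
    (h _ le_rfl)⟩
  · rw [← Cardinal.beth_zero]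
    exact h 0 zero_le
  · exact Cardinal.isStrongLimit_beth.2
      (Ordinal.isSuccLimit_add _ Ordinal.isSuccLimit_omega0).isSuccPrelimit

theorem isCondensedSet_yo (C : Cmp.{u}) : IsCondensedSet (yo.obj C) := by
  obtain ⟨κ, hκ⟩ := exists_strongLimitCard (Cardinal.mk C.carrier)
  exact ⟨isCondensed_yo C, κ, isKGenerated_of_isLocallyKSmall (isCondensed_yo C)
    (isLocallyKSmall_yo fun A _ => (Cardinal.mk_set_le A).trans_lt hκ)⟩

instance faithful_toCond : (toCond isCondensedSet_yo.{u}).Faithful where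
  map_injective {C D} F G h := hom_ext' fun x => by
    have := congrArg (fun k : (toCond isCondensedSet_yo).obj C ⟶ (toCond isCondensedSet_yo).obj D =>
      ev (k.hom.app (op CompHaus.pt) (ptSec x)) PUnit.unit) h
    exact this

/-- Evaluating `η` on the inclusion of a member `A` gives a section over `A`, which is bounded
continuous and, by naturality at points, equals the map on points. This is the reason for fullness.
-/
theorem isMorphism_of_natTrans (η : yo.obj C ⟶ yo.obj D) :
    IsMorphism C D fun x => ev (η.app _ (ptSec x)) PUnit.unit :=
  isMorphism_of_cont fun A => by
    have := cont_ev (η.app _ (memberSec A))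
    have e : ev (η.app _ (memberSec A)) = fun x : A.1 => ev (η.app _ (ptSec x.1)) PUnit.unit :=
      funext fun x => ev_app η _ x
    rwa [e] at this

instance full_toCond : (toCond isCondensedSet_yo.{u}).Full where
  map_surjective {C D} η := by
    refine ⟨⟨_, isMorphism_of_natTrans η.hom⟩, ?_⟩
    ext1
    refine Psh.hom_ext fun K s => sec_ext fun k => ?_
    exact (ev_app η.hom s k).symm

end Cmp

/-! ### Compactological sets from families of compact spaces -/

/-- The saturation of a closed set is the projection of a closed set in `K × K`, so `f` is a closed
map. Normality separates two fibres, and complements of images of complements are disjoint open sets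
downstairs. -/
theorem t2Space_coinduced_of_isClosed {K A : Type*} [TopologicalSpace K] [CompactSpace K] [T2Space K]
    {f : K → A} (hf : Function.Surjective f) (h : IsClosed {x : K × K | f x.1 = f x.2}) :
    @T2Space A (TopologicalSpace.coinduced f inferInstance) := by
  let _ : TopologicalSpace A := TopologicalSpace.coinduced f inferInstance
  have hq : Topology.IsQuotientMap f := ⟨⟨rfl⟩, hf⟩
  have hcl : IsClosedMap f := by
    intro S hS
    rw [← hq.isClosed_preimage]
    have : f ⁻¹' (f '' S) = Prod.snd '' ({x : K × K | f x.1 = f x.2} ∩ Prod.fst ⁻¹' S) := by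
      ext k
      constructor
      · rintro ⟨s, hs, hsk⟩
        exact ⟨(s, k), ⟨hsk, hs⟩, rfl⟩
      · rintro ⟨⟨s, k⟩, ⟨h₁, h₂⟩, rfl⟩
        exact ⟨s, h₂, h₁⟩
    rw [this]
    exact isClosedMap_snd_of_compactSpace _ (h.inter (hS.preimage continuous_fst))
  have hfib (a : A) : IsClosed (f ⁻¹' {a}) := by
    obtain ⟨k, rfl⟩ := hf a
    exact h.preimage (continuous_id.prodMk (continuous_const (y := k)))
  refine ⟨fun a b hab => ?_⟩
  obtain ⟨U, V, hU, hV, haU, hbV, hUV⟩ := normal_separation (hfib a) (hfib b)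
    (Disjoint.preimage f (by simpa using hab))
  refine ⟨(f '' Uᶜ)ᶜ, (f '' Vᶜ)ᶜ, (hcl _ hU.isClosed_compl).isOpen_compl,
    (hcl _ hV.isClosed_compl).isOpen_compl, ?_, ?_, ?_⟩
  · rintro ⟨k, hk, rfl⟩
    exact hk (haU rfl)
  · rintro ⟨k, hk, rfl⟩
    exact hk (hbV rfl)
  · rw [Set.disjoint_left]
    intro c hc hc'
    obtain ⟨k, rfl⟩ := hf c
    exact Set.disjoint_left.1 hUV (not_not.1 fun h => hc ⟨k, h, rfl⟩)
      (not_not.1 fun h => hc' ⟨k, h, rfl⟩)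

namespace Cmp

/-- A family of maps from compact Hausdorff spaces to a set whose images form a compactology. -/
structure Atlas (Q : Type u) (J : Type w) where
  K : J → CompHaus.{u}
  q : ∀ j, K j → Q
  nonempty : Nonempty J
  cover : ∀ x, ∃ j k, q j k = x
  isClosed : ∀ j, IsClosed {x : K j × K j | q j x.1 = q j x.2}
  directed : ∀ i j, ∃ (l : J) (a : K i ⟶ K l) (b : K j ⟶ K l),
    (∀ x, q l (a x) = q i x) ∧ ∀ x, q l (b x) = q j x
  sub : ∀ (j : J) (A : Set (K j)), IsClosed A →
    ∃ (l : J) (a : K l ⟶ K j), Set.range a = A ∧ ∀ x, q j (a x) = q l x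

namespace Atlas

variable {Q : Type u} {J : Type w} (𝒜 : Atlas Q J)

/-- A chart with image `A`, as a map to `A`. -/
def chart (j : J) {A : Set Q} (h : Set.range (𝒜.q j) = A) (k : 𝒜.K j) : A :=
  ⟨𝒜.q j k, h ▸ Set.mem_range_self k⟩

/-- The quotient topology on the image of a chart. -/
abbrev top (j : J) {A : Set Q} (h : Set.range (𝒜.q j) = A) : TopologicalSpace A :=
  TopologicalSpace.coinduced (𝒜.chart j h) inferInstance

theorem chart_surjective (j : J) {A : Set Q} (h : Set.range (𝒜.q j) = A) :
    Function.Surjective (𝒜.chart j h) := by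
  subst h
  rintro ⟨_, k, rfl⟩
  exact ⟨k, rfl⟩

theorem t2Space_top (j : J) {A : Set Q} (h : Set.range (𝒜.q j) = A) :
    @T2Space A (𝒜.top j h) := by
  refine t2Space_coinduced_of_isClosed (𝒜.chart_surjective j h) ?_
  simpa only [chart, Subtype.mk.injEq] using 𝒜.isClosed j

theorem continuous_chart (j : J) {A : Set Q} (h : Set.range (𝒜.q j) = A) :
    @Continuous _ _ _ (𝒜.top j h) (𝒜.chart j h) := continuous_coinduced_rng

theorem compactSpace_top (j : J) {A : Set Q} (h : Set.range (𝒜.q j) = A) :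
    @CompactSpace A (𝒜.top j h) := by
  let _ := 𝒜.top j h
  exact (𝒜.chart_surjective j h).compactSpace (𝒜.continuous_chart j h)

theorem isClosedEmbedding_of_map {i j : J} {A B : Set Q} (hA : Set.range (𝒜.q i) = A)
    (hB : Set.range (𝒜.q j) = B) (a : 𝒜.K i ⟶ 𝒜.K j) (ha : ∀ x, 𝒜.q j (a x) = 𝒜.q i x)
    (hAB : A ⊆ B) :
    @Topology.IsClosedEmbedding A B (𝒜.top i hA) (𝒜.top j hB) (Set.inclusion hAB) := by
  let _ := 𝒜.top i hA
  let _ := 𝒜.top j hB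
  have := 𝒜.compactSpace_top i hA
  have := 𝒜.t2Space_top j hB
  refine Continuous.isClosedEmbedding ?_ (Set.inclusion_injective hAB)
  refine continuous_coinduced_dom.2 ?_
  have : Set.inclusion hAB ∘ 𝒜.chart i hA = 𝒜.chart j hB ∘ a :=
    funext fun x => Subtype.ext (ha x).symm
  rw [this]
  exact (𝒜.continuous_chart j hB).comp (CompHaus.continuous_hom a)

/-- Both topologies are induced from the image of a common larger chart, since a continuous
injection of a compact space into a Hausdorff one is a closed embedding. For `A = B` this says that
the topology does not depend on the chart. -/
theorem top_eq_induced {i j : J} {A B : Set Q} (hA : Set.range (𝒜.q i) = A)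
    (hB : Set.range (𝒜.q j) = B) (hAB : A ⊆ B) :
    𝒜.top i hA = (𝒜.top j hB).induced (Set.inclusion hAB) := by
  obtain ⟨l, a, b, ha, hb⟩ := 𝒜.directed i j
  have hAl : A ⊆ Set.range (𝒜.q l) := by
    rw [← hA]
    rintro _ ⟨x, rfl⟩
    exact ⟨a x, ha x⟩
  have hBl : B ⊆ Set.range (𝒜.q l) := by
    rw [← hB]
    rintro _ ⟨x, rfl⟩
    exact ⟨b x, hb x⟩
  let _ := 𝒜.top i hA
  let _ := 𝒜.top j hB
  let _ := 𝒜.top l rfl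
  have h₁ := (𝒜.isClosedEmbedding_of_map hA rfl a ha hAl).isInducing.eq_induced
  have h₂ := (𝒜.isClosedEmbedding_of_map hB rfl b hb hBl).isInducing.eq_induced
  rw [h₁, h₂, induced_compose]
  rfl

/-- The compactological set given by an atlas. -/
def toCmp : Cmp.{u} where
  carrier := Q
  sets := {A | ∃ j, Set.range (𝒜.q j) = A}
  top A := 𝒜.top A.2.choose A.2.choose_spec
  nonempty := 𝒜.nonempty.elim fun j => ⟨_, j, rfl⟩
  compact A := 𝒜.compactSpace_top _ _
  t2 A := 𝒜.t2Space_top _ _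
  cover := Set.eq_univ_of_forall fun x => by
    obtain ⟨j, k, rfl⟩ := 𝒜.cover x
    exact ⟨_, ⟨j, rfl⟩, ⟨k, rfl⟩⟩
  directed := by
    rintro _ ⟨i, rfl⟩ _ ⟨j, rfl⟩
    obtain ⟨l, a, b, ha, hb⟩ := 𝒜.directed i j
    refine ⟨_, ⟨l, rfl⟩, ?_, ?_⟩
    · rintro _ ⟨x, rfl⟩
      exact ⟨a x, ha x⟩
    · rintro _ ⟨x, rfl⟩
      exact ⟨b x, hb x⟩
  coherent A B h := 𝒜.top_eq_induced _ _ h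
  stable A B hB := by
    obtain ⟨j, hj⟩ : ∃ j, j = A.2.choose := ⟨_, rfl⟩
    have hA := A.2.choose_spec
    let _ := 𝒜.top A.2.choose hA
    have := 𝒜.t2Space_top A.2.choose hA
    obtain ⟨l, a, ha, ha'⟩ := 𝒜.sub _ (𝒜.chart _ hA ⁻¹' B)
      (hB.isClosed.preimage (𝒜.continuous_chart _ hA))
    refine ⟨l, ?_⟩
    ext x
    constructor
    · rintro ⟨y, rfl⟩
      have : a y ∈ 𝒜.chart _ hA ⁻¹' B := ha ▸ Set.mem_range_self y
      exact ⟨_, this, ha' y⟩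
    · rintro ⟨b, hb, rfl⟩
      obtain ⟨k, rfl⟩ := 𝒜.chart_surjective _ hA b
      obtain ⟨y, rfl⟩ : k ∈ Set.range a := ha ▸ hb
      exact ⟨y, (ha' y).symm⟩

theorem cont_q (j : J) : 𝒜.toCmp.Cont (𝒜.q j) := by
  refine ⟨⟨Set.range (𝒜.q j), j, rfl⟩, fun t => Set.mem_range_self t, ?_⟩
  -- The topology of the range was defined by a chosen chart, possibly different from `j`.
  have h : 𝒜.toCmp.top ⟨Set.range (𝒜.q j), j, rfl⟩ = 𝒜.top j rfl := by
    refine (𝒜.top_eq_induced _ rfl subset_rfl).trans ?_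
    exact @induced_id _ (𝒜.top j rfl)
  rw [h]
  exact 𝒜.continuous_chart j rfl

theorem exists_of_cont {T : Type*} [TopologicalSpace T] {f : T → Q}
    (hf : 𝒜.toCmp.Cont f) : ∃ j, ∀ t, f t ∈ Set.range (𝒜.q j) := by
  obtain ⟨⟨_, j, rfl⟩, h, -⟩ := hf
  exact ⟨j, h⟩

theorem isMorphism {D : Cmp.{u}} {F : Q → D.carrier} (h : ∀ j, D.Cont (F ∘ 𝒜.q j)) :
    IsMorphism 𝒜.toCmp D F := by
  refine isMorphism_of_cont fun A => ?_
  let B : Set Q := A.1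
  let _ : TopologicalSpace B := 𝒜.toCmp.top A
  have hq : Topology.IsQuotientMap (𝒜.chart _ A.2.choose_spec : _ → B) :=
    ⟨⟨rfl⟩, 𝒜.chart_surjective _ _⟩
  exact Cont.of_isQuotientMap (f := fun x : B => F x) hq (h _)

theorem isSmallCmp {κ : StrongLimitCard.{u}}
    (h : ∀ j, ∃ l, Cardinal.mk (𝒜.K l) < κ.card ∧ Set.range (𝒜.q j) ⊆ Set.range (𝒜.q l)) :
    IsSmallCmp κ 𝒜.toCmp := by
  rintro _ ⟨j, rfl⟩
  obtain ⟨l, hl, hjl⟩ := h j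
  exact (Cardinal.mk_le_mk_of_subset hjl).trans_lt (Cardinal.mk_range_le.trans_lt hl)

end Atlas

end Cmp

/-! ### The compactological reflection of a condensed set -/

namespace Reflection

variable (X : CompHaus.{u}ᵒᵖ ⥤ Type u)

variable {X} in
/-- The value of a section at a point. -/
def val {K : CompHaus.{u}} (x : X.obj (op K)) (k : K) : X.obj (op CompHaus.pt.{u}) :=
  Psh.pb X (CompHaus.point k) x

variable {X} in
theorem val_pb {K L : CompHaus.{u}} (f : K ⟶ L) (x : X.obj (op L)) (k : K) :
    val (Psh.pb X f x) k = val x (f k) := by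
  rw [val, ← Psh.pb_comp]
  rfl

variable {X} in
theorem val_pt (x : X.obj (op CompHaus.pt.{u})) : val x PUnit.unit = x := Psh.pb_id X x

/-- An equivalence relation on points whose pullback along every section is closed. -/
def IsClosedRel (r : Setoid (X.obj (op CompHaus.pt.{u}))) : Prop :=
  ∀ (K : CompHaus.{u}) (x : X.obj (op K)), IsClosed {p : K × K | r (val x p.1) (val x p.2)}

/-- The smallest closed equivalence relation. -/
def rel : Setoid (X.obj (op CompHaus.pt.{u})) := sInf {r | IsClosedRel X r}

variable {X}

/-- Closed relations are stable under arbitrary intersections, so the infimum is again one of them.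
-/
theorem isClosedRel_rel : IsClosedRel X (rel X) := by
  intro K x
  have : {p : K × K | rel X (val x p.1) (val x p.2)} =
      ⋂ r ∈ {r | IsClosedRel X r}, {p : K × K | r (val x p.1) (val x p.2)} := by
    ext p
    simp only [Set.mem_iInter]
    exact Iff.rfl
  rw [this]
  exact isClosed_biInter fun r hr => hr K x

theorem rel_le {r : Setoid (X.obj (op CompHaus.pt.{u}))} (hr : IsClosedRel X r) {a b}
    (h : rel X a b) : r a b := h r hr

variable (X) in
/-- The points of the reflection. -/
def Points : Type u := Quotient (rel X)

/-- The map to the reflection given by a section. -/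
def chart {K : CompHaus.{u}} (x : X.obj (op K)) (k : K) : Points X := Quotient.mk (rel X) (val x k)

theorem chart_pb {K L : CompHaus.{u}} (f : K ⟶ L) (x : X.obj (op L)) (k : K) :
    chart (Psh.pb X f x) k = chart x (f k) := by
  rw [chart, val_pb]
  rfl

theorem chart_eq_iff {K L : CompHaus.{u}} {x : X.obj (op K)} {y : X.obj (op L)} {k : K} {l : L} :
    chart x k = chart y l ↔ rel X (val x k) (val y l) := Quotient.eq

theorem exists_pt (z : Points X) : ∃ x : X.obj (op CompHaus.pt.{u}), chart x PUnit.unit = z := by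
  obtain ⟨x, rfl⟩ := Quotient.exists_rep z
  exact ⟨x, by rw [chart, val_pt]⟩

/-- Two sections glue over the coproduct of their domains; this is what makes the images of sections
directed. -/
theorem exists_amalgam (hX : IsCondensed X) {K L : CompHaus.{u}} (x : X.obj (op K))
    (y : X.obj (op L)) : ∃ (M : CompHaus.{u}) (z : X.obj (op M)) (a : K ⟶ M) (b : L ⟶ M),
      Psh.pb X a z = x ∧ Psh.pb X b z = y := by
  let A : Bool → CompHaus.{u} := fun b => cond b K L
  obtain ⟨z, hz, -⟩ := CompHaus.existsUnique_glue hX A fun b => match b with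
    | true => x
    | false => y
  exact ⟨_, z, CompHausLike.finiteCoproduct.ι A true, CompHausLike.finiteCoproduct.ι A false,
    hz true, hz false⟩

/-- The sections of a condensed set form an atlas for its reflection. -/
def atlas (hX : IsCondensed X) : Cmp.Atlas (Points X) (Σ K : CompHaus.{u}, X.obj (op K)) where
  K j := j.1
  q j := chart j.2
  nonempty := by
    -- The empty coproduct carries a unique section, so there is a chart even when `X` has no
    -- points.
    obtain ⟨x, -⟩ := CompHaus.existsUnique_glue hX (fun i : Empty => i.elim) fun i => i.elim
    exact ⟨⟨_, x⟩⟩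
  cover z := by
    obtain ⟨x, hx⟩ := exists_pt z
    exact ⟨⟨_, x⟩, PUnit.unit, hx⟩
  isClosed j := by
    simp only [chart_eq_iff]
    exact isClosedRel_rel _ _
  directed i j := by
    obtain ⟨M, z, a, b, ha, hb⟩ := exists_amalgam hX i.2 j.2
    exact ⟨⟨M, z⟩, a, b, fun k => by rw [← ha, chart_pb], fun k => by rw [← hb, chart_pb]⟩
  sub j A hA := by
    let i : CompHaus.sub j.1 A hA ⟶ j.1 := CompHaus.homOf ⟨Subtype.val, continuous_subtype_val⟩
    exact ⟨⟨_, Psh.pb X i j.2⟩, i, Subtype.range_val, fun k => (chart_pb _ _ _).symm⟩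

/-- The reflection of a condensed set. -/
def toCmp (hX : IsCondensed X) : Cmp.{u} := (atlas hX).toCmp

theorem cont_chart (hX : IsCondensed X) {K : CompHaus.{u}} (x : X.obj (op K)) :
    (toCmp hX).Cont (chart x) := (atlas hX).cont_q ⟨K, x⟩

/-- The universal morphism to the reflection. -/
def unit (hX : IsCondensed X) : X ⟶ Cmp.yo.obj (toCmp hX) :=
  Psh.homMk (fun _ x => Cmp.secMk (chart x) (cont_chart hX x))
    fun f x => Cmp.sec_ext fun k => chart_pb f x k

variable {C : Cmp.{u}}

theorem ev_app_eq (η : X ⟶ Cmp.yo.obj C) {K : CompHaus.{u}} (x : X.obj (op K)) (k : K) :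
    Cmp.ev (η.app _ x) k = Cmp.ev (η.app _ (val x k)) PUnit.unit := by
  rw [val, Psh.app_pb]
  rfl

/-- Along a section, the kernel becomes the coincidence set of a bounded continuous map with itself,
which is closed as members are Hausdorff. -/
theorem isClosedRel_of_hom (η : X ⟶ Cmp.yo.obj C) :
    IsClosedRel X (Setoid.ker fun x => Cmp.ev (η.app (op CompHaus.pt) x) PUnit.unit) := by
  intro K x
  simp only [Setoid.ker_def, ← ev_app_eq]
  exact (Cmp.cont_ev (η.app _ x)).isClosed_eq (Cmp.cont_ev (η.app _ x))

/-- Minimality of the relation makes the map on points factor; it is a morphism because it is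
bounded continuous on each chart, and unique because every point of the reflection comes from a
point of `X`. -/
theorem existsUnique_desc (hX : IsCondensed X) (η : X ⟶ Cmp.yo.obj C) :
    ∃! F : toCmp hX ⟶ C, unit hX ≫ Cmp.yo.map F = η := by
  let F : Points X → C.carrier := Quotient.lift
    (fun x => Cmp.ev (η.app (op CompHaus.pt) x) PUnit.unit)
    fun a b h => rel_le (isClosedRel_of_hom η) h
  have hF {K : CompHaus.{u}} (x : X.obj (op K)) : F ∘ chart x = Cmp.ev (η.app _ x) :=
    funext fun k => (ev_app_eq η x k).symm
  refine ⟨⟨F, (atlas hX).isMorphism fun j => ?_⟩, ?_, fun G hG => Cmp.hom_ext' fun z => ?_⟩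
  · exact hF j.2 ▸ Cmp.cont_ev _
  · exact Psh.hom_ext fun K x => Cmp.sec_ext fun k => congrFun (hF x) k
  · obtain ⟨x, rfl⟩ := exists_pt z
    rw [← hG] at hF
    exact (congrFun (hF x) PUnit.unit).symm

/-- The universal property of the reflection. -/
def equiv (X : Cond.{u}) (C : Cmp.{u}) :
    (toCmp X.property.1 ⟶ C) ≃ (X ⟶ (Cmp.toCond Cmp.isCondensedSet_yo).obj C) :=
  Equiv.ofBijective (fun F => ObjectProperty.homMk (unit X.property.1 ≫ Cmp.yo.map F)) <| by
    rw [Function.bijective_iff_existsUnique]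
    intro η
    obtain ⟨F, hF, hF'⟩ := existsUnique_desc X.property.1 η.hom
    exact ⟨F, by ext1; exact hF, fun G hG => hF' G (congrArg (fun k => k.hom) hG)⟩

theorem equiv_comp (X : Cond.{u}) (C D : Cmp.{u}) (g : C ⟶ D) (F : toCmp X.property.1 ⟶ C) :
    equiv X D (F ≫ g) = equiv X C F ≫ (Cmp.toCond Cmp.isCondensedSet_yo).map g := rfl

end Reflection

namespace Cond

/-- The reflector from condensed sets to compactological sets. -/
def reflector : Cond.{u} ⥤ Cmp.{u} :=
  Adjunction.leftAdjointOfEquiv Reflection.equiv Reflection.equiv_comp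

/-- The reflector is left adjoint to the embedding of compactological sets. -/
def reflectorAdj : reflector.{u} ⊣ Cmp.toCond Cmp.isCondensedSet_yo :=
  Adjunction.adjunctionOfEquivLeft Reflection.equiv Reflection.equiv_comp

theorem reflector_map_toFun {X Y : Cond.{u}} (f : X ⟶ Y) {K : CompHaus.{u}} (x : X.obj.obj (op K))
    (k : K) : (reflector.map f).toFun (Reflection.chart x k) =
      Reflection.chart (f.hom.app _ x) k := by
  have h : Reflection.equiv X (reflector.obj Y) (reflector.map f) =
      f ≫ Reflection.equiv Y _ (𝟙 _) := Equiv.apply_symm_apply _ _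
  exact congrArg (fun η : X ⟶ (Cmp.toCond Cmp.isCondensedSet_yo).obj (reflector.obj Y) =>
    Cmp.ev (η.hom.app _ x) k) h

/-- The charts range over arbitrarily large spaces, but by the local condition the image of each
lies in the image of a chart with `κ`-small domain. -/
theorem isSmallCmp_reflection {κ : StrongLimitCard.{u}} {X : CompHaus.{u}ᵒᵖ ⥤ Type u}
    (hX : IsCondensed X) (h : IsLocallyKSmall κ X) : IsSmallCmp κ (Reflection.toCmp hX) := by
  refine Cmp.Atlas.isSmallCmp _ ?_
  rintro ⟨T, z⟩
  obtain ⟨S, p, K, g, w, hp, hw⟩ := h T z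
  refine ⟨⟨K.obj, w⟩, K.property, ?_⟩
  rintro _ ⟨t, rfl⟩
  obtain ⟨s, rfl⟩ := hp t
  refine ⟨g s, ?_⟩
  change Reflection.chart w (g s) = Reflection.chart z (p s)
  rw [← Reflection.chart_pb, ← Reflection.chart_pb, hw]

end Cond

/-! ### Finite products -/

theorem preservesFiniteProducts_of_binary_of_terminal {C D : Type*} [Category* C] [Category* D]
    (F : C ⥤ D)
    (h₂ : ∀ X Y : C, ∃ (P : C) (f : P ⟶ X) (g : P ⟶ Y), Nonempty (IsLimit (BinaryFan.mk f g)) ∧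
      Nonempty (IsLimit (BinaryFan.mk (F.map f) (F.map g))))
    (h₀ : ∃ T : C, Nonempty (IsTerminal T) ∧ Nonempty (IsTerminal (F.obj T))) :
    PreservesFiniteProducts F := by
  have (X Y : C) : HasLimit (pair X Y) := by
    obtain ⟨P, f, g, ⟨h⟩, -⟩ := h₂ X Y
    exact ⟨⟨⟨_, h⟩⟩⟩
  have : HasBinaryProducts C := hasBinaryProducts_of_hasLimit_pair C
  obtain ⟨T, ⟨hT⟩, ⟨hT'⟩⟩ := h₀
  have : HasTerminal C := hT.hasTerminal
  have := hasFiniteProducts_of_has_binary_and_terminal (C := C)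
  have (X Y : C) : PreservesLimit (pair X Y) F := by
    obtain ⟨P, f, g, ⟨h⟩, ⟨h'⟩⟩ := h₂ X Y
    exact preservesLimit_of_preserves_limit_cone h ((isLimitMapConeBinaryFanEquiv F f g).symm h')
  have : PreservesLimitsOfShape (Discrete WalkingPair) F :=
    ⟨fun {K} => preservesLimit_of_iso_diagram F (diagramIsoPair K).symm⟩
  have : PreservesLimit (Functor.empty.{0} C) F :=
    preservesLimit_of_preserves_limit_cone hT ((isLimitMapConeEmptyConeEquiv F T).symm hT')
  have := preservesLimitsOfShape_pempty_of_preservesTerminal F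
  exact .of_preserves_binary_and_terminal F

namespace Psh

/-- The product of two presheaves of sets. -/
def prod {C : Type*} [Category* C] (X Y : Cᵒᵖ ⥤ Type w) : Cᵒᵖ ⥤ Type w :=
  Psh.mk (fun K => X.obj (op K) × Y.obj (op K)) (fun f p => (pb X f p.1, pb Y f p.2))
    (fun _ p => Prod.ext (pb_id X p.1) (pb_id Y p.2))
    fun f g p => Prod.ext (pb_comp X f g p.1) (pb_comp Y f g p.2)

section

variable {C : Type*} [Category* C] {X Y : Cᵒᵖ ⥤ Type w}

/-- A section of the product, from a pair of sections. -/
def pair {K : C} (x : X.obj (op K)) (y : Y.obj (op K)) : (prod X Y).obj (op K) := (x, y)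

/-- The first projection. -/
def fst : prod X Y ⟶ X := homMk (fun _ p => p.1) fun _ _ => rfl

/-- The second projection. -/
def snd : prod X Y ⟶ Y := homMk (fun _ p => p.2) fun _ _ => rfl

theorem pb_pair {K L : C} (f : K ⟶ L) (x : X.obj (op L)) (y : Y.obj (op L)) :
    pb (prod X Y) f (pair x y) = pair (pb X f x) (pb Y f y) := rfl

theorem exists_pair {K : C} (z : (prod X Y).obj (op K)) :
    ∃ (x : X.obj (op K)) (y : Y.obj (op K)), pair x y = z := ⟨z.1, z.2, rfl⟩

theorem pair_inj {K : C} {x x' : X.obj (op K)} {y y' : Y.obj (op K)} :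
    (pair x y : (prod X Y).obj (op K)) = pair x' y' ↔ x = x' ∧ y = y' := Prod.mk_inj

/-- The morphism to a product given by its components. -/
def lift {Z : Cᵒᵖ ⥤ Type w} (f : Z ⟶ X) (g : Z ⟶ Y) : Z ⟶ prod X Y :=
  homMk (fun _ z => pair (f.app _ z) (g.app _ z)) fun h z => by
    rw [app_pb, app_pb, pb_pair]

end

end Psh

theorem isCondensed_prod {X Y : CompHaus.{u}ᵒᵖ ⥤ Type u} (hX : IsCondensed X)
    (hY : IsCondensed Y) : IsCondensed (Psh.prod X Y) := by
  refine CompHaus.isCondensed_of (fun n A z => ?_) (fun K L f hf z z' h => ?_)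
    fun K L f hf φ hφ => ?_
  · choose x y hxy using fun a => Psh.exists_pair (z a)
    obtain ⟨x₀, hx, hx'⟩ := CompHaus.existsUnique_glue hX A x
    obtain ⟨y₀, hy, hy'⟩ := CompHaus.existsUnique_glue hY A y
    refine ⟨Psh.pair x₀ y₀, fun a => ?_, fun z₀ hz₀ => ?_⟩
    · rw [Psh.pb_pair, hx, hy, hxy]
    · obtain ⟨x₁, y₁, rfl⟩ := Psh.exists_pair z₀
      have h (a) := Psh.pair_inj.1 ((hz₀ a).trans (hxy a).symm)
      exact Psh.pair_inj.2 ⟨hx' x₁ fun a => (h a).1, hy' y₁ fun a => (h a).2⟩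
  · have := Prod.ext_iff.1 h
    exact Prod.ext (CompHaus.pb_injective hX f hf this.1) (CompHaus.pb_injective hY f hf this.2)
  · have h (E a b hab) := Prod.ext_iff.1 (hφ E a b hab)
    obtain ⟨x, hx⟩ := CompHaus.exists_pb_eq hX f hf φ.1 fun E a b hab => (h E a b hab).1
    obtain ⟨y, hy⟩ := CompHaus.exists_pb_eq hY f hf φ.2 fun E a b hab => (h E a b hab).2
    exact ⟨Psh.pair x y, Prod.ext hx hy⟩

/-- The fibre product over `T` of the two covers maps to the product of the two `κ`-small targets.
-/
theorem isLocallyKSmall_prod {X Y : CompHaus.{u}ᵒᵖ ⥤ Type u} {κ : StrongLimitCard.{u}}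
    (hX : IsLocallyKSmall κ X) (hY : IsLocallyKSmall κ Y) :
    IsLocallyKSmall κ (Psh.prod X Y) := by
  intro T z
  obtain ⟨x, y, rfl⟩ := Psh.exists_pair z
  obtain ⟨S, p, K, g, v, hp, hv⟩ := hX T x
  obtain ⟨S', p', K', g', v', hp', hv'⟩ := hY T y
  let E : CompHaus.{u} := CompHaus.sub (CompHaus.of (S × S')) {x | p x.1 = p' x.2}
    (isClosed_eq ((CompHaus.continuous_hom p).comp continuous_fst)
      ((CompHaus.continuous_hom p').comp continuous_snd))
  let a : E ⟶ S := CompHaus.homOf ⟨fun x => x.1.1, continuous_fst.comp continuous_subtype_val⟩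
  let b : E ⟶ S' := CompHaus.homOf ⟨fun x => x.1.2, continuous_snd.comp continuous_subtype_val⟩
  have hab : a ≫ p = b ≫ p' := CompHaus.hom_ext' fun x => x.2
  let r₁ : (CHaus.prod K K').obj ⟶ K.obj := CompHaus.homOf ⟨Prod.fst, continuous_fst⟩
  let r₂ : (CHaus.prod K K').obj ⟶ K'.obj := CompHaus.homOf ⟨Prod.snd, continuous_snd⟩
  let g₀ : E ⟶ (CHaus.prod K K').obj := CompHaus.homOf ⟨fun x => (g (a x), g' (b x)),
    ((CompHaus.continuous_hom g).comp (CompHaus.continuous_hom a)).prodMk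
      ((CompHaus.continuous_hom g').comp (CompHaus.continuous_hom b))⟩
  refine ⟨E, a ≫ p, CHaus.prod K K', g₀, Psh.pair (Psh.pb X r₁ v) (Psh.pb Y r₂ v'), fun t => ?_, ?_⟩
  · obtain ⟨s, rfl⟩ := hp t
    obtain ⟨s', hs'⟩ := hp' (p s)
    exact ⟨⟨(s, s'), hs'.symm⟩, rfl⟩
  · rw [Psh.pb_pair, Psh.pb_pair, Psh.pair_inj, ← Psh.pb_comp, ← Psh.pb_comp]
    refine ⟨?_, ?_⟩
    · rw [Psh.pb_comp, hv, ← Psh.pb_comp]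
      rfl
    · rw [hab, Psh.pb_comp, hv', ← Psh.pb_comp]
      rfl

namespace Cond

/-- Two bounds are compared through the local condition, which is visibly monotone in `κ`. -/
theorem exists_common_bound (X Y : Cond.{u}) :
    ∃ κ : StrongLimitCard.{u}, IsLocallyKSmall κ X.obj ∧ IsLocallyKSmall κ Y.obj := by
  obtain ⟨hX, κ, h⟩ := X.property
  obtain ⟨hY, κ', h'⟩ := Y.property
  replace h := CondK.isLocallyKSmall_of_isKGenerated hX h
  replace h' := CondK.isLocallyKSmall_of_isKGenerated hY h'
  rcases le_total κ.card κ'.card with hκ | hκ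
  · exact ⟨κ', h.mono hκ, h'⟩
  · exact ⟨κ, h, h'.mono hκ⟩

/-- The product of two condensed sets. -/
def prod (X Y : Cond.{u}) : Cond.{u} :=
  ⟨Psh.prod X.obj Y.obj, isCondensed_prod X.property.1 Y.property.1, by
    obtain ⟨κ, h, h'⟩ := exists_common_bound X Y
    exact ⟨κ, isKGenerated_of_isLocallyKSmall (isCondensed_prod X.property.1 Y.property.1)
      (isLocallyKSmall_prod h h')⟩⟩

/-- The first projection. -/
def fst (X Y : Cond.{u}) : prod X Y ⟶ X := ObjectProperty.homMk Psh.fst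

/-- The second projection. -/
def snd (X Y : Cond.{u}) : prod X Y ⟶ Y := ObjectProperty.homMk Psh.snd

/-- The product of condensed sets is computed sectionwise. -/
def isLimitProd (X Y : Cond.{u}) : IsLimit (BinaryFan.mk (fst X Y) (snd X Y)) :=
  BinaryFan.isLimitMk (fun s => ObjectProperty.homMk (Psh.lift s.fst.hom s.snd.hom))
    (fun _ => rfl) (fun _ => rfl) fun s m h h' => by
      rw [← h, ← h']
      rfl

/-- The terminal condensed set. -/
def terminal : Cond.{u} :=
  ⟨(Functor.const _).obj PUnit, by
    have h : IsCondensed ((Functor.const CompHaus.{u}ᵒᵖ).obj PUnit.{u + 1}) :=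
      CompHaus.isCondensed_of (fun n A z => ⟨PUnit.unit, fun _ => rfl, fun _ _ => rfl⟩)
        (fun K L f hf z z' h => rfl) fun K L f hf φ hφ => ⟨PUnit.unit, rfl⟩
    obtain ⟨κ, -⟩ := Cmp.exists_strongLimitCard.{u} 0
    exact ⟨h, κ, isKGenerated_of_isLocallyKSmall h fun T z => ⟨T, 𝟙 T, CHaus.pt,
      CompHaus.homOf ⟨fun _ => PUnit.unit, continuous_const⟩, PUnit.unit, fun t => ⟨t, rfl⟩, rfl⟩⟩⟩

/-- The terminal condensed set is terminal. -/
def isTerminalTerminal : IsTerminal terminal.{u} :=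
  IsTerminal.ofUniqueHom (fun _ => ObjectProperty.homMk (Psh.homMk (fun _ _ => PUnit.unit)
    fun _ _ => rfl)) fun _ _ => rfl

theorem isLocallyKSmall_terminal : IsLocallyKSmall κ terminal.{u}.obj :=
  fun T _ => ⟨T, 𝟙 T, CHaus.pt, CompHaus.homOf ⟨fun _ => PUnit.unit, continuous_const⟩,
    PUnit.unit, fun t => ⟨t, rfl⟩, rfl⟩

end Cond

/-- The product in `Cond` of two objects of the image is again locally `κ`-small, hence in the
essential image; a fully faithful functor reflects the limit cone. -/
theorem CondK.preservesFiniteProducts_toCond : PreservesFiniteProducts (CondK.toCond κ) := by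
  have := (CondK.fullyFaithfulToCond κ).full
  have := (CondK.fullyFaithfulToCond κ).faithful
  refine preservesFiniteProducts_of_binary_of_terminal _ (fun X Y => ?_) ?_
  · let Z := Cond.prod ((CondK.toCond κ).obj X) ((CondK.toCond κ).obj Y)
    obtain ⟨P, ⟨e⟩⟩ := (CondK.essImage_toCond_iff κ Z).2 (isKGenerated_of_isLocallyKSmall
      Z.property.1 (isLocallyKSmall_prod (CondK.isLocallyKSmall_free X)
        (CondK.isLocallyKSmall_free Y)))
    have h : IsLimit (BinaryFan.mk
        ((CondK.toCond κ).map ((CondK.toCond κ).preimage (e.hom ≫ Cond.fst _ _)))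
        ((CondK.toCond κ).map ((CondK.toCond κ).preimage (e.hom ≫ Cond.snd _ _)))) :=
      IsLimit.ofIsoLimit (Cond.isLimitProd _ _) (BinaryFan.ext e.symm (by simp) (by simp))
    exact ⟨P, _, _, ⟨isLimitOfReflectsOfMapIsLimit _ _ _ h⟩, ⟨h⟩⟩
  · obtain ⟨P, ⟨e⟩⟩ := (CondK.essImage_toCond_iff κ Cond.terminal).2
      (isKGenerated_of_isLocallyKSmall Cond.terminal.property.1 (Cond.isLocallyKSmall_terminal κ))
    have h : IsTerminal ((CondK.toCond κ).obj P) := Cond.isTerminalTerminal.ofIso e.symm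
    exact ⟨P, ⟨IsTerminal.isTerminalOfObj _ _ h⟩, ⟨h⟩⟩

namespace Reflection

variable {X Y : CompHaus.{u}ᵒᵖ ⥤ Type u}

/-- The section of a presheaf over `K` which is constant with a given value. -/
def constSec (K : CompHaus.{u}) (y : Y.obj (op CompHaus.pt.{u})) : Y.obj (op K) :=
  Psh.pb Y (CompHaus.homOf ⟨fun _ => PUnit.unit, continuous_const⟩) y

theorem val_constSec {K : CompHaus.{u}} (y : Y.obj (op CompHaus.pt.{u})) (k : K) :
    val (constSec K y) k = y := (val_pb _ _ _).trans (val_pt y)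

theorem val_pair {K : CompHaus.{u}} (x : X.obj (op K)) (y : Y.obj (op K)) (k : K) :
    val (Psh.pair x y : (Psh.prod X Y).obj (op K)) k = Psh.pair (val x k) (val y k) := rfl

/-- With one coordinate frozen, pairing a section with a constant one shows that the relation on the
product pulls back to a closed relation in the other coordinate. Minimality then gives both steps,
and transitivity combines them. -/
theorem rel_pair {x x' : X.obj (op CompHaus.pt.{u})} {y y' : Y.obj (op CompHaus.pt.{u})}
    (hx : rel X x x') (hy : rel Y y y') :
    rel (Psh.prod X Y) (Psh.pair x y) (Psh.pair x' y') := by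
  have h₁ : rel (Psh.prod X Y) (Psh.pair x y) (Psh.pair x' y) := by
    refine rel_le (r := (rel (Psh.prod X Y)).comap fun x => Psh.pair x y) (fun K s => ?_) hx
    have := isClosedRel_rel K (Psh.pair s (constSec K y) : (Psh.prod X Y).obj (op K))
    simp only [val_pair, val_constSec] at this
    exact this
  have h₂ : rel (Psh.prod X Y) (Psh.pair x' y) (Psh.pair x' y') := by
    refine rel_le (r := (rel (Psh.prod X Y)).comap fun y => Psh.pair x' y) (fun K s => ?_) hy
    have := isClosedRel_rel K (Psh.pair (constSec K x') s : (Psh.prod X Y).obj (op K))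
    simp only [val_pair, val_constSec] at this
    exact this
  exact (rel (Psh.prod X Y)).trans h₁ h₂

end Reflection

/-! ### The reflection of a product -/

namespace Cond

open Reflection

variable (X Y : Cond.{u})

/-- The map from the points of the reflection of a product to pairs of points. -/
def pointsProd (z : Points (prod X Y).obj) : Points X.obj × Points Y.obj :=
  ((reflector.map (fst X Y)).toFun z, (reflector.map (snd X Y)).toFun z)

variable {X Y}

theorem pointsProd_chart {K : CompHaus.{u}} (x : X.obj.obj (op K)) (y : Y.obj.obj (op K)) (k : K) :
    pointsProd X Y (chart (Psh.pair x y : (Psh.prod X.obj Y.obj).obj (op K)) k) =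
      (chart x k, chart y k) :=
  Prod.ext (reflector_map_toFun (fst X Y) _ k) (reflector_map_toFun (snd X Y) _ k)

variable (X Y) in
theorem pointsProd_bijective : Function.Bijective (pointsProd X Y) := by
  refine ⟨fun z z' h => ?_, fun ⟨p, q⟩ => ?_⟩
  · obtain ⟨s, rfl⟩ := exists_pt z
    obtain ⟨s', rfl⟩ := exists_pt z'
    obtain ⟨x, y, rfl⟩ := Psh.exists_pair s
    obtain ⟨x', y', rfl⟩ := Psh.exists_pair s'
    have h₀ := (pointsProd_chart x y PUnit.unit).symm.trans
      (h.trans (pointsProd_chart x' y' PUnit.unit))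
    obtain ⟨h₁, h₂⟩ := Prod.mk_inj.1 h₀
    exact chart_eq_iff.2 (rel_pair (chart_eq_iff.1 h₁) (chart_eq_iff.1 h₂))
  · obtain ⟨x, rfl⟩ := exists_pt p
    obtain ⟨y, rfl⟩ := exists_pt q
    exact ⟨_, pointsProd_chart x y PUnit.unit⟩

/-- On a member `A` the two components land in the images of charts over `K` and `L`, which combine
to one section over `K × L`. The fibre product of `A` with `K × L` maps onto `A` by a quotient map,
and there the map factors through that chart. -/
theorem isMorphism_of_pointsProd {D : Cmp.{u}} (f : D ⟶ reflector.obj X) (g : D ⟶ reflector.obj Y)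
    (F : D.carrier → Points (prod X Y).obj)
    (hF : ∀ d, pointsProd X Y (F d) = (f.toFun d, g.toFun d)) :
    Cmp.IsMorphism D (reflector.obj (prod X Y)) F := by
  refine Cmp.isMorphism_of_cont fun A => ?_
  let _ := D.top A
  have := D.compact A
  have := D.t2 A
  have hf : (toCmp X.property.1).Cont fun a : A.1 => f.toFun a :=
    f.isMorphism.cont (Cmp.Cont.subtype_val A)
  have hg : (toCmp Y.property.1).Cont fun a : A.1 => g.toFun a :=
    g.isMorphism.cont (Cmp.Cont.subtype_val A)
  obtain ⟨⟨K, x⟩, hx⟩ := Cmp.Atlas.exists_of_cont _ hf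
  obtain ⟨⟨L, y⟩, hy⟩ := Cmp.Atlas.exists_of_cont _ hg
  let r₁ : CompHaus.of (K × L) ⟶ K := CompHaus.homOf ⟨Prod.fst, continuous_fst⟩
  let r₂ : CompHaus.of (K × L) ⟶ L := CompHaus.homOf ⟨Prod.snd, continuous_snd⟩
  let s : (Psh.prod X.obj Y.obj).obj (op (CompHaus.of (K × L))) :=
    Psh.pair (Psh.pb X.obj r₁ x) (Psh.pb Y.obj r₂ y)
  have hs (k : K) (l : L) : pointsProd X Y (chart s (k, l)) = (chart x k, chart y l) := by
    rw [pointsProd_chart, chart_pb, chart_pb]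
    rfl
  have hcl : IsClosed {p : A.1 × (K × L) | f.toFun p.1 = chart x p.2.1 ∧
      g.toFun p.1 = chart y p.2.2} := by
    have h₁ := hf.isClosed_eq (cont_chart X.property.1 x)
    have h₂ := hg.isClosed_eq (cont_chart Y.property.1 y)
    exact (h₁.preimage (f := fun p : A.1 × (K × L) => (p.1, p.2.1)) (by fun_prop)).inter
      (h₂.preimage (f := fun p : A.1 × (K × L) => (p.1, p.2.2)) (by fun_prop))
  have := isCompact_iff_compactSpace.1 hcl.isCompact
  let P := {p : A.1 × (K × L) // f.toFun p.1 = chart x p.2.1 ∧ g.toFun p.1 = chart y p.2.2}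
  have : CompactSpace P := this
  let π : P → A.1 := fun p => p.1.1
  have hπ : Continuous π := continuous_fst.comp continuous_subtype_val
  have hπs : Function.Surjective π := fun a => by
    obtain ⟨k, hk⟩ := hx a
    obtain ⟨l, hl⟩ := hy a
    exact ⟨⟨(a, (k, l)), hk.symm, hl.symm⟩, rfl⟩
  refine Cmp.Cont.of_isQuotientMap (hπ.isClosedMap.isQuotientMap hπ hπs) ?_
  have e : (fun a : A.1 => F a) ∘ π = chart s ∘ fun p : P => p.1.2 := funext fun p => by
    apply (pointsProd_bijective X Y).1
    refine (hF _).trans (Eq.trans ?_ (hs _ _).symm)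
    exact Prod.ext p.2.1 p.2.2
  have hc : (reflector.obj (prod X Y)).Cont (chart s ∘ fun p : P => p.1.2) :=
    (cont_chart (prod X Y).property.1 s).comp_continuous
      (continuous_snd.comp continuous_subtype_val)
  exact e ▸ hc

variable (X Y) in
/-- The reflector preserves binary products. -/
def isLimitReflectorProd :
    IsLimit (BinaryFan.mk (reflector.map (fst X Y)) (reflector.map (snd X Y))) := by
  let φ := Equiv.ofBijective _ (pointsProd_bijective X Y)
  have h {D : Cmp.{u}} (f : D ⟶ reflector.obj X) (g : D ⟶ reflector.obj Y) (d : D.carrier) :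
      pointsProd X Y (φ.symm (f.toFun d, g.toFun d)) = (f.toFun d, g.toFun d) :=
    φ.apply_symm_apply _
  refine BinaryFan.isLimitMk (fun s => ⟨fun d => φ.symm (s.fst.toFun d, s.snd.toFun d),
    isMorphism_of_pointsProd s.fst s.snd _ (h s.fst s.snd)⟩)
    (fun s => Cmp.hom_ext' fun d => (Prod.ext_iff.1 (h s.fst s.snd d)).1)
    (fun s => Cmp.hom_ext' fun d => (Prod.ext_iff.1 (h s.fst s.snd d)).2)
    fun s m h₁ h₂ => Cmp.hom_ext' fun d => ?_
  apply (pointsProd_bijective X Y).1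
  refine Eq.trans ?_ (h s.fst s.snd d).symm
  rw [← h₁, ← h₂]
  rfl

/-- The reflector preserves the terminal object. -/
def isTerminalReflectorTerminal : IsTerminal (reflector.obj terminal.{u}) :=
  have hs (a b : Points terminal.{u}.obj) : a = b := by
    obtain ⟨x, rfl⟩ := exists_pt a
    obtain ⟨y, rfl⟩ := exists_pt b
    rfl
  IsTerminal.ofUniqueHom (fun D => ⟨fun _ => chart (X := terminal.{u}.obj) (K := CompHaus.pt)
      PUnit.unit PUnit.unit, Cmp.isMorphism_of_cont fun A =>
        let _ := D.top A
        Cmp.Cont.const (C := reflector.obj terminal.{u}) _⟩)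
    fun _ _ => Cmp.hom_ext' fun _ => hs _ _

theorem preservesFiniteProducts_reflector : PreservesFiniteProducts reflector.{u} :=
  preservesFiniteProducts_of_binary_of_terminal _
    (fun X Y => ⟨_, fst X Y, snd X Y, ⟨isLimitProd X Y⟩, ⟨isLimitReflectorProd X Y⟩⟩)
    ⟨_, ⟨isTerminalTerminal⟩, ⟨isTerminalReflectorTerminal⟩⟩

end Cond

/-! ### Ideals of closed subsets -/

/-- An ideal of closed subsets of a topological space. -/
@[ext]
structure ClosedIdeal (K : Type u) [TopologicalSpace K] : Type u where
  sets : Set (Set K)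
  isClosed : ∀ S ∈ sets, IsClosed S
  empty_mem : ∅ ∈ sets
  mono : ∀ S ∈ sets, ∀ S', IsClosed S' → S' ⊆ S → S' ∈ sets
  union_mem : ∀ S ∈ sets, ∀ S' ∈ sets, S ∪ S' ∈ sets

namespace ClosedIdeal

theorem iUnion_mem {K : Type u} [TopologicalSpace K] (I : ClosedIdeal K) {α : Type*} [Finite α]
    {S : α → Set K} (hS : ∀ a, S a ∈ I.sets) : ⋃ a, S a ∈ I.sets := by
  have := Fintype.ofFinite α
  have h (s : Finset α) : ⋃ a ∈ s, S a ∈ I.sets := by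
    classical
    induction s using Finset.induction_on with
    | empty => simpa using I.empty_mem
    | insert a s _ ih =>
      rw [Finset.set_biUnion_insert]
      exact I.union_mem _ (hS a) _ ih
  simpa using h Finset.univ

/-- The inverse image of an ideal under a map of compact spaces. -/
def pull {K L : CompHaus.{u}} (f : K ⟶ L) (I : ClosedIdeal L) : ClosedIdeal K where
  sets := {S | IsClosed S ∧ f '' S ∈ I.sets}
  isClosed S hS := hS.1
  empty_mem := ⟨isClosed_empty, by simpa using I.empty_mem⟩
  mono S hS S' hS' h := ⟨hS', I.mono _ hS.2 _ ((CompHaus.continuous_hom f).isClosedMap _ hS')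
    (Set.image_mono h)⟩
  union_mem S hS S' hS' := ⟨hS.1.union hS'.1, by
    rw [Set.image_union]
    exact I.union_mem _ hS.2 _ hS'.2⟩

theorem mem_pull {K L : CompHaus.{u}} {f : K ⟶ L} {I : ClosedIdeal L} {S : Set K} :
    S ∈ (pull f I).sets ↔ IsClosed S ∧ f '' S ∈ I.sets := Iff.rfl

theorem pull_id {K : CompHaus.{u}} (I : ClosedIdeal K) : pull (𝟙 K) I = I := by
  ext S
  rw [mem_pull, show (⇑(𝟙 K : K ⟶ K) : K → K) = id from rfl, Set.image_id]
  exact ⟨fun h => h.2, fun h => ⟨I.isClosed S h, h⟩⟩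

theorem pull_comp {K L M : CompHaus.{u}} (f : K ⟶ L) (g : L ⟶ M) (I : ClosedIdeal M) :
    pull (f ≫ g) I = pull f (pull g I) := by
  ext S
  have h : (f ≫ g) '' S = g '' (f '' S) := Set.image_comp g f S
  rw [mem_pull, mem_pull, mem_pull, h]
  exact ⟨fun ⟨h₁, h₂⟩ => ⟨h₁, (CompHaus.continuous_hom f).isClosedMap _ h₁, h₂⟩,
    fun ⟨h₁, _, h₂⟩ => ⟨h₁, h₂⟩⟩

/-- The presheaf of ideals of closed subsets. -/
def psh : (CHaus κ)ᵒᵖ ⥤ Type u :=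
  Psh.mk (fun K => ClosedIdeal K.obj) (fun f => pull f.hom) (fun _ I => pull_id I)
    fun f g I => pull_comp f.hom g.hom I

/-- A closed `S` belongs to the ideal exactly if its preimage belongs to the pulled back ideal, so
the latter determines the former. -/
theorem pull_injective {K L : CompHaus.{u}} {f : K ⟶ L} (hf : Function.Surjective f) :
    Function.Injective (pull f) := by
  have key (I : ClosedIdeal L) (S : Set L) :
      S ∈ I.sets ↔ IsClosed S ∧ f ⁻¹' S ∈ (pull f I).sets := by
    rw [mem_pull, Set.image_preimage_eq S hf]
    exact ⟨fun h => ⟨I.isClosed S h, (I.isClosed S h).preimage (CompHaus.continuous_hom f), h⟩,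
      fun h => h.2.2⟩
  intro I J h
  ext S
  rw [key I, key J, h]

/-- Agreement of the two pullbacks to the kernel pair forces `I` to be stable under saturation along
`f`; the descended ideal consists of the closed sets whose preimage is in `I`. -/
theorem exists_pull_eq {K L : CHaus κ} (f : K ⟶ L) (I : ClosedIdeal K.obj)
    (hI : ∀ (E : CHaus κ) (a b : E ⟶ K), (∀ e, f.hom (a.hom e) = f.hom (b.hom e)) →
      pull a.hom I = pull b.hom I) : ∃ J, pull f.hom J = I := by
  have hf := CompHaus.continuous_hom f.hom
  let E : CHaus κ := (CHaus.prod K K).sub {x | f.hom x.1 = f.hom x.2}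
    (isClosed_eq (hf.comp continuous_fst) (hf.comp continuous_snd))
  let a : E ⟶ K := CHaus.homOf ⟨fun x => x.1.1, continuous_fst.comp continuous_subtype_val⟩
  let b : E ⟶ K := CHaus.homOf ⟨fun x => x.1.2, continuous_snd.comp continuous_subtype_val⟩
  have hab := hI E a b fun x => x.2
  -- The saturation of `S` is the image under `b` of the preimage of `S` under `a`.
  have key (S : Set K.obj) (hS : S ∈ I.sets) : f.hom ⁻¹' (f.hom '' S) ∈ I.sets := by
    have hc : IsClosed (a.hom ⁻¹' S) := (I.isClosed S hS).preimage (CompHaus.continuous_hom a.hom)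
    have h₁ : a.hom ⁻¹' S ∈ (pull a.hom I).sets :=
      ⟨hc, I.mono S hS _ ((CompHaus.continuous_hom a.hom).isClosedMap _ hc)
        (Set.image_preimage_subset _ _)⟩
    rw [hab] at h₁
    convert h₁.2
    ext k
    constructor
    · rintro ⟨s, hs, hsk⟩
      exact ⟨⟨(s, k), hsk⟩, hs, rfl⟩
    · rintro ⟨⟨⟨s, k⟩, hsk⟩, hs, rfl⟩
      exact ⟨s, hs, hsk⟩
  refine ⟨⟨{S | IsClosed S ∧ f.hom ⁻¹' S ∈ I.sets}, fun S h => h.1,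
    ⟨isClosed_empty, I.empty_mem⟩, fun S hS S' hS' h => ⟨hS', I.mono _ hS.2 _ (hS'.preimage hf)
      (Set.preimage_mono h)⟩, fun S hS S' hS' => ⟨hS.1.union hS'.1, I.union_mem _ hS.2 _ hS'.2⟩⟩,
    ?_⟩
  ext S
  constructor
  · rintro ⟨h₁, -, h₂⟩
    exact I.mono _ h₂ _ h₁ (Set.subset_preimage_image _ _)
  · intro hS
    exact ⟨I.isClosed S hS, hf.isClosedMap _ (I.isClosed S hS), key S hS⟩

theorem existsUnique_glue {n : ℕ} (A : Fin n → CompHaus.{u}) (x : ∀ a, ClosedIdeal (A a)) :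
    ∃! y : ClosedIdeal (Σ a, A a),
      ∀ a, pull (L := CompHausLike.finiteCoproduct A) (CompHausLike.finiteCoproduct.ι A a) y =
        x a := by
  let j (a : Fin n) : A a → Σ a, A a := fun k => ⟨a, k⟩
  have hj (a : Fin n) : Function.Injective (j a) := sigma_mk_injective (β := fun a => A a)
  have hc (a : Fin n) : Continuous (j a) :=
    continuous_sigmaMk (σ := fun a => A a)
  have hcl (a : Fin n) : IsClosedMap (j a) :=
    (Topology.IsClosedEmbedding.sigmaMk (σ := fun a => A a)).isClosedMap
  refine ⟨⟨{S | IsClosed S ∧ ∀ a, j a ⁻¹' S ∈ (x a).sets}, fun S h => h.1,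
    ⟨isClosed_empty, fun a => (x a).empty_mem⟩, fun S hS S' hS' h => ⟨hS', fun a =>
      (x a).mono _ (hS.2 a) _ (hS'.preimage (hc a)) (Set.preimage_mono h)⟩,
    fun S hS S' hS' => ⟨hS.1.union hS'.1, fun a => (x a).union_mem _ (hS.2 a) _ (hS'.2 a)⟩⟩,
    fun a => ?_, fun y hy => ?_⟩
  · ext S
    constructor
    · rintro ⟨h₁, -, h₂⟩
      have : j a ⁻¹' (j a '' S) ∈ (x a).sets := h₂ a
      rwa [Set.preimage_image_eq _ (hj a)] at this
    · intro hS
      have h₁ := (x a).isClosed S hS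
      refine ⟨h₁, hcl a _ h₁, fun b => ?_⟩
      change j b ⁻¹' (j a '' S) ∈ _
      by_cases hab : b = a
      · subst hab
        rwa [Set.preimage_image_eq _ (hj _)]
      · convert (x b).empty_mem
        ext k
        simp only [Set.mem_preimage, Set.mem_image, Set.mem_empty_iff_false, iff_false]
        rintro ⟨k', -, h⟩
        exact hab (congrArg Sigma.fst h).symm
  · have hy' (a) (S : Set (A a)) : S ∈ (x a).sets ↔ IsClosed S ∧ j a '' S ∈ y.sets := by
      rw [← hy a]
      exact Iff.rfl
    ext S
    constructor
    · intro hS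
      refine ⟨y.isClosed S hS, fun a => (hy' a _).2 ?_⟩
      have h := (y.isClosed S hS).preimage (hc a)
      exact ⟨h, y.mono S hS _ (hcl a _ h) (Set.image_preimage_subset _ _)⟩
    · rintro ⟨-, hS⟩
      have h : S = ⋃ a, j a '' (j a ⁻¹' S) := by
        ext ⟨a, k⟩
        simp only [Set.mem_iUnion]
        constructor
        · intro hk
          exact ⟨a, k, hk, rfl⟩
        · rintro ⟨b, k', hk', h⟩
          rwa [← h]
      rw [h]
      exact y.iUnion_mem fun a => ((hy' a _).1 (hS a)).2

theorem isCondensed_psh : IsCondensed (psh κ) :=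
  CHaus.isCondensed_of (fun _ A x => existsUnique_glue (fun a => (A a).obj) x)
    (fun _ _ _ hf => pull_injective hf) fun _ _ f _ I hI => exists_pull_eq κ f I hI

end ClosedIdeal

/-! ### Coverings and quasicompactness -/

namespace CondK

variable {κ}

/-- The morphism from a representable given by a section. -/
def ofSec (X : CondK κ) {K : CHaus κ} (x : X.obj.obj (op K)) : (rep κ).obj K ⟶ X :=
  ObjectProperty.homMk (Psh.homMk (X := yoneda.obj K) (fun _ f => Psh.pb X.obj f x)
    fun f g => Psh.pb_comp X.obj f g x)

/-- The section given by a morphism from a representable. -/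
def secOf {X : CondK κ} {K : CHaus κ} (φ : (rep κ).obj K ⟶ X) : X.obj.obj (op K) :=
  φ.hom.app (op K) (𝟙 K)

theorem app_eq_pb {X : CondK κ} {K T : CHaus κ} (φ : (rep κ).obj K ⟶ X) (f : T ⟶ K) :
    φ.hom.app (op T) f = Psh.pb X.obj f (secOf φ) := by
  have h : f = Psh.pb (yoneda.obj K) f (𝟙 K) := (Category.comp_id f).symm
  conv_lhs => rw [h]
  exact Psh.app_pb φ.hom f (𝟙 K)

theorem rep_hom_ext {X : CondK κ} {K : CHaus κ} {φ ψ : (rep κ).obj K ⟶ X}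
    (h : secOf φ = secOf ψ) : φ = ψ := by
  ext1
  refine Psh.hom_ext fun T f => ?_
  exact (app_eq_pb φ f).trans ((congrArg _ h).trans (app_eq_pb ψ f).symm)

theorem hom_ext' {X Y : CondK κ} {φ ψ : X ⟶ Y}
    (h : ∀ (T : CHaus κ) (x : X.obj.obj (op T)), φ.hom.app (op T) x = ψ.hom.app (op T) x) :
    φ = ψ := by
  ext1
  exact Psh.hom_ext h

/-- The underlying map of a section of a representable. -/
def repMap {M T : CHaus κ} (f : ((rep κ).obj M).obj.obj (op T)) : T.obj → M.obj :=
  fun t => (show T ⟶ M from f).hom t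

/-- The ideals of closed sets whose image under a section is finitely covered by a family of
subsets, as a morphism. -/
def coveredIdeal {Z : CondK κ} {M : CHaus κ} (m : Z ⟶ (rep κ).obj M) {I : Type u}
    (R : I → Set M.obj) : Z ⟶ ⟨ClosedIdeal.psh κ, ClosedIdeal.isCondensed_psh κ⟩ :=
  ObjectProperty.homMk <| Psh.homMk (fun T z => show ClosedIdeal T.obj from
    { sets := {S | IsClosed S ∧ ∃ s : Finset I, repMap (m.hom.app _ z) '' S ⊆ ⋃ i ∈ s, R i}
      isClosed := fun _ h => h.1
      empty_mem := ⟨isClosed_empty, ∅, by simp⟩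
      mono := fun S hS S' hS' h => ⟨hS', hS.2.imp fun _ => (Set.image_mono h).trans⟩
      union_mem := by
        classical
        rintro S ⟨hS, s, hs⟩ S' ⟨hS', s', hs'⟩
        refine ⟨hS.union hS', s ∪ s', ?_⟩
        rw [Set.image_union, Finset.set_biUnion_union]
        exact Set.union_subset_union hs hs' }) fun {T' T} g z => ClosedIdeal.ext <| by
    have hg := CompHaus.continuous_hom g.hom
    have e (S : Set T'.obj) : repMap (m.hom.app _ (Psh.pb Z.obj g z)) '' S =
        repMap (m.hom.app _ z) '' (g.hom '' S) := by
      rw [← Set.image_comp, Psh.app_pb]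
      rfl
    ext S
    constructor
    · rintro ⟨hS, s, hs⟩
      exact ⟨hS, hg.isClosedMap _ hS, s, e S ▸ hs⟩
    · rintro ⟨hS, -, s, hs⟩
      exact ⟨hS, s, (e S).symm ▸ hs⟩

theorem mem_coveredIdeal {Z : CondK κ} {M : CHaus κ} (m : Z ⟶ (rep κ).obj M) {I : Type u}
    (R : I → Set M.obj) {T : CHaus κ} (z : Z.obj.obj (op T)) (S : Set T.obj) :
    S ∈ (show ClosedIdeal T.obj from (coveredIdeal m R).hom.app (op T) z).sets ↔
      IsClosed S ∧ ∃ s : Finset I, repMap (m.hom.app _ z) '' S ⊆ ⋃ i ∈ s, R i := Iff.rfl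

/-- Two morphisms from `Z` to the condensed set of ideals are compared: closed sets with finitely
covered image, and all closed sets. They agree on each member of the family, whose own range covers
its image, so they agree on `Z`. Evaluation at the whole of `T` yields the finite set. -/
theorem exists_finite_of_isCovering {Z : CondK κ} {M : CHaus κ} (m : Z ⟶ (rep κ).obj M) {I : Type u}
    {K : I → CHaus κ} {φ : ∀ i, (rep κ).obj (K i) ⟶ Z} (h : IsCovering K φ) {T : CHaus κ}
    (z : Z.obj.obj (op T)) : ∃ s : Finset I, Set.range (repMap (m.hom.app _ z)) ⊆
      ⋃ i ∈ s, Set.range (repMap (m.hom.app _ (secOf (φ i)))) := by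
  let R (i : I) : Set M.obj := Set.range (repMap (m.hom.app _ (secOf (φ i))))
  -- The one-element family consisting of the whole space produces the ideal of all closed sets.
  have all {T : CHaus κ} (z : Z.obj.obj (op T)) (S : Set T.obj) (hS : IsClosed S) :
      S ∈ (show ClosedIdeal T.obj from (coveredIdeal m (I := PUnit.{u + 1}) fun _ =>
        Set.univ).hom.app (op T) z).sets :=
    (mem_coveredIdeal m _ z S).2 ⟨hS, {PUnit.unit}, fun _ _ =>
      Set.mem_biUnion (Finset.mem_singleton_self _) trivial⟩
  have key : coveredIdeal m R = coveredIdeal m (I := PUnit.{u + 1}) fun _ => Set.univ := by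
    refine h _ _ fun i => rep_hom_ext (ClosedIdeal.ext (Set.ext fun S => ?_))
    refine ⟨fun hS => all (secOf (φ i)) S ((mem_coveredIdeal m R (secOf (φ i)) S).1 hS).1,
      fun hS => (mem_coveredIdeal m R (secOf (φ i)) S).2
        ⟨((mem_coveredIdeal m _ (secOf (φ i)) S).1 hS).1, {i}, ?_⟩⟩
    exact (Set.image_subset_range _ _).trans
      (Set.subset_biUnion_of_mem (u := R) (Finset.mem_singleton_self i))
  have hz := all z Set.univ isClosed_univ
  rw [← key] at hz
  obtain ⟨-, s, hs⟩ := (mem_coveredIdeal m R z _).1 hz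
  exact ⟨s, Set.image_univ ▸ hs⟩

/-- Applied to the identity, the finiteness lemma gives a finite jointly surjective subfamily, and
sections of a condensed set can be compared on such a family. -/
theorem isQuasicompact_rep (M : CHaus κ) : IsQuasicompact ((rep κ).obj M) := by
  intro I K φ h
  obtain ⟨s, hs⟩ := exists_finite_of_isCovering (𝟙 _) h (T := M) (𝟙 M)
  refine ⟨s, fun Y g h hgh => rep_hom_ext ?_⟩
  refine CHaus.eq_of_finite_cover Y.property (A := fun i : s => K i) (fun i => secOf (φ i))
    (fun b => ?_) fun i => ?_
  · obtain ⟨i, hi, x, hx⟩ := Set.mem_iUnion₂.1 (hs ⟨b, rfl⟩)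
    exact ⟨⟨i, hi⟩, x, hx⟩
  · exact (app_eq_pb g (secOf (φ i))).symm.trans
      ((congrArg secOf (hgh i)).trans (app_eq_pb h (secOf (φ i))))

theorem isQuasicompact_of_iso {Z Z' : CondK κ} (e : Z ≅ Z') (h : IsQuasicompact Z) :
    IsQuasicompact Z' := by
  intro I K φ hφ
  obtain ⟨s, hs⟩ := h K (fun i => φ i ≫ e.inv) fun Y g h hgh => by
    rw [← cancel_epi e.inv]
    exact hφ _ _ fun i => by simpa using hgh i
  refine ⟨s, fun Y g h hgh => ?_⟩
  rw [← cancel_epi e.hom]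
  exact hs _ _ fun i => by simpa using hgh i

theorem isQuasiseparated_of_iso {X Y : CondK κ} (e : X ≅ Y) (hX : IsQuasiseparated X) :
    IsQuasiseparated Y := fun _ f g _ p q h =>
  hX (f ≫ e.inv) (g ≫ e.inv) p q
    (h.of_iso (Iso.refl _) (Iso.refl _) (Iso.refl _) e.symm (by simp) (by simp) (by simp) (by simp))

end CondK

/-! ### Quasiseparated condensed sets -/

namespace CondK

/-- The `κ`-condensed set attached to a compactological set. -/
abbrev ofCmp (C : Cmp.{u}) : CondK κ :=
  (Cond.res κ).obj ((Cmp.toCond Cmp.isCondensedSet_yo).obj C)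

variable {κ}

/-- A section of `ofCmp κ C`, as a map. -/
def evK {C : Cmp.{u}} {K : CHaus κ} (s : (ofCmp κ C).obj.obj (op K)) : K.obj → C.carrier :=
  Cmp.ev (show (Cmp.yo.obj C).obj (op K.obj) from s)

theorem evK_ext {C : Cmp.{u}} {K : CHaus κ} {s t : (ofCmp κ C).obj.obj (op K)}
    (h : ∀ k, evK s k = evK t k) : s = t := Cmp.sec_ext h

theorem cont_evK {C : Cmp.{u}} {K : CHaus κ} (s : (ofCmp κ C).obj.obj (op K)) : C.Cont (evK s) :=
  Cmp.cont_ev _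

theorem comp_app {X Y Z : CondK κ} (f : X ⟶ Y) (g : Y ⟶ Z) {T : CHaus κ} (x : X.obj.obj (op T)) :
    (f ≫ g).hom.app (op T) x = g.hom.app (op T) (f.hom.app (op T) x) := rfl

theorem isPullback_of_existsUnique {P A B D : CondK κ} {p : P ⟶ A} {q : P ⟶ B} {f : A ⟶ D}
    {g : B ⟶ D} (w : p ≫ f = q ≫ g)
    (h : ∀ (T : CHaus κ) (a : A.obj.obj (op T)) (b : B.obj.obj (op T)),
      f.hom.app _ a = g.hom.app _ b → ∃! z, p.hom.app (op T) z = a ∧ q.hom.app (op T) z = b) :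
    IsPullback p q f g := by
  have hs (s : PullbackCone f g) (T : CHaus κ) (z : s.pt.obj.obj (op T)) :
      f.hom.app _ (s.fst.hom.app _ z) = g.hom.app _ (s.snd.hom.app _ z) := by
    rw [← comp_app, ← comp_app, s.condition]
  choose l hl hl' using h
  let lift (s : PullbackCone f g) : s.pt ⟶ P :=
    ObjectProperty.homMk <| Psh.homMk (fun T z => l T _ _ (hs s T z)) fun {T' T} r z => by
      symm
      refine hl' _ _ _ (hs s T' _) _ ⟨?_, ?_⟩
      · rw [Psh.app_pb, (hl _ _ _ _).1, Psh.app_pb]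
      · rw [Psh.app_pb, (hl _ _ _ _).2, Psh.app_pb]
  refine ⟨⟨w⟩, ⟨PullbackCone.IsLimit.mk w lift (fun s => ?_) (fun s => ?_) fun s m h₁ h₂ => ?_⟩⟩
  · exact hom_ext' fun T z => (hl _ _ _ (hs s T z)).1
  · exact hom_ext' fun T z => (hl _ _ _ (hs s T z)).2
  · refine hom_ext' fun T z => hl' _ _ _ (hs s T z) _ ⟨?_, ?_⟩
    · rw [← comp_app, h₁]
    · rw [← comp_app, h₂]

/-- The coincidence locus of two bounded continuous maps is a closed subspace of `K × K`, and it
represents the pullback. -/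
theorem exists_isPullback_rep {C : Cmp.{u}} {K : CHaus κ} (f g : (rep κ).obj K ⟶ ofCmp κ C) :
    ∃ (M : CHaus κ) (p q : (rep κ).obj M ⟶ (rep κ).obj K), IsPullback p q f g := by
  let M : CHaus κ := (CHaus.prod K K).sub {x | evK (secOf f) x.1 = evK (secOf g) x.2}
    ((cont_evK (secOf f)).isClosed_eq (cont_evK (secOf g)))
  let a : M ⟶ K := CHaus.homOf ⟨fun x => x.1.1, continuous_fst.comp continuous_subtype_val⟩
  let b : M ⟶ K := CHaus.homOf ⟨fun x => x.1.2, continuous_snd.comp continuous_subtype_val⟩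
  have w : (rep κ).map a ≫ f = (rep κ).map b ≫ g := rep_hom_ext <| by
    refine (app_eq_pb f (𝟙 M ≫ a)).trans (Eq.trans ?_ (app_eq_pb g (𝟙 M ≫ b)).symm)
    exact evK_ext fun x => x.2
  refine ⟨M, (rep κ).map a, (rep κ).map b, isPullback_of_existsUnique w ?_⟩
  intro T (c : T ⟶ K) (d : T ⟶ K) h
  have h' := (app_eq_pb f c).symm.trans (h.trans (app_eq_pb g d))
  let z : T ⟶ M := CHaus.homOf ⟨fun t => ⟨(c.hom t, d.hom t), congrArg (fun x => evK x t) h'⟩,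
    ((CompHaus.continuous_hom c.hom).prodMk (CompHaus.continuous_hom d.hom)).subtype_mk _⟩
  refine ⟨z, ⟨rfl, rfl⟩, ?_⟩
  rintro (y : T ⟶ M) ⟨h₁, h₂⟩
  refine CHaus.hom_ext fun t => Subtype.ext (Prod.ext ?_ ?_)
  · exact congrArg (fun k : T ⟶ K => k.hom t) h₁
  · exact congrArg (fun k : T ⟶ K => k.hom t) h₂

theorem isQuasiseparated_ofCmp (C : Cmp.{u}) : IsQuasiseparated (ofCmp κ C) := by
  intro K f g Z p q h
  obtain ⟨M, p', q', h'⟩ := exists_isPullback_rep f g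
  exact isQuasicompact_of_iso (h'.isoIsPullback _ _ h) (isQuasicompact_rep M)

end CondK

/-! ### Kernel pairs and points of quasiseparated condensed sets -/

namespace CondK

variable {κ} {X : CondK κ}

/-- The kernel pair of a section. -/
def kernelPsh {K : CHaus κ} (x : X.obj.obj (op K)) : (CHaus κ)ᵒᵖ ⥤ Type u :=
  Psh.mk (fun T => {c : (T ⟶ K) × (T ⟶ K) // Psh.pb X.obj c.1 x = Psh.pb X.obj c.2 x})
    (fun f c => ⟨(f ≫ c.1.1, f ≫ c.1.2), by rw [Psh.pb_comp, Psh.pb_comp, c.2]⟩)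
    (fun _ c => Subtype.ext (Prod.ext (Category.id_comp c.1.1) (Category.id_comp c.1.2)))
    fun f g c => Subtype.ext (Prod.ext (Category.assoc f g c.1.1) (Category.assoc f g c.1.2))

theorem isCondensed_kernelPsh {K : CHaus κ} (x : X.obj.obj (op K)) :
    IsCondensed (kernelPsh x) := by
  refine CHaus.isCondensed_of (fun n A c => ?_) (fun S T f hf c d h => ?_) fun S T f hf c hc => ?_
  · refine ⟨⟨(CHaus.sigmaDesc A fun a => (c a).1.1, CHaus.sigmaDesc A fun a => (c a).1.2),
      CHaus.eq_of_finite_cover X.property (CHaus.sigmaι A) (fun ⟨a, t⟩ => ⟨a, t, rfl⟩) fun a => ?_⟩,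
      fun a => rfl, fun d hd => Subtype.ext (Prod.ext ?_ ?_)⟩
    · rw [← Psh.pb_comp, ← Psh.pb_comp]
      exact (c a).2
    · exact CHaus.hom_ext fun ⟨a, t⟩ => congrArg (fun c => c.1.1.hom t) (hd a)
    · exact CHaus.hom_ext fun ⟨a, t⟩ => congrArg (fun c => c.1.2.hom t) (hd a)
  · have := CHaus.epi_of_surjective f hf
    exact Subtype.ext (Prod.ext ((cancel_epi f).1 (congrArg (fun c => c.1.1) h))
      ((cancel_epi f).1 (congrArg (fun c => c.1.2) h)))
  · obtain ⟨a, ha⟩ := CHaus.exists_pb_eq (CHaus.isCondensed_yoneda K) f hf c.1.1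
      fun E a b hab => congrArg (fun c => c.1.1) (hc E a b hab)
    obtain ⟨b, hb⟩ := CHaus.exists_pb_eq (CHaus.isCondensed_yoneda K) f hf c.1.2
      fun E a b hab => congrArg (fun c => c.1.2) (hc E a b hab)
    refine ⟨⟨(a, b), CHaus.pb_injective X.property f hf ?_⟩, Subtype.ext (Prod.ext ha hb)⟩
    refine (Psh.pb_comp X.obj f a x).symm.trans (Eq.trans ?_ (Psh.pb_comp X.obj f b x))
    replace ha : f ≫ a = c.1.1 := ha
    replace hb : f ≫ b = c.1.2 := hb
    rw [ha, hb]
    exact c.2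

/-- The kernel pair of a section, as a `κ`-condensed set. -/
abbrev kernel {K : CHaus κ} (x : X.obj.obj (op K)) : CondK κ :=
  ⟨kernelPsh x, isCondensed_kernelPsh x⟩

theorem isQuasicompact_kernel (hX : IsQuasiseparated X) {K : CHaus κ} (x : X.obj.obj (op K)) :
    IsQuasicompact (kernel x) := by
  let p : kernel x ⟶ (rep κ).obj K :=
    ObjectProperty.homMk (Psh.homMk (fun T c => show T ⟶ K from Subtype.val c |>.1) fun _ _ => rfl)
  let q : kernel x ⟶ (rep κ).obj K :=
    ObjectProperty.homMk (Psh.homMk (fun T c => show T ⟶ K from Subtype.val c |>.2) fun _ _ => rfl)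
  refine hX (ofSec X x) (ofSec X x) p q (isPullback_of_existsUnique ?_ ?_)
  · exact hom_ext' fun T c => c.2
  · intro T a b h
    exact ⟨⟨(a, b), h⟩, ⟨rfl, rfl⟩, fun c hc => Subtype.ext (Prod.ext hc.1 hc.2)⟩

/-- The value of a section at a point. -/
def val {K : CHaus κ} (x : X.obj.obj (op K)) (k : K.obj) : X.obj.obj (op (CHaus.pt : CHaus κ)) :=
  Psh.pb X.obj (CHaus.point k) x

theorem val_pb {K L : CHaus κ} (f : K ⟶ L) (x : X.obj.obj (op L)) (k : K.obj) :
    val (Psh.pb X.obj f x) k = val x (f.hom k) := by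
  rw [val, ← Psh.pb_comp]
  rfl

theorem val_pt (x : X.obj.obj (op (CHaus.pt : CHaus κ))) : val x PUnit.unit = x :=
  Psh.pb_id X.obj x

/-- Two maps, as a map to the product. -/
def pair {T K : CHaus κ} (a b : T ⟶ K) : T ⟶ CHaus.prod K K :=
  CHaus.homOf ⟨fun t => (a.hom t, b.hom t),
    (CompHaus.continuous_hom a.hom).prodMk (CompHaus.continuous_hom b.hom)⟩

/-- The first projection of a closed subspace of a product. -/
def subFst {K L : CHaus κ} (A : Set (K.obj × L.obj)) (hA : IsClosed A) :
    (CHaus.prod K L).sub A hA ⟶ K :=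
  CHaus.homOf ⟨fun x => x.1.1, continuous_fst.comp continuous_subtype_val⟩

/-- The second projection of a closed subspace of a product. -/
def subSnd {K L : CHaus κ} (A : Set (K.obj × L.obj)) (hA : IsClosed A) :
    (CHaus.prod K L).sub A hA ⟶ L :=
  CHaus.homOf ⟨fun x => x.1.2, continuous_snd.comp continuous_subtype_val⟩

/-- A map to a closed subspace of a product. -/
def subLift {K L T : CHaus κ} (A : Set (K.obj × L.obj)) (hA : IsClosed A) (a : T ⟶ K) (b : T ⟶ L)
    (h : ∀ t, (a.hom t, b.hom t) ∈ A) : T ⟶ (CHaus.prod K L).sub A hA :=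
  CHaus.homOf ⟨fun t => ⟨(a.hom t, b.hom t), h t⟩,
    ((CompHaus.continuous_hom a.hom).prodMk (CompHaus.continuous_hom b.hom)).subtype_mk _⟩

/-- A quasiseparated condensed set is governed by finitely many closed relations on each chart. -/
theorem exists_finite_kernel (hX : IsQuasiseparated X) {K : CHaus κ} (x : X.obj.obj (op K)) :
    ∃ s : Set (Set (K.obj × K.obj)), s.Finite ∧
      (∀ A ∈ s, ∃ hA : IsClosed A, Psh.pb X.obj (subFst A hA) x = Psh.pb X.obj (subSnd A hA) x) ∧
      ∀ k k', val x k = val x k' → (k, k') ∈ ⋃₀ s := by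
  classical
  let I : Type u := {A : Set (K.obj × K.obj) //
    ∃ hA : IsClosed A, Psh.pb X.obj (subFst A hA) x = Psh.pb X.obj (subSnd A hA) x}
  let M (i : I) : CHaus κ := (CHaus.prod K K).sub i.1 i.2.1
  let c (i : I) : (kernel x).obj.obj (op (M i)) := ⟨(subFst _ i.2.1, subSnd _ i.2.1), i.2.2⟩
  let φ (i : I) : (rep κ).obj (M i) ⟶ kernel x := ofSec (kernel x) (c i)
  -- A pair `(a, b)` in the kernel factors through its image in `K × K`. The image is a closed
  -- relation along which `x` agrees, because `T` surjects onto it.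
  have hφ : IsCovering M φ := by
    intro Y g h hgh
    refine hom_ext' fun T => ?_
    rintro ⟨⟨a, b⟩, hab⟩
    replace hab : Psh.pb X.obj a x = Psh.pb X.obj b x := hab
    have hr : IsClosed (Set.range (pair a b).hom) :=
      (isCompact_range (CompHaus.continuous_hom (pair a b).hom)).isClosed
    let r : T ⟶ (CHaus.prod K K).sub _ hr := subLift _ hr a b fun t => ⟨t, rfl⟩
    let i : I := ⟨Set.range (pair a b).hom, hr, by
      apply CHaus.pb_injective X.property r
      · rintro ⟨_, t, rfl⟩
        exact ⟨t, rfl⟩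
      · exact (Psh.pb_comp X.obj r (subFst _ hr) x).symm.trans
          (hab.trans (Psh.pb_comp X.obj r (subSnd _ hr) x))⟩
    exact congrArg (fun η : (rep κ).obj (M i) ⟶ Y => η.hom.app (op T) r) (hgh i)
  obtain ⟨s, hs⟩ := isQuasicompact_kernel hX x M φ hφ
  let m : kernel x ⟶ (rep κ).obj (CHaus.prod K K) :=
    ObjectProperty.homMk (Psh.homMk (fun T c => show T ⟶ CHaus.prod K K from
      pair (Subtype.val c).1 (Subtype.val c).2) fun _ _ => rfl)
  refine ⟨Subtype.val '' (s : Set I), s.finite_toSet.image _, ?_, fun k k' h => ?_⟩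
  · rintro _ ⟨i, -, rfl⟩
    exact i.2
  · obtain ⟨t, ht⟩ := exists_finite_of_isCovering m hs (T := CHaus.pt)
      ⟨(CHaus.point k, CHaus.point k'), h⟩
    obtain ⟨i, -, y, hy⟩ := Set.mem_iUnion₂.1 (ht ⟨PUnit.unit, rfl⟩)
    refine ⟨_, ⟨i.1, i.2, rfl⟩, ?_⟩
    have : (k, k') = y.1 := hy.symm
    rw [this]
    exact y.2

theorem isClosed_val_eq (hX : IsQuasiseparated X) {K : CHaus κ} (x : X.obj.obj (op K)) :
    IsClosed {p : K.obj × K.obj | val x p.1 = val x p.2} := by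
  obtain ⟨s, hs, h, h'⟩ := exists_finite_kernel hX x
  have : {p : K.obj × K.obj | val x p.1 = val x p.2} = ⋃₀ s := by
    ext ⟨k, k'⟩
    refine ⟨h' k k', ?_⟩
    rintro ⟨A, hA, hk⟩
    obtain ⟨hA', e⟩ := h A hA
    let p : ((CHaus.prod K K).sub A hA').obj := ⟨(k, k'), hk⟩
    exact (val_pb _ x p).symm.trans ((congrArg (fun y => val y p) e).trans (val_pb _ x p))
  rw [this]
  rw [Set.sUnion_eq_biUnion]
  exact hs.isClosed_biUnion fun A hA => (h A hA).1

/-- The finitely many closed relations pull back to a finite closed cover of `E`, and on each piece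
the two pullbacks agree as sections, not only on points. -/
theorem pb_eq_of_val_eq (hX : IsQuasiseparated X) {K E : CHaus κ} (x : X.obj.obj (op K))
    (a b : E ⟶ K) (hab : ∀ e, val x (a.hom e) = val x (b.hom e)) :
    Psh.pb X.obj a x = Psh.pb X.obj b x := by
  obtain ⟨s, hs, h, h'⟩ := exists_finite_kernel hX x
  have := hs.to_subtype
  have hcl (A : s) : IsClosed ((pair a b).hom ⁻¹' A.1) :=
    (h A.1 A.2).1.preimage (CompHaus.continuous_hom (pair a b).hom)
  let j (A : s) : E.sub _ (hcl A) ⟶ E := CHaus.homOf ⟨Subtype.val, continuous_subtype_val⟩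
  refine CHaus.eq_of_finite_cover X.property j (fun e => ?_) fun A => ?_
  · obtain ⟨A, hA, he⟩ := h' _ _ (hab e)
    exact ⟨⟨A, hA⟩, ⟨e, he⟩, rfl⟩
  · obtain ⟨hA, e⟩ := h A.1 A.2
    have := congrArg (Psh.pb X.obj (subLift A.1 hA (j A ≫ a) (j A ≫ b) fun t => t.2)) e
    rw [← Psh.pb_comp, ← Psh.pb_comp] at this
    rw [← Psh.pb_comp, ← Psh.pb_comp]
    exact this

theorem exists_amalgam (X : CondK κ) {K L : CHaus κ} (x : X.obj.obj (op K))
    (y : X.obj.obj (op L)) : ∃ (M : CHaus κ) (z : X.obj.obj (op M)) (a : K ⟶ M) (b : L ⟶ M),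
      Psh.pb X.obj a z = x ∧ Psh.pb X.obj b z = y := by
  let A : Bool → CHaus κ := fun b => cond b K L
  obtain ⟨z, hz, -⟩ := CHaus.existsUnique_glue X.property A fun b => match b with
    | true => x
    | false => y
  exact ⟨_, z, CHaus.sigmaι A true, CHaus.sigmaι A false, hz true, hz false⟩

theorem eq_of_val_eq (hX : IsQuasiseparated X) {K : CHaus κ} {x y : X.obj.obj (op K)}
    (h : ∀ k, val x k = val y k) : x = y := by
  obtain ⟨M, z, a, b, rfl, rfl⟩ := exists_amalgam X x y
  refine pb_eq_of_val_eq hX z a b fun k => ?_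
  rw [← val_pb, ← val_pb, h]

/-- The sections of a quasiseparated condensed set form an atlas for its set of points. -/
def atlas (hX : IsQuasiseparated X) : Cmp.Atlas (X.obj.obj (op (CHaus.pt : CHaus κ)))
    (Σ K : CHaus κ, X.obj.obj (op K)) where
  K j := j.1.obj
  q j := val j.2
  nonempty := by
    obtain ⟨x, -⟩ := CHaus.existsUnique_glue X.property (fun i : Empty => i.elim) fun i => i.elim
    exact ⟨⟨_, x⟩⟩
  cover z := ⟨⟨_, z⟩, PUnit.unit, val_pt z⟩
  isClosed j := isClosed_val_eq hX j.2
  directed i j := by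
    obtain ⟨M, z, a, b, ha, hb⟩ := exists_amalgam X i.2 j.2
    exact ⟨⟨M, z⟩, a.hom, b.hom, fun k => by rw [← ha, val_pb], fun k => by rw [← hb, val_pb]⟩
  sub j A hA := by
    let i : j.1.sub A hA ⟶ j.1 := CHaus.homOf ⟨Subtype.val, continuous_subtype_val⟩
    exact ⟨⟨_, Psh.pb X.obj i j.2⟩, i.hom, Subtype.range_val, fun k => (val_pb i j.2 k).symm⟩

/-- The canonical morphism from a quasiseparated condensed set to a compactological set. -/
def toOfCmp (hX : IsQuasiseparated X) : X ⟶ ofCmp κ (atlas hX).toCmp :=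
  ObjectProperty.homMk <| Psh.homMk
    (fun K x => Cmp.secMk (C := (atlas hX).toCmp) (val x) ((atlas hX).cont_q ⟨K, x⟩))
    fun f x => Cmp.sec_ext fun k => val_pb f x k

/-- For surjectivity, a bounded continuous `f` lands in the image of a section `y` over some `L`.
The pullback of `y` to the fibre product of `K` and `L` descends to `K`, because sections are
determined by their points. -/
theorem bijective_toOfCmp (hX : IsQuasiseparated X) (K : CHaus κ) :
    Function.Bijective ((toOfCmp hX).hom.app (op K)) := by
  refine ⟨fun x y h => eq_of_val_eq hX fun k => congrArg (fun s => evK s k) h, fun f => ?_⟩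
  obtain ⟨⟨L, y⟩, hy⟩ := (atlas hX).exists_of_cont (cont_evK f)
  have hP : IsClosed {p : K.obj × L.obj | evK f p.1 = val y p.2} :=
    (cont_evK f).isClosed_eq ((atlas hX).cont_q ⟨L, y⟩)
  obtain ⟨x, hx⟩ := CHaus.exists_pb_eq X.property (subFst _ hP)
    (fun k => by
      obtain ⟨l, hl⟩ := hy k
      exact ⟨⟨(k, l), hl.symm⟩, rfl⟩) (Psh.pb X.obj (subSnd _ hP) y)
    fun E a b hab => by
      rw [← Psh.pb_comp, ← Psh.pb_comp]
      refine pb_eq_of_val_eq hX y _ _ fun e => ?_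
      have h₁ := (a.hom e).2
      have h₂ := (b.hom e).2
      exact h₁.symm.trans ((congrArg (evK f) (hab e)).trans h₂)
  refine ⟨x, evK_ext fun k => ?_⟩
  obtain ⟨l, hl⟩ := hy k
  let p : ((CHaus.prod K L).sub _ hP).obj := ⟨(k, l), hl.symm⟩
  have h : val x k = val y l :=
    (val_pb _ x p).symm.trans ((congrArg (fun z => val z p) hx).trans (val_pb _ y p))
  exact h.trans hl

theorem exists_iso_ofCmp (hX : IsQuasiseparated X) :
    ∃ C : Cmp.{u}, IsSmallCmp κ C ∧ Nonempty (X ≅ ofCmp κ C) := by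
  refine ⟨(atlas hX).toCmp, (atlas hX).isSmallCmp fun j => ⟨j, j.1.property, subset_rfl⟩, ?_⟩
  have : IsIso ((IsCondensed (C := CHaus κ)).ι.map (toOfCmp hX)) :=
    Psh.isIso_of_bijective _ (bijective_toOfCmp hX)
  have := isIso_of_reflects_iso (toOfCmp hX) (IsCondensed (C := CHaus κ)).ι
  exact ⟨asIso (toOfCmp hX)⟩

end CondK

/-! ### The `κ`-small adjunction -/

namespace CmpK

/-- The restricted Yoneda embedding of `Cmp_κ` is the restriction of the one of `Cmp`. -/
def yoIso : CmpK.yo κ ≅ CmpK.incl κ ⋙ Cmp.yo ⋙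
    (Functor.whiskeringLeft _ _ _).obj (IsSmallCompHaus κ).ι.op :=
  NatIso.ofComponents (fun C => NatIso.ofComponents (fun K =>
    ((IsSmallCmp κ).fullyFaithfulι.homEquiv (X := (fromCHaus κ).obj K.unop) (Y := C)).toIso)
    fun f => by ext; rfl) fun F => by ext; rfl

theorem isCondensed_yo (C : CmpK κ) : IsCondensed ((CmpK.yo κ).obj C) :=
  Psh.isCondensed_of_iso ((yoIso κ).app C).symm
    (CHaus.isCondensed_restrict (Cmp.isCondensed_yo C.obj))

/-- The embedding of `Cmp_κ` into `Cond_κ` is the restriction of the one of `Cmp` into `Cond`. -/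
def toCondIso : CmpK.toCond κ (isCondensed_yo κ) ≅
    CmpK.incl κ ⋙ Cmp.toCond Cmp.isCondensedSet_yo ⋙ Cond.res κ :=
  ((IsCondensed (C := CHaus κ)).fullyFaithfulι.whiskeringRight _).preimageIso (yoIso κ)

theorem isIso_whiskerLeft_counit : IsIso (Functor.whiskerLeft
    (CmpK.incl κ ⋙ Cmp.toCond Cmp.isCondensedSet_yo) (CondK.toCondAdj κ).counit) := by
  have (C : CmpK κ) : IsIso ((Functor.whiskerLeft
      (CmpK.incl κ ⋙ Cmp.toCond Cmp.isCondensedSet_yo) (CondK.toCondAdj κ).counit).app C) :=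
    CondK.isIso_toCondAdj_counit_app κ (isKGenerated_of_isLocallyKSmall (Cmp.isCondensed_yo C.obj)
      (Cmp.isLocallyKSmall_yo C.property))
  exact NatIso.isIso_of_isIso_app _

/-- The embeddings of compactological sets into condensed sets commute with the inclusions of the
`κ`-small categories. -/
def inclToCondIso : CmpK.incl κ ⋙ Cmp.toCond Cmp.isCondensedSet_yo ≅
    CmpK.toCond κ (isCondensed_yo κ) ⋙ CondK.toCond κ :=
  have := isIso_whiskerLeft_counit κ
  (asIso (Functor.whiskerLeft (CmpK.incl κ ⋙ Cmp.toCond Cmp.isCondensedSet_yo)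
    (CondK.toCondAdj κ).counit)).symm ≪≫
    (Functor.isoWhiskerRight (toCondIso κ) (CondK.toCond κ)).symm

instance faithful_toCond : (CmpK.toCond κ (isCondensed_yo κ)).Faithful :=
  Functor.Faithful.of_comp_iso (inclToCondIso κ).symm

instance full_toCond : (CmpK.toCond κ (isCondensed_yo κ)).Full :=
  have := (CondK.fullyFaithfulToCond κ).faithful
  Functor.Full.of_comp_faithful_iso (inclToCondIso κ).symm

theorem isQuasiseparated_toCond (C : CmpK κ) :
    CondK.IsQuasiseparated ((CmpK.toCond κ (isCondensed_yo κ)).obj C) :=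
  CondK.isQuasiseparated_of_iso ((toCondIso κ).app C).symm (CondK.isQuasiseparated_ofCmp C.obj)

/-- The embedding of `Cmp_κ` into the quasiseparated `κ`-condensed sets. -/
def toQsCond : CmpK κ ⥤ QsCondK κ :=
  ObjectProperty.lift _ (CmpK.toCond κ (isCondensed_yo κ)) (isQuasiseparated_toCond κ)

instance : (toQsCond κ).Faithful := inferInstanceAs (ObjectProperty.lift _ _ _).Faithful

instance : (toQsCond κ).Full := inferInstanceAs (ObjectProperty.lift _ _ _).Full

instance : (toQsCond κ).EssSurj where
  mem_essImage X := by
    obtain ⟨C, hC, ⟨e⟩⟩ := CondK.exists_iso_ofCmp X.property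
    exact ⟨⟨C, hC⟩, ⟨CondK.IsQuasiseparated.isoMk ((toCondIso κ).app ⟨C, hC⟩ ≪≫ e.symm)⟩⟩

instance : (toQsCond κ).IsEquivalence where

end CmpK

/-! ### The reflectors for fixed `κ` -/

namespace CondK

/-- The reflector from `κ`-condensed sets to `κ`-small compactological sets. -/
def reflector : CondK κ ⥤ CmpK κ :=
  ObjectProperty.lift _ (toCond κ ⋙ Cond.reflector) fun X =>
    Cond.isSmallCmp_reflection _ (isLocallyKSmall_free X)

/-- The reflectors commute with the embeddings. -/
def reflectorIso : toCond κ ⋙ Cond.reflector ≅ reflector κ ⋙ CmpK.incl κ := Iso.refl _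

/-- The reflector is left adjoint to the embedding of `κ`-small compactological sets. -/
def reflectorAdj : reflector κ ⊣ CmpK.toCond κ (CmpK.isCondensed_yo κ) :=
  Cond.reflectorAdj.restrictFullyFaithful (fullyFaithfulToCond κ) (IsSmallCmp κ).fullyFaithfulι
    (reflectorIso κ) (CmpK.inclToCondIso κ)

/-- Followed by the fully faithful inclusion, which reflects limits, the reflector is the composite
of two functors that preserve finite products. -/
theorem preservesFiniteProducts_reflector : PreservesFiniteProducts (reflector κ) := by
  have := preservesFiniteProducts_toCond κ
  have := Cond.preservesFiniteProducts_reflector.{u}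
  refine ⟨fun n => ?_⟩
  have : PreservesLimitsOfShape (Discrete (Fin n)) (reflector κ ⋙ CmpK.incl κ) :=
    preservesLimitsOfShape_of_natIso (reflectorIso κ)
  exact preservesLimitsOfShape_of_reflects_of_preserves _ (CmpK.incl κ)

/-- The reflector from `κ`-condensed sets to quasiseparated ones. -/
def qsReflector : CondK κ ⥤ QsCondK κ := reflector κ ⋙ CmpK.toQsCond κ

/-- The reflector is left adjoint to the inclusion of the quasiseparated `κ`-condensed sets. -/
def qsReflectorAdj : qsReflector κ ⊣ IsQuasiseparated.ι :=
  -- The composite right adjoint is the inverse of the equivalence followed by the embedding; the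
  -- counit of the equivalence identifies it with the inclusion.
  ((reflectorAdj κ).comp (CmpK.toQsCond κ).asEquivalence.toAdjunction).ofNatIsoRight
    (Functor.isoWhiskerLeft (CmpK.toQsCond κ).inv
        (Iso.refl (CmpK.toQsCond κ ⋙ IsQuasiseparated.ι)) ≪≫
      (Functor.associator _ _ _).symm ≪≫
      Functor.isoWhiskerRight (CmpK.toQsCond κ).asEquivalence.counitIso IsQuasiseparated.ι ≪≫
      Functor.leftUnitor _)

end CondK

end

/-- Compactological sets form a reflective subcategory of condensed sets, both for every uncountable
strong limit cardinal `κ` and without size restriction. The `κ`-reflectors are cocontinuous, preserve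
finite products and factor through the reflector onto `qsCond_κ` and an equivalence
`qsCond_κ ≌ Cmp_κ`. `Cond_κ` embeds into `Cond` as the `κ`-generated condensed sets by a left adjoint
`i` of restriction, and the adjunctions are compatible with `i` and the inclusion of `Cmp_κ` in
`Cmp`. -/
theorem mainTheorem12 :
    ∃ (hκ : ∀ (κ : StrongLimitCard.{u}) (C : CmpK κ), IsCondensed ((CmpK.yo κ).obj C))
      (h : ∀ C : Cmp.{u}, IsCondensedSet (Cmp.yo.obj C))
      (Lκ : ∀ κ : StrongLimitCard.{u}, CondK κ ⥤ CmpK κ)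
      (adjκ : ∀ κ : StrongLimitCard.{u}, Lκ κ ⊣ CmpK.toCond κ (hκ κ))
      (L : Cond.{u} ⥤ Cmp.{u}) (adj : L ⊣ Cmp.toCond h),
      (∀ κ : StrongLimitCard.{u},
        (CmpK.toCond κ (hκ κ)).Full ∧ (CmpK.toCond κ (hκ κ)).Faithful ∧
        PreservesColimitsOfSize.{u, u} (Lκ κ) ∧ PreservesFiniteProducts (Lκ κ) ∧
        ∃ (R : CondK κ ⥤ QsCondK κ) (_ : R ⊣ CondK.IsQuasiseparated.ι) (e : QsCondK κ ≌ CmpK κ),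
          Nonempty (e.inverse ⋙ CondK.IsQuasiseparated.ι ≅ CmpK.toCond κ (hκ κ)) ∧
          Nonempty (Lκ κ ≅ R ⋙ e.functor)) ∧
      (Cmp.toCond h).Full ∧ (Cmp.toCond h).Faithful ∧
      PreservesColimitsOfSize.{u, u} L ∧ PreservesFiniteProducts L ∧
      ∀ κ : StrongLimitCard.{u},
        ∃ (i : CondK κ ⥤ Cond.{u}) (_ : i ⊣ Cond.res κ),
          i.Full ∧ i.Faithful ∧
          (∀ X : Cond.{u}, i.essImage X ↔ IsKGenerated κ X.obj) ∧
          ∃ (α : CmpK.incl κ ⋙ Cmp.toCond h ≅ CmpK.toCond κ (hκ κ) ⋙ i)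
            (β : i ⋙ L ≅ Lκ κ ⋙ CmpK.incl κ),
            ∀ X : CondK κ,
              adj.unit.app (i.obj X) ≫ (Cmp.toCond h).map (β.hom.app X) =
                i.map ((adjκ κ).unit.app X) ≫ α.inv.app ((Lκ κ).obj X) := by
  refine ⟨CmpK.isCondensed_yo, Cmp.isCondensedSet_yo, CondK.reflector, CondK.reflectorAdj,
    Cond.reflector, Cond.reflectorAdj, fun κ => ⟨inferInstance, inferInstance,
      (CondK.reflectorAdj κ).leftAdjoint_preservesColimits,
      CondK.preservesFiniteProducts_reflector κ, CondK.qsReflector κ, CondK.qsReflectorAdj κ,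
      (CmpK.toQsCond κ).asEquivalence.symm, ⟨Iso.refl _⟩, ⟨?_⟩⟩,
    inferInstance, inferInstance, Cond.reflectorAdj.leftAdjoint_preservesColimits,
    Cond.preservesFiniteProducts_reflector, fun κ => ⟨CondK.toCond κ, CondK.toCondAdj κ,
      (CondK.fullyFaithfulToCond κ).full, (CondK.fullyFaithfulToCond κ).faithful,
      CondK.essImage_toCond_iff κ, CmpK.inclToCondIso κ, CondK.reflectorIso κ, fun X => ?_⟩⟩
  · exact Functor.isoWhiskerLeft (CondK.reflector κ) (CmpK.toQsCond κ).asEquivalence.unitIso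
  -- The restricted unit is by construction the unrestricted one transported along both comparison
  -- isomorphisms, so `α` cancels against its inverse.
  · rw [CondK.reflectorAdj, Adjunction.map_restrictFullyFaithful_unit_app, Category.assoc,
      Category.assoc, Iso.hom_inv_id_app]
    exact (Category.comp_id _).symm
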